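/- Let $G$ be a connected, simply connected nilpotent (real, finite-dimensional) Lie group with Haar measure $dx$, Lie algebra $\mathfrak g$ and exponential map $\exp:\mathfrak g\to G$, which is a diffeomorphism with inverse $\log$. Let $\mathfrak g^\sharp$ be the dual of $\mathfrak g$ and write $\langle X\mid\xi\rangle=\xi(X)$. Let $dX$ be the Haar measure on $\mathfrak g$ corresponding to $dx$ under $\log$, and let $d\xi$ be the dual Haar measure on $\mathfrak g^\sharp$, i.e. the one for which $(\mathcal F h)(\xi)=\int_{\mathfrak g}e^{-i\langle X\mid\xi\rangle}h(X)\,dX$ is unitary $L^2(\mathfrak g,dX)\to L^2(\mathfrak g^\sharp,d\xi)$. Put $\Xi=G\times\mathfrak g^\sharp$ with the measure $dx\,d\xi$. Scalar products are linear in the first variable. Fix a Schwartz function $\omega:G\to\mathbb C$ (that is, $\omega\circ\exp$ is a Schwartz function on $\mathfrak g$) with $\|\omega\|_{L^2(G)}=1$. For $(z,\zeta)\in\Xi$ let $$\omega_{z,\zeta}(x)=e^{-i\langle\log(zx)\mid\zeta\rangle}\,\omega(zx),\qquad \Omega_{z,\zeta}(u)=\langle u,\omega_{z,\zeta}\rangle\,\omega_{z,\zeta}\quad(u\in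 L^2(G)).$$ For a measurable $f:\Xi\to\mathbb C$ the Berezin operator ${\sf Ber}_\omega(f)$ is the bounded operator on $L^2(G)$ given, whenever it exists, by the weak integral $$\langle{\sf Ber}_\omega(f)u,v\rangle=\int_G\int_{\mathfrak g^\sharp}f(x,\xi)\,\langle\Omega_{x,\xi}(u),v\rangle\,dx\,d\xi,\qquad u,v\in L^2(G),$$ the integrand being integrable for all $u,v\in L^2(G)$. For $1\le s<\infty$ let $\mathbb B^s[L^2(G)]$ be the Schatten–von Neumann class of the bounded operators $T$ on $L^2(G)$ with $\|T\|_{\mathbb B^s}=({\rm Tr}\,|T|^s)^{1/s}<\infty$, and let $\mathbb B^\infty[L^2(G)]$ be the algebra of all bounded operators on $L^2(G)$ with the operator norm. **Theorem.** For every $s\in[1,\infty]$, the operator ${\sf Ber}_\omega(f)$ exists for every $f\in L^s(\Xi)$, and $f\mapsto{\sf Ber}_\omega(f)$ is a linear map from $L^s(\Xi)$ to $\mathbb B^s[L^2(G)]$ with $$\|{\sf Ber}_\omega(f)\|_{\mathbb B^s[L^2(G)]}\le 4^{1/s}\,\|f\|_{L^s(\Xi)}\qquad(f\in L^s(\Xi)),$$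 where $4^{1/\infty}=1$. In particular, if $f\in L^1(\Xi)$, then ${\sf Ber}_\omega(f)$ is a trace-class operator, and $${\rm Tr}\big[{\sf Ber}_\omega(f)\big]=\int_G\int_{\mathfrak g^\sharp}f(x,\xi)\,dx\,d\xi .$$ -/

import Mathlib

open MeasureTheory
open scoped Manifold ContDiff ENNReal SchwartzMap

universe u

namespace Berezin

/-- A smooth real Lie group is regular enough for Mathlib's Lie bracket on `GroupLieAlgebra`. -/
instance instLEInftyMinSmoothness : ENat.LEInfty (minSmoothness ℝ 3) :=
  ⟨by rw [minSmoothness_of_isRCLikeNormedField]; exact ENat.LEInfty.out⟩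

noncomputable section LieGroupPart

variable {E : Type*} [NormedAddCommGroup E] [NormedSpace ℝ E]
  {G : Type*} [TopologicalSpace G] [ChartedSpace E G] [Group G] [LieGroup 𝓘(ℝ, E) ∞ G]

/-- Left translates of integral curves of a left-invariant vector field are integral curves. -/
theorem hasMFDerivAt_mul_left_curve (X : GroupLieAlgebra 𝓘(ℝ, E) G) (g : G) (γ : ℝ → G) (t : ℝ)
    (h : HasMFDerivAt 𝓘(ℝ, ℝ) 𝓘(ℝ, E) γ t
      ((1 : ℝ →L[ℝ] ℝ).smulRight (mulInvariantVectorField X (γ t)))) :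
    HasMFDerivAt 𝓘(ℝ, ℝ) 𝓘(ℝ, E) (fun s => g * γ s) t
      ((1 : ℝ →L[ℝ] ℝ).smulRight (mulInvariantVectorField X (g * γ t))) := by
  have hM : (∞ : WithTop ℕ∞) ≠ 0 := by simp
  have hg : ∀ a b : G, MDifferentiableAt 𝓘(ℝ, E) 𝓘(ℝ, E) (fun x : G => a * x) b := fun a b =>
    (contMDiff_mul_left (I := 𝓘(ℝ, E)) (n := ∞)).contMDiffAt.mdifferentiableAt hM
  have key : mfderiv 𝓘(ℝ, E) 𝓘(ℝ, E) (fun x : G => g * x) (γ t)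
      (mulInvariantVectorField X (γ t)) = mulInvariantVectorField X (g * γ t) := by
    have hfun : (fun x : G => g * γ t * x) = (fun x => g * x) ∘ (fun x => γ t * x) := by
      funext x; simp [mul_assoc]
    have hcomp := mfderiv_comp (I := 𝓘(ℝ, E)) (I' := 𝓘(ℝ, E)) (I'' := 𝓘(ℝ, E)) (1 : G)
      (g := fun x : G => g * x) (f := fun x : G => γ t * x) (hg _ _) (hg _ _)
    simp only [mulInvariantVectorField]
    rw [hfun, hcomp]
    have hb : ∀ b : G, b = γ t → ∀ w : E,
        (mfderiv 𝓘(ℝ, E) 𝓘(ℝ, E) (fun x : G => g * x) (γ t) : E →L[ℝ] E) w =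
          (mfderiv 𝓘(ℝ, E) 𝓘(ℝ, E) (fun x : G => g * x) b : E →L[ℝ] E) w := by
      rintro _ rfl _
      rfl
    exact hb _ (mul_one _) _
  have h2 := (hg g (γ t)).hasMFDerivAt.comp t h
  have hL : (mfderiv 𝓘(ℝ, E) 𝓘(ℝ, E) (fun x : G => g * x) (γ t)).comp
      ((1 : ℝ →L[ℝ] ℝ).smulRight (mulInvariantVectorField X (γ t))) =
      (1 : ℝ →L[ℝ] ℝ).smulRight (mulInvariantVectorField X (g * γ t)) := by
    rw [← key]
    ext
    simp
  rw [← hL]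
  exact h2

variable [FiniteDimensional ℝ E] [T2Space G]

/-- Every element of the Lie algebra generates a (global) one-parameter curve: an integral curve
through the identity of the associated left-invariant vector field. -/
theorem exists_oneParameter (X : GroupLieAlgebra 𝓘(ℝ, E) G) :
    ∃ γ : ℝ → G, γ 0 = 1 ∧ IsMIntegralCurve γ (mulInvariantVectorField X) := by
  have : CompleteSpace E := FiniteDimensional.complete ℝ E
  have : LieGroup 𝓘(ℝ, E) (minSmoothness ℝ 3) G := inferInstance
  have hv : ContMDiff 𝓘(ℝ, E) (𝓘(ℝ, E).prod 𝓘(ℝ, E)) 1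
      (fun g : G => (mulInvariantVectorField X g : TangentBundle 𝓘(ℝ, E) G)) :=
    (contMDiff_mulInvariantVectorField X).of_le
      (by rw [minSmoothness_of_isRCLikeNormedField]; norm_num)
  obtain ⟨γ, hγ0, hγ⟩ := exists_isMIntegralCurveAt_of_contMDiffAt_boundaryless
    (t₀ := 0) (hv.contMDiffAt (x := (1 : G)))
  obtain ⟨ε, hε, hγ⟩ := isMIntegralCurveAt_iff'.mp hγ
  refine exists_isMIntegralCurve_of_isMIntegralCurveOn hv hε (fun g => ?_) 1
  refine ⟨fun t => g * γ t, by simp [hγ0], fun t ht => ?_⟩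
  have ht' : t ∈ Metric.ball (0 : ℝ) ε := by simpa [Real.ball_eq_Ioo] using ht
  exact (hasMFDerivAt_mul_left_curve X g γ t
    ((hγ t ht').hasMFDerivAt (Metric.isOpen_ball.mem_nhds ht'))).hasMFDerivWithinAt

/-- The exponential map `exp : 𝔤 → G`: `exp X` is the value at time `1` of the integral curve
through `1` of the left-invariant vector field generated by `X`. The Lie algebra
`𝔤 = GroupLieAlgebra 𝓘(ℝ, E) G` is the tangent space at `1`; its underlying vector space is the
model space `E`. -/
def lieExp (X : GroupLieAlgebra 𝓘(ℝ, E) G) : G :=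
  (exists_oneParameter X).choose 1

/-- `exp` does not depend on the choice of the integral curve. -/
theorem lieExp_eq (X : GroupLieAlgebra 𝓘(ℝ, E) G) {γ : ℝ → G} (h0 : γ 0 = 1)
    (h : IsMIntegralCurve γ (mulInvariantVectorField X)) : lieExp X = γ 1 := by
  have : CompleteSpace E := FiniteDimensional.complete ℝ E
  have hv : ContMDiff 𝓘(ℝ, E) (𝓘(ℝ, E).prod 𝓘(ℝ, E)) 1
      (fun g : G => (mulInvariantVectorField X g : TangentBundle 𝓘(ℝ, E) G)) :=
    (contMDiff_mulInvariantVectorField X).of_le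
      (by rw [minSmoothness_of_isRCLikeNormedField]; norm_num)
  obtain ⟨h1, h2⟩ := (exists_oneParameter X).choose_spec
  exact congrFun (isMIntegralCurve_Ioo_eq_of_contMDiff_boundaryless (t₀ := 0) hv h2 h
    (h1.trans h0.symm)) 1

/-- The logarithm `log : G → 𝔤`, the inverse of the exponential map; its values are written in the
underlying vector space `E` of `𝔤`. -/
def lieLog (x : G) : E :=
  Function.invFun (fun X : E => lieExp (G := G) X) x

/-- `w : G → ℂ` is a Schwartz function on `G`: the function `w ∘ exp` is a Schwartz function on the
vector space underlying `𝔤`. -/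
def IsSchwartz (w : G → ℂ) : Prop :=
  ∃ φ : 𝓢(E, ℂ), ∀ X : E, w (lieExp (G := G) X) = φ X

/-- The coherent state `w_{z,ζ}(x) = exp (-i ⟨log (z x) | ζ⟩) w (z x)` at the point `(z, ζ)` of the
phase space `Ξ = G × 𝔤♯`. -/
def coherentState (w : G → ℂ) (p : G × StrongDual ℝ E) (x : G) : ℂ :=
  Complex.exp (-(Complex.I * ((p.2 (lieLog (p.1 * x)) : ℝ) : ℂ))) * w (p.1 * x)

end LieGroupPart

noncomputable section MeasurePart

variable {E : Type*} [NormedAddCommGroup E] [NormedSpace ℝ E] [FiniteDimensional ℝ E]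
  [MeasurableSpace E] [BorelSpace E]

/-- The Haar measure `dξ` on the dual space `𝔤♯` which is dual to the Haar measure `ν = dX` on `𝔤`:
the one for which the Fourier transform `(𝓕 h)(ξ) = ∫ exp (-i ⟨X | ξ⟩) h X dX` is unitary from
`L²(𝔤, dX)` to `L²(𝔤♯, dξ)`. If `dX` is `c` times the Lebesgue measure in the coordinates of a basis
`b` of `𝔤`, where `c = ν (parallelepiped b)`, then `dξ` is `((2π)ⁿ c)⁻¹` times the Lebesgue measure
in the coordinates of the dual basis. -/
def dualHaar (ν : Measure E) : Measure (StrongDual ℝ E) :=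
  (ENNReal.ofReal ((2 * Real.pi) ^ Module.finrank ℝ E) *
      ν (parallelepiped (Module.finBasis ℝ E)))⁻¹ •
    ((Module.finBasis ℝ E).dualBasis.map
      (LinearMap.toContinuousLinearMap : (E →ₗ[ℝ] ℝ) ≃ₗ[ℝ] StrongDual ℝ E)).addHaar

variable {G : Type*} [TopologicalSpace G] [T2Space G] [ChartedSpace E G] [Group G]
  [LieGroup 𝓘(ℝ, E) ∞ G] [MeasurableSpace G]

/-- The Haar measure `dX` on the Lie algebra that corresponds to the Haar measure `μ = dx` on `G`
under the logarithm. -/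
def lieAlgebraHaar (E : Type*) [NormedAddCommGroup E] [NormedSpace ℝ E] [FiniteDimensional ℝ E]
    [MeasurableSpace E] {G : Type*} [TopologicalSpace G] [T2Space G] [ChartedSpace E G] [Group G]
    [LieGroup 𝓘(ℝ, E) ∞ G] [MeasurableSpace G] (μ : Measure G) : Measure E :=
  μ.map lieLog

/-- The product measure `dx dξ` on the phase space `Ξ = G × 𝔤♯`. -/
def phaseMeasure (E : Type*) [NormedAddCommGroup E] [NormedSpace ℝ E] [FiniteDimensional ℝ E]
    [MeasurableSpace E] [BorelSpace E] {G : Type*} [TopologicalSpace G] [T2Space G]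
    [ChartedSpace E G] [Group G] [LieGroup 𝓘(ℝ, E) ∞ G] [MeasurableSpace G] (μ : Measure G) :
    Measure (G × StrongDual ℝ E) :=
  μ.prod (dualHaar (lieAlgebraHaar E μ))

/-- The scalar product `⟨u, w_p⟩ = ∫ u(x) conj(w_p(x)) dx` of `u ∈ L²(G)` with the coherent state
at the point `p` of the phase space. -/
def coherentCoeff (μ : Measure G) (w : G → ℂ) (u : Lp ℂ 2 μ) (p : G × StrongDual ℝ E) : ℂ :=
  ∫ x, u x * starRingEnd ℂ (coherentState w p x) ∂μ

/-- The matrix element `⟨Ω_p u, v⟩` of the rank one operator `Ω_p = ⟨·, w_p⟩ w_p` attached to the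
coherent state at `p`, that is, `⟨u, w_p⟩ ⟨w_p, v⟩`. -/
def rankOneElement (μ : Measure G) (w : G → ℂ) (u v : Lp ℂ 2 μ) (p : G × StrongDual ℝ E) : ℂ :=
  coherentCoeff μ w u p * starRingEnd ℂ (coherentCoeff μ w v p)

/-- The bounded operator `T` on `L²(G)` is the weak integral `∫ f(p) Ω_p dp` over the phase space:
for all `u, v ∈ L²(G)` the function `f(p) ⟨Ω_p u, v⟩` is integrable, and its integral is `⟨T u, v⟩`
(scalar products linear in the first variable; Mathlib's `inner` is linear in the second). -/
def IsBerezinOperator (μ : Measure G) (w : G → ℂ) (f : G × StrongDual ℝ E → ℂ)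
    (T : Lp ℂ 2 μ →L[ℂ] Lp ℂ 2 μ) : Prop :=
  ∀ u v : Lp ℂ 2 μ,
    Integrable (fun p => f p * rankOneElement μ w u v p) (phaseMeasure E μ) ∧
      inner ℂ v (T u) = ∫ p, f p * rankOneElement μ w u v p ∂(phaseMeasure E μ)

open Classical in
/-- The Berezin operator `Ber_w(f) = ∫ f(p) Ω_p dp` with symbol `f`: the bounded operator on `L²(G)`
which is this integral in the weak sense (and `0` if there is none). -/
def berezin (μ : Measure G) (w : G → ℂ) (f : G × StrongDual ℝ E → ℂ) :
    Lp ℂ 2 μ →L[ℂ] Lp ℂ 2 μ :=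
  if h : ∃ T, IsBerezinOperator μ w f T then h.choose else 0

/-- The weak integral is unique. -/
theorem berezin_eq {μ : Measure G} {w : G → ℂ} {f : G × StrongDual ℝ E → ℂ}
    {T : Lp ℂ 2 μ →L[ℂ] Lp ℂ 2 μ} (hT : IsBerezinOperator μ w f T) : berezin μ w f = T := by
  have h : ∃ T, IsBerezinOperator μ w f T := ⟨T, hT⟩
  rw [berezin, dif_pos h]
  ext1 u
  refine ext_inner_left ℂ fun v => ?_
  rw [(h.choose_spec u v).2, (hT u v).2]

end MeasurePart

noncomputable section SchattenPart

variable {H : Type u} [NormedAddCommGroup H] [InnerProductSpace ℂ H] [CompleteSpace H]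

/-- The trace in `[0, ∞]` of a positive operator `A`: the sum of the diagonal matrix elements
`⟨A e, e⟩` over an orthonormal basis. For positive `A` it does not depend on the basis. -/
def positiveTrace (A : H →L[ℂ] H) : ℝ≥0∞ :=
  ∑' e : (exists_hilbertBasis ℂ H).choose, ENNReal.ofReal (inner ℂ (e : H) (A e)).re

open Classical in
/-- The Schatten–von Neumann norm of exponent `s ∈ [1, ∞]`, with values in `[0, ∞]`. For `s < ∞` it
is `(Tr |T|ˢ)^(1/s)`, and for `s = ∞` it is the operator norm. -/
def schattenNorm (s : ℝ≥0∞) (T : H →L[ℂ] H) : ℝ≥0∞ :=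
  if s = ⊤ then ‖T‖ₑ
  else positiveTrace (CFC.rpow (CFC.abs T) s.toReal) ^ s.toReal⁻¹

/-- `T` belongs to the Schatten–von Neumann class of exponent `s`, that is, its norm of exponent `s`
is finite. Exponent `1` gives the trace-class operators, exponent `∞` all bounded operators. -/
def MemSchatten (s : ℝ≥0∞) (T : H →L[ℂ] H) : Prop :=
  schattenNorm s T < ⊤

/-- The operator `T` has the trace `t`: the series of the diagonal matrix elements `⟨T bᵢ, bᵢ⟩`
converges unconditionally to `t`, for every orthonormal basis `b`. -/
def HasTrace (T : H →L[ℂ] H) (t : ℂ) : Prop :=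
  ∀ (ι : Type u) (b : HilbertBasis ι ℂ H), HasSum (fun i => inner ℂ (b i) (T (b i))) t

end SchattenPart

end Berezin

set_option linter.unusedSectionVars false

/-! Everything follows from two properties of the coherent states: they are unit vectors of `L²(G)`,
and they resolve the identity, `∫ |⟨u, w_p⟩|² dp = ‖u‖²`. For unit vectors `u, v` the weight `|⟨u,
w_p⟩| |⟨v, w_p⟩|` then has total mass at most 1 by Cauchy–Schwarz, so Jensen's inequality gives `|⟨T
u, v⟩|^s ≤ ∫ |f|^s |⟨u, w_p⟩| |⟨v, w_p⟩| dp` for `T = Ber(f)` and finite `s`. Summing over two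
orthonormal families and using Bessel's inequality at each `p` leaves at most `∫ |f|^s`. Since `T`
is compact (Hilbert–Schmidt for simple symbols, which are dense), the singular vectors of `T` are
admissible families and produce `Tr |T|^s`. No interpolation is needed and the constant is 1, which
is at most `4^(1/s)`; the case `s = ∞` is the same estimate for the operator norm. The trace formula
is Parseval's identity `∑ |⟨b_i, w_p⟩|² = 1` integrated against `f`. This half is
`IsCoherentFamily.schattenNorm_le` and `IsCoherentFamily.hasTrace`.

The resolution of the identity (`lintegral_enorm_coherentCoeff_sq`) holds because, for fixed `z`,
the coefficient is the Fourier transform in `ζ` of `X ↦ u(z⁻¹ exp X) conj (w(exp X))`. Plancherel on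
`𝔤` removes `ζ`, and unimodularity of `G` separates the remaining double integral into `‖u‖² ‖w‖²`.

This uses that `exp` is a homeomorphism carrying Lebesgue measure to Haar measure, which is derived
here from the definitions. The curve `exp(-tX) exp(t(X + Y))` solves an ODE with stationary point 1
when `Y = 0`; linearising it gives the left-trivialised derivative `(1 - e^{-ad X}) / ad X` of
`exp`, which is unipotent because `𝔤` is nilpotent. Inverting it yields vector fields on `𝔤` whose
flows lift right translations, so `exp` is a covering map (`isCoveringMap_gexp`), hence a
homeomorphism as `G` is simply connected. Unipotence also makes left translations have Jacobian 1 in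
exponential coordinates. -/

namespace Berezin

/-! ### Nilpotent brackets: the unipotent derivative of `exp` and flows given by finitely many
Picard iterates -/

noncomputable section NilpotentFlow

variable {E : Type*} [NormedAddCommGroup E] [NormedSpace ℝ E]

/-- A descending chain of subspaces, from `⊤` to `⊥`, which a bracket `B` lowers by one step in each
of its arguments. -/
structure NilpotentFiltration (B : E →L[ℝ] E →L[ℝ] E) (N : ℕ → Submodule ℝ E) (n : ℕ) : Prop where
  top : N 0 = ⊤
  bot : N n = ⊥
  anti : Antitone N
  left : ∀ k x, x ∈ N k → ∀ y, B x y ∈ N (k + 1)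
  right : ∀ k y, y ∈ N k → ∀ x, B x y ∈ N (k + 1)

/-- The nilpotent part `1 - (1 - exp (-ad X)) / ad X`, with `ad X = B X` and the series cut after
`n` terms. -/
def expDerivNil (B : E →L[ℝ] E →L[ℝ] E) (n : ℕ) (X : E) : E →L[ℝ] E :=
  -∑ j ∈ Finset.range n, ((-1 : ℝ) ^ (j + 1) / (j + 2).factorial) • (B X) ^ (j + 1)

/-- The left-trivialised derivative `(1 - exp (-ad X)) / ad X` of the exponential map at `X`. -/
def expDeriv (B : E →L[ℝ] E →L[ℝ] E) (n : ℕ) (X : E) : E →L[ℝ] E :=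
  1 - expDerivNil B n X

/-- The inverse of `expDeriv B n X`. -/
def expDerivInv (B : E →L[ℝ] E →L[ℝ] E) (n : ℕ) (X : E) : E →L[ℝ] E :=
  ∑ j ∈ Finset.range n, (expDerivNil B n X) ^ j

/-- The Picard iterates for the vector field `X ↦ expDerivInv B n X Y`. -/
def picardIter (B : E →L[ℝ] E →L[ℝ] E) (n : ℕ) (X Y : E) : ℕ → ℝ → E
  | 0, _ => X
  | k + 1, t => X + ∫ r in (0 : ℝ)..t, expDerivInv B n (picardIter B n X Y k r) Y

/-- The flow of the vector field `X ↦ expDerivInv B n X Y`. -/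
def nilFlow (B : E →L[ℝ] E →L[ℝ] E) (n : ℕ) (X Y : E) (t : ℝ) : E :=
  picardIter B n X Y n t

theorem pow_sub_pow_apply_mem {S : Submodule ℝ E} {P Q : E →L[ℝ] E} (hP : ∀ v ∈ S, P v ∈ S)
    (hPQ : ∀ v, P v - Q v ∈ S) (j : ℕ) (v : E) : (P ^ j) v - (Q ^ j) v ∈ S := by
  induction j with
  | zero => simp
  | succ j ih =>
    rw [pow_succ', pow_succ']
    have : (P * P ^ j) v - (Q * Q ^ j) v =
        P ((P ^ j) v - (Q ^ j) v) + (P ((Q ^ j) v) - Q ((Q ^ j) v)) := by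
      simp
    rw [this]
    exact S.add_mem (hP _ ih) (hPQ _)

theorem continuous_expDerivNil (B : E →L[ℝ] E →L[ℝ] E) (n : ℕ) : Continuous (expDerivNil B n) := by
  unfold expDerivNil
  fun_prop

theorem continuous_expDeriv (B : E →L[ℝ] E →L[ℝ] E) (n : ℕ) : Continuous (expDeriv B n) :=
  continuous_const.sub (continuous_expDerivNil B n)

theorem continuous_expDerivInv (B : E →L[ℝ] E →L[ℝ] E) (n : ℕ) : Continuous (expDerivInv B n) := by
  have := continuous_expDerivNil B n
  unfold expDerivInv
  fun_prop

theorem expDeriv_zero (B : E →L[ℝ] E →L[ℝ] E) (n : ℕ) : expDeriv B n 0 = 1 := by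
  simp [expDeriv, expDerivNil]

theorem expDeriv_eq_sum (B : E →L[ℝ] E →L[ℝ] E) (n : ℕ) (X : E) :
    expDeriv B n X =
      ∑ j ∈ Finset.range (n + 1), ((-1 : ℝ) ^ j / (j + 1).factorial) • (B X) ^ j := by
  rw [Finset.sum_range_succ', expDeriv, expDerivNil, sub_neg_eq_add, add_comm]
  simp

/-- Joint continuity in the starting point, the direction and the time is what later makes the
trivialisations of the covering `exp` continuous. -/
theorem continuous_picardIter (B : E →L[ℝ] E →L[ℝ] E) (n k : ℕ) :
    Continuous fun q : (E × E) × ℝ => picardIter B n q.1.1 q.1.2 k q.2 := by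
  induction k with
  | zero => simp only [picardIter]; fun_prop
  | succ k ih =>
    have := continuous_expDerivInv B n
    simp only [picardIter]
    refine (by fun_prop : Continuous fun q : (E × E) × ℝ => q.1.1).add ?_
    refine intervalIntegral.continuous_parametric_intervalIntegral_of_continuous
      (f := fun (q : (E × E) × ℝ) r =>
        expDerivInv B n (picardIter B n q.1.1 q.1.2 k r) q.1.2) ?_ continuous_snd
    have h1 : Continuous fun q : ((E × E) × ℝ) × ℝ => picardIter B n q.1.1.1 q.1.1.2 k q.2 :=
      ih.comp (f := fun q : ((E × E) × ℝ) × ℝ => (q.1.1, q.2)) (by fun_prop)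
    exact (this.comp h1).clm_apply (by fun_prop)

theorem continuous_nilFlow (B : E →L[ℝ] E →L[ℝ] E) (n : ℕ) :
    Continuous fun q : (E × E) × ℝ => nilFlow B n q.1.1 q.1.2 q.2 :=
  continuous_picardIter B n n

theorem continuous_field_comp (B : E →L[ℝ] E →L[ℝ] E) (n : ℕ) (Y : E) {c : ℝ → E}
    (hc : Continuous c) : Continuous fun r => expDerivInv B n (c r) Y :=
  ((continuous_expDerivInv B n).comp hc).clm_apply continuous_const

theorem continuous_picardIter_time (B : E →L[ℝ] E →L[ℝ] E) (n k : ℕ) (X Y : E) :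
    Continuous (picardIter B n X Y k) :=
  (continuous_picardIter B n k).comp (f := fun t : ℝ => ((X, Y), t)) (by fun_prop)

namespace NilpotentFiltration

variable {B : E →L[ℝ] E →L[ℝ] E} {N : ℕ → Submodule ℝ E} {n : ℕ} (h : NilpotentFiltration B N n)
include h

theorem pow_mem {k : ℕ} {y : E} (hy : y ∈ N k) (x : E) (j : ℕ) : (B x ^ (j + 1)) y ∈ N (k + 1) := by
  induction j with
  | zero => simpa using h.right k y hy x
  | succ j ih =>
    rw [pow_succ']
    exact h.right k _ (h.anti (Nat.le_succ k) ih) x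

theorem iterate_mem {P : E →L[ℝ] E} (hP : ∀ k, ∀ y ∈ N k, P y ∈ N (k + 1)) (j : ℕ) (y : E) :
    (P ^ j) y ∈ N j := by
  induction j with
  | zero => simp [h.top]
  | succ j ih => rw [pow_succ']; exact hP _ _ ih

theorem pow_eq_zero {P : E →L[ℝ] E} (hP : ∀ k, ∀ y ∈ N k, P y ∈ N (k + 1)) : P ^ n = 0 := by
  ext y
  have := h.iterate_mem hP n y
  rwa [h.bot, Submodule.mem_bot] at this

theorem bracket_pow (x : E) : (B x) ^ n = 0 :=
  h.pow_eq_zero fun k y hy => h.right k y hy x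

theorem nil_mem (x : E) (k : ℕ) (y : E) (hy : y ∈ N k) : expDerivNil B n x y ∈ N (k + 1) := by
  simp only [expDerivNil, neg_apply, sum_apply,
    smul_apply]
  exact neg_mem (sum_mem fun j _ => Submodule.smul_mem _ _ (h.pow_mem hy x j))

theorem nil_pow (x : E) : (expDerivNil B n x) ^ n = 0 :=
  h.pow_eq_zero (h.nil_mem x)

theorem expDeriv_mul_inv (x : E) : expDeriv B n x * expDerivInv B n x = 1 := by
  rw [expDeriv, expDerivInv, mul_neg_geom_sum, h.nil_pow, sub_zero]

theorem expDerivInv_mul (x : E) : expDerivInv B n x * expDeriv B n x = 1 := by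
  rw [expDeriv, expDerivInv, geom_sum_mul_neg, h.nil_pow, sub_zero]

/-- `B a - B b = B (a - b)` sends everything into `N (k + 1)`, and `B a` preserves `N (k + 1)`;
powers and sums inherit both facts. Thus the value modulo `N (k + 1)` depends only on the argument
modulo `N k`. -/
theorem nil_sub_mem {k : ℕ} {a b : E} (hab : a - b ∈ N k) (v : E) :
    expDerivNil B n a v - expDerivNil B n b v ∈ N (k + 1) := by
  have key : ∀ j, (B a ^ j) v - (B b ^ j) v ∈ N (k + 1) := fun j => by
    refine pow_sub_pow_apply_mem (fun w hw => h.anti (Nat.le_succ _) (h.right _ w hw a))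
      (fun w => ?_) j v
    have := h.left k _ hab w
    rwa [map_sub] at this
  have : expDerivNil B n a v - expDerivNil B n b v = -∑ j ∈ Finset.range n,
      ((-1 : ℝ) ^ (j + 1) / (j + 2).factorial) • ((B a ^ (j + 1)) v - (B b ^ (j + 1)) v) := by
    simp only [expDerivNil, neg_apply, sum_apply,
      smul_apply, smul_sub, Finset.sum_sub_distrib]
    abel
  rw [this]
  exact neg_mem (sum_mem fun j _ => Submodule.smul_mem _ _ (key _))

theorem inv_sub_mem {k : ℕ} {a b : E} (hab : a - b ∈ N k) (v : E) :
    expDerivInv B n a v - expDerivInv B n b v ∈ N (k + 1) := by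
  simp only [expDerivInv, sum_apply]
  rw [← Finset.sum_sub_distrib]
  exact sum_mem fun j _ => pow_sub_pow_apply_mem
    (fun w hw => h.anti (Nat.le_succ _) (h.nil_mem a _ w hw)) (h.nil_sub_mem hab) j v

variable [FiniteDimensional ℝ E]

theorem intervalIntegral_sub_mem {k : ℕ} (Y : E) {c d : ℝ → E} (hc : Continuous c)
    (hd : Continuous d) (hcd : ∀ t, c t - d t ∈ N k) (t : ℝ) :
    (∫ r in (0 : ℝ)..t, expDerivInv B n (c r) Y) - ∫ r in (0 : ℝ)..t, expDerivInv B n (d r) Y ∈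
      N (k + 1) := by
  have : CompleteSpace E := FiniteDimensional.complete ℝ E
  have hc' := continuous_field_comp B n Y hc
  have hd' := continuous_field_comp B n Y hd
  rw [← intervalIntegral.integral_sub (hc'.intervalIntegrable _ _) (hd'.intervalIntegrable _ _)]
  set f : ℝ → E := fun r => expDerivInv B n (c r) Y - expDerivInv B n (d r) Y with hf
  have hfm : ∀ r, f r ∈ N (k + 1) := fun r => h.inv_sub_mem (hcd r) Y
  -- Integrating inside the finite-dimensional, hence complete, subspace keeps the integral in it.
  let g : ℝ → N (k + 1) := fun r => ⟨f r, hfm r⟩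
  have hg : f = fun r => (N (k + 1)).subtypeL (g r) := rfl
  have hgi : IntervalIntegrable g volume 0 t :=
    ((hc'.sub hd').subtype_mk hfm).intervalIntegrable _ _
  have : CompleteSpace (N (k + 1)) := FiniteDimensional.complete ℝ _
  rw [hg, ContinuousLinearMap.intervalIntegral_comp_comm _ hgi]
  exact Subtype.property _

/-- Each Picard step gains one level of the filtration by `inv_sub_mem`. At level `n` the filtration
vanishes, so the `n`-th iterate is the exact solution; this gives global existence and uniqueness
without estimates. -/
theorem solution_sub_picardIter_mem {Y : E} {c : ℝ → E}
    (hc : ∀ t, HasDerivAt c (expDerivInv B n (c t) Y) t) (k : ℕ) (t : ℝ) :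
    c t - picardIter B n (c 0) Y k t ∈ N k := by
  have : CompleteSpace E := FiniteDimensional.complete ℝ E
  have hcc : Continuous c := continuous_iff_continuousAt.2 fun t => (hc t).continuousAt
  induction k generalizing t with
  | zero => simp [h.top]
  | succ k ih =>
    have h1 : c t = c 0 + ∫ r in (0 : ℝ)..t, expDerivInv B n (c r) Y := by
      rw [intervalIntegral.integral_eq_sub_of_hasDerivAt (fun r _ => hc r)
        ((continuous_field_comp B n Y hcc).intervalIntegrable _ _)]
      abel
    rw [picardIter, h1, add_sub_add_left_eq_sub]
    exact h.intervalIntegral_sub_mem Y hcc (continuous_picardIter_time B n k _ Y) ih t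

theorem eq_nilFlow {Y : E} {c : ℝ → E} (hc : ∀ t, HasDerivAt c (expDerivInv B n (c t) Y) t)
    (t : ℝ) : c t = nilFlow B n (c 0) Y t := by
  have := h.solution_sub_picardIter_mem hc n t
  rwa [h.bot, Submodule.mem_bot, sub_eq_zero] at this

theorem picardIter_succ_sub_mem (X Y : E) (k : ℕ) (t : ℝ) :
    picardIter B n X Y (k + 1) t - picardIter B n X Y k t ∈ N k := by
  induction k generalizing t with
  | zero => simp [h.top]
  | succ k ih =>
    rw [picardIter.eq_2 B n X Y t (k + 1), picardIter.eq_2 B n X Y t k, add_sub_add_left_eq_sub]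
    exact h.intervalIntegral_sub_mem Y (continuous_picardIter_time B n _ _ Y)
      (continuous_picardIter_time B n _ _ Y) ih t

theorem nilFlow_eq (X Y : E) (t : ℝ) :
    nilFlow B n X Y t = X + ∫ r in (0 : ℝ)..t, expDerivInv B n (nilFlow B n X Y r) Y := by
  have := h.picardIter_succ_sub_mem X Y n t
  rw [h.bot, Submodule.mem_bot, sub_eq_zero] at this
  rw [nilFlow, ← this, picardIter]
  rfl

theorem nilFlow_zero (X Y : E) : nilFlow B n X Y 0 = X := by
  rw [h.nilFlow_eq]; simp

theorem hasDerivAt_nilFlow (X Y : E) (t : ℝ) :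
    HasDerivAt (nilFlow B n X Y) (expDerivInv B n (nilFlow B n X Y t) Y) t := by
  have : CompleteSpace E := FiniteDimensional.complete ℝ E
  have hcont := continuous_field_comp B n Y (continuous_picardIter_time B n n X Y)
  have h1 := (intervalIntegral.integral_hasDerivAt_right (hcont.intervalIntegrable 0 t)
    (hcont.stronglyMeasurableAtFilter _ _) hcont.continuousAt).const_add X
  have h2 : nilFlow B n X Y =
      fun t => X + ∫ r in (0 : ℝ)..t, expDerivInv B n (nilFlow B n X Y r) Y :=
    funext (h.nilFlow_eq X Y)
  rw [h2]
  have h3 := h1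
  simp only [← h.nilFlow_eq X Y t]
  exact h3

/-- The reversed curve solves the equation for `-Y`, and solutions are unique. -/
theorem nilFlow_neg_nilFlow (X Y : E) : nilFlow B n (nilFlow B n X Y 1) (-Y) 1 = X := by
  have hc : ∀ t, HasDerivAt (fun t => nilFlow B n X Y (1 - t))
      (expDerivInv B n (nilFlow B n X Y (1 - t)) (-Y)) t := fun t => by
    have h1 : HasDerivAt (fun t : ℝ => 1 - t) (-1) t := by
      simpa using (hasDerivAt_id t).const_sub 1
    have h2 := HasDerivAt.scomp t (h.hasDerivAt_nilFlow X Y (1 - t)) h1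
    rw [neg_one_smul] at h2
    rw [map_neg]
    exact h2
  have := h.eq_nilFlow hc 1
  simpa [h.nilFlow_zero] using this.symm

/-- `det (1 - P)` is the characteristic polynomial of `P` at 1, which is a pure power of the
variable when `P` is nilpotent. -/
theorem det_expDeriv (X : E) : LinearMap.det (expDeriv B n X : E →ₗ[ℝ] E) = 1 := by
  have hnil : IsNilpotent ((expDerivNil B n X : E →L[ℝ] E) : E →ₗ[ℝ] E) := by
    refine ⟨n, ?_⟩
    rw [← ContinuousLinearMap.toLinearMap_pow, h.nil_pow]
    rfl
  have h1 := LinearMap.eval_charpoly ((expDerivNil B n X : E →L[ℝ] E) : E →ₗ[ℝ] E) 1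
  rw [hnil.charpoly_eq_X_pow_finrank] at h1
  simpa [expDeriv] using h1.symm

end NilpotentFiltration

end NilpotentFlow

/-! ### Linearisation of an ODE at a stationary point, in a chart -/

section Linearization

open Set Filter Topology

variable {E : Type*} [NormedAddCommGroup E] [NormedSpace ℝ E]

/-- Grönwall's inequality with zero initial value; `K ≥ 1` and times at most 1 allow a constant that
depends on `K` alone. -/
theorem norm_le_mul_exp_of_deriv_le {f f' : ℝ → E} {K ε T : ℝ} (hK : 1 ≤ K) (hε : 0 ≤ ε)
    (hT : T ≤ 1) (hf : ContinuousOn f (Icc 0 T))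
    (hf' : ∀ t ∈ Ico 0 T, HasDerivWithinAt f (f' t) (Ici t) t) (h0 : f 0 = 0)
    (hb : ∀ t ∈ Ico 0 T, ‖f' t‖ ≤ K * ‖f t‖ + ε) : ∀ t ∈ Icc 0 T, ‖f t‖ ≤ ε * Real.exp K := by
  intro t ht
  have h1 := norm_le_gronwallBound_of_norm_deriv_right_le (δ := 0) hf hf' (by simp [h0]) hb t ht
  refine h1.trans ?_
  rw [gronwallBound_of_K_ne_0 (by positivity)]
  simp only [zero_mul, zero_add, sub_zero]
  have h2 : Real.exp (K * t) ≤ Real.exp K := Real.exp_le_exp.2 (by nlinarith [ht.1, ht.2])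
  have h3 : ε / K ≤ ε := div_le_self hε hK
  have h4 : 0 ≤ Real.exp (K * t) - 1 := by
    have := Real.one_le_exp (x := K * t) (mul_nonneg (by linarith) ht.1)
    linarith
  calc ε / K * (Real.exp (K * t) - 1) ≤ ε * (Real.exp (K * t) - 1) := by gcongr
    _ ≤ ε * Real.exp K := by gcongr; linarith

/-- The solution of the linear equation `u' = L u + Y`, `u 0 = 0`, for nilpotent `L`. -/
noncomputable def linearSolution (L : E →L[ℝ] E) (n : ℕ) (Y : E) (t : ℝ) : E :=
  ∑ j ∈ Finset.range (n + 1), (t ^ (j + 1) / (j + 1).factorial) • (L ^ j) Y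

theorem hasDerivAt_linearSolution {L : E →L[ℝ] E} {n : ℕ} (hL : L ^ n = 0) (Y : E) (t : ℝ) :
    HasDerivAt (linearSolution L n Y) (L (linearSolution L n Y t) + Y) t := by
  have h1 : HasDerivAt (linearSolution L n Y)
      (∑ j ∈ Finset.range (n + 1), (t ^ j / j.factorial) • (L ^ j) Y) t := by
    unfold linearSolution
    refine HasDerivAt.fun_sum fun j _ => HasDerivAt.smul_const ?_ _
    have := (hasDerivAt_pow (j + 1) t).div_const ((j + 1).factorial : ℝ)
    convert this using 1
    rw [Nat.factorial_succ]
    push_cast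
    field_simp
  convert h1 using 1
  rw [linearSolution, map_sum, Finset.sum_range_succ, Finset.sum_range_succ']
  -- Applying `L` shifts the sum by one index: the top term dies, and the missing bottom term is
  -- `Y`.
  have h2 : L (L ^ n <| Y) = 0 := by rw [hL]; simp
  rw [map_smul, h2, smul_zero, add_zero]
  simp [pow_succ' L]

/-- An a priori bound for, and the linearisation of, an ordinary differential equation near a
stationary point. -/
theorem exists_linearization_bound {F : E × E → E} {L : E →L[ℝ] E} {n : ℕ} (hL : L ^ n = 0) {e : E}
    (hF0 : F (e, 0) = 0)
    (hF : HasFDerivAt F (L.coprod (ContinuousLinearMap.id ℝ E)) (e, 0)) :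
    ∃ C > 0, ∀ ε > 0, ∃ δ > 0, ∀ r : ℝ, r ≤ δ → ∀ Y : E, ‖Y‖ ≤ r → ∀ T ≤ 1, ∀ p : ℝ → E,
      ContinuousOn p (Icc 0 T) → p 0 = e →
      (∀ t ∈ Ico 0 T, HasDerivWithinAt p (F (p t, Y)) (Ici t) t) →
      (∀ t ∈ Ico 0 T, ‖p t - e‖ ≤ r) →
      ∀ t ∈ Icc 0 T, ‖p t - e‖ ≤ C * ‖Y‖ ∧ ‖p t - e - linearSolution L n Y t‖ ≤ ε * ‖Y‖ := by
  set K : ℝ := ‖L‖ + 1 with hK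
  have hK1 : 1 ≤ K := by simp [hK]
  set C : ℝ := 2 * Real.exp K with hC
  have hCpos : 0 < C := by positivity
  refine ⟨C, hCpos, fun ε hε => ?_⟩
  -- The a priori bound needs `η ≤ 1`. The second Grönwall bound, with inhomogeneity `η (C + 1)
  -- ‖Y‖`, needs `η (C + 1) e^K ≤ ε`.
  set η : ℝ := min 1 (ε / ((C + 1) * Real.exp K)) with hη
  have hηpos : 0 < η := lt_min one_pos (by positivity)
  have h1 := (hasFDerivAt_iff_isLittleO.1 hF).bound hηpos
  obtain ⟨δ, hδ, hb⟩ := Metric.eventually_nhds_iff.1 h1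
  refine ⟨δ / 2, by positivity, fun r hr Y hY T hT p hp hp0 hp' hpr => ?_⟩
  have herr : ∀ t ∈ Ico 0 T,
      ‖F (p t, Y) - (L (p t - e) + Y)‖ ≤ η * (‖p t - e‖ + ‖Y‖) := by
    intro t ht
    have h2 := hb (y := (p t, Y)) (by
      rw [Prod.dist_eq, max_lt_iff, dist_eq_norm, dist_eq_norm, sub_zero]
      exact ⟨by linarith [hpr t ht], by linarith⟩)
    simp only [hF0, sub_zero, ContinuousLinearMap.coprod_apply, Prod.mk_sub_mk,
      ContinuousLinearMap.coe_id', id_eq] at h2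
    refine h2.trans ?_
    gcongr
    simp only [Prod.norm_def]
    exact max_le_add_of_nonneg (norm_nonneg _) (norm_nonneg _)
  have hcont : ContinuousOn (fun t => p t - e) (Icc 0 T) := hp.sub continuousOn_const
  have hder : ∀ t ∈ Ico 0 T, HasDerivWithinAt (fun t => p t - e) (F (p t, Y)) (Ici t) t :=
    fun t ht => (hp' t ht).sub_const e
  have hA : ∀ t ∈ Icc 0 T, ‖p t - e‖ ≤ C * ‖Y‖ := by
    have := norm_le_mul_exp_of_deriv_le (ε := 2 * ‖Y‖) hK1 (by positivity) hT hcont hder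
      (by simp [hp0]) (fun t ht => by
        have h2 := herr t ht
        have h3 : η ≤ 1 := min_le_left _ _
        have h4 : ‖F (p t, Y)‖ ≤ ‖F (p t, Y) - (L (p t - e) + Y)‖ + ‖L (p t - e) + Y‖ := by
          simpa using norm_add_le (F (p t, Y) - (L (p t - e) + Y)) (L (p t - e) + Y)
        have h5 : ‖L (p t - e) + Y‖ ≤ ‖L‖ * ‖p t - e‖ + ‖Y‖ :=
          (norm_add_le _ _).trans (by gcongr; exact L.le_opNorm _)
        have h6 : η * (‖p t - e‖ + ‖Y‖) ≤ 1 * (‖p t - e‖ + ‖Y‖) := by gcongr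
        simp only [hK]
        linarith)
    intro t ht
    have := this t ht
    simp only [hC]
    linarith
  intro t ht
  refine ⟨hA t ht, ?_⟩
  have hu := fun t => hasDerivAt_linearSolution hL Y t
  have := norm_le_mul_exp_of_deriv_le (ε := η * (C + 1) * ‖Y‖) hK1 (by positivity) hT
    (hcont.sub (fun t _ => (hu t).continuousAt.continuousWithinAt))
    (fun t ht => (hder t ht).sub (hu t).hasDerivWithinAt)
    (by simp [hp0, linearSolution]) (fun t ht => by
      have h2 := herr t ht
      have h3 := hA t (Ico_subset_Icc_self ht)
      have h4 : F (p t, Y) - (L (linearSolution L n Y t) + Y) =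
          (F (p t, Y) - (L (p t - e) + Y)) + L (p t - e - linearSolution L n Y t) := by
        rw [map_sub L (p t - e)]; abel
      rw [h4]
      refine (norm_add_le _ _).trans ?_
      have h5 : ‖L (p t - e - linearSolution L n Y t)‖ ≤
          K * ‖p t - e - linearSolution L n Y t‖ :=
        (L.le_opNorm _).trans (by gcongr; simp [hK])
      have h6 : η * (‖p t - e‖ + ‖Y‖) ≤ η * (C * ‖Y‖ + ‖Y‖) := by gcongr
      simp only [Pi.sub_apply]
      linarith) t ht
  refine this.trans ?_
  have h7 : η ≤ ε / ((C + 1) * Real.exp K) := min_le_right _ _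
  calc η * (C + 1) * ‖Y‖ * Real.exp K = η * ((C + 1) * Real.exp K) * ‖Y‖ := by ring
    _ ≤ ε / ((C + 1) * Real.exp K) * ((C + 1) * Real.exp K) * ‖Y‖ := by gcongr
    _ = ε * ‖Y‖ := by field_simp

variable [FiniteDimensional ℝ E] {G : Type*} [TopologicalSpace G] [T2Space G]

/-- Differentiation with respect to a parameter of a family of curves which, in a chart, solve an
ordinary differential equation having the centre of the chart as a stationary point. -/
theorem tendsto_and_hasFDerivAt_of_chart_ode (c : OpenPartialHomeomorph G E) {x₀ : G}
    (hx₀ : x₀ ∈ c.source) {F : E × E → E} {L : E →L[ℝ] E} {n : ℕ} (hL : L ^ n = 0)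
    (hF0 : F (c x₀, 0) = 0)
    (hF : HasFDerivAt F (L.coprod (ContinuousLinearMap.id ℝ E)) (c x₀, 0))
    {g : E → ℝ → G} (hg0 : ∀ Y, g Y 0 = x₀) (hgc : ∀ Y, Continuous (g Y))
    (hg : ∀ᶠ x in 𝓝 x₀, ∀ Y t, g Y t = x → HasDerivAt (fun s => c (g Y s)) (F (c x, Y)) t) :
    Tendsto (fun Y => g Y 1) (𝓝 0) (𝓝 x₀) ∧
      HasFDerivAt (fun Y => c (g Y 1))
        (∑ j ∈ Finset.range (n + 1), ((1 : ℝ) / (j + 1).factorial) • L ^ j) 0 := by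
  obtain ⟨C, hC, hb⟩ := exists_linearization_bound hL hF0 hF
  have htgt : c x₀ ∈ c.target := c.map_source hx₀
  have hg' : ∀ᶠ q in 𝓝 (c x₀), q ∈ c.target ∧
      ∀ Y t, g Y t = c.symm q → HasDerivAt (fun s => c (g Y s)) (F (c (c.symm q), Y)) t := by
    refine (c.open_target.eventually_mem htgt).and ?_
    have h1 : Tendsto c.symm (𝓝 (c x₀)) (𝓝 x₀) := by
      have := c.continuousAt_symm htgt
      rwa [ContinuousAt, c.left_inv hx₀] at this
    exact h1.eventually hg
  obtain ⟨ρ, hρ, hball⟩ := Metric.eventually_nhds_iff.1 hg'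
  -- the curves stay in the chart, and are close to the solution of the linearised equation
  have key : ∀ ε > 0, ∀ r' > 0, ∃ δ > 0, ∀ Y : E, ‖Y‖ < δ → g Y 1 ∈ c.source ∧
      ‖c (g Y 1) - c x₀‖ < r' ∧ ‖c (g Y 1) - c x₀ - linearSolution L n Y 1‖ ≤ ε * ‖Y‖ := by
    intro ε hε r' hr'
    obtain ⟨δ, hδ, hbδ⟩ := hb ε hε
    set r : ℝ := min (min δ (ρ / 2)) r' with hr
    have hrpos : 0 < r := by positivity
    have hrδ : r ≤ δ := (min_le_left _ _).trans (min_le_left _ _)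
    have hrρ : r < ρ := ((min_le_left _ _).trans (min_le_right _ _)).trans_lt (by linarith)
    -- This forces `‖Y‖ < r` and `C ‖Y‖ < r`, so that the a priori bound is strictly better than the
    -- assumption under which it is derived.
    refine ⟨min r (r / C), by positivity, fun Y hY => ?_⟩
    have hYr : ‖Y‖ < r := hY.trans_le (min_le_left _ _)
    have hYC : C * ‖Y‖ < r := by
      have := hY.trans_le (min_le_right _ _)
      rwa [lt_div_iff₀ hC, mul_comm] at this
    -- A compact, hence closed, subset of `G` inside the chart domain: staying in `K` is a closed
    -- condition on the curve.
    set K : Set G := c.symm '' Metric.closedBall (c x₀) r with hKdef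
    have hKt : Metric.closedBall (c x₀) r ⊆ c.target := fun q hq =>
      (hball (lt_of_le_of_lt hq hrρ)).1
    have hKcl : IsClosed K :=
      ((isCompact_closedBall _ _).image_of_continuousOn (c.continuousOn_symm.mono hKt)).isClosed
    have hKmem : ∀ x ∈ K, x ∈ c.source ∧ ‖c x - c x₀‖ ≤ r ∧
        ∀ t, g Y t = x → HasDerivAt (fun s => c (g Y s)) (F (c x, Y)) t := by
      rintro x ⟨q, hq, rfl⟩
      refine ⟨c.map_target (hKt hq), ?_, fun t ht => ?_⟩
      · rw [c.right_inv (hKt hq), ← dist_eq_norm]; exact hq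
      · exact (hball (lt_of_le_of_lt hq hrρ)).2 Y t ht
    have hKnhds : ∀ x, x ∈ c.source → ‖c x - c x₀‖ < r → K ∈ 𝓝 x := by
      intro x hx hxr
      have h1 : c.source ∩ c ⁻¹' Metric.ball (c x₀) r ∈ 𝓝 x :=
        (c.isOpen_inter_preimage Metric.isOpen_ball).mem_nhds
          ⟨hx, by rwa [mem_preimage, mem_ball_iff_norm]⟩
      refine mem_of_superset h1 fun y hy => ⟨c y, Metric.ball_subset_closedBall hy.2, c.left_inv hy.1⟩
    have hx₀K : x₀ ∈ K := mem_of_mem_nhds (hKnhds x₀ hx₀ (by simpa using hrpos))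
    have concl : ∀ T ∈ Icc (0 : ℝ) 1, (∀ τ ∈ Icc (0 : ℝ) T, g Y τ ∈ K) →
        ‖c (g Y T) - c x₀‖ ≤ C * ‖Y‖ ∧
          ‖c (g Y T) - c x₀ - linearSolution L n Y T‖ ≤ ε * ‖Y‖ := by
      intro T hT hTK
      refine hbδ r hrδ Y hYr.le T hT.2 (fun t => c (g Y t)) ?_ (by simp [hg0]) ?_ ?_ T
        ⟨hT.1, le_rfl⟩
      · exact fun t ht =>
          ((hKmem _ (hTK t ht)).2.2 t rfl).continuousAt.continuousWithinAt
      · exact fun t ht =>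
          ((hKmem _ (hTK t (Ico_subset_Icc_self ht))).2.2 t rfl).hasDerivWithinAt
      · exact fun t ht => (hKmem _ (hTK t (Ico_subset_Icc_self ht))).2.1
    -- Continuous induction on the times up to which the curve has stayed in `K`. Writing the
    -- earlier times as `σ * t` displays this set as an intersection of closed sets.
    have hall : Icc (0 : ℝ) 1 ⊆ {t | ∀ σ ∈ Icc (0 : ℝ) 1, g Y (σ * t) ∈ K} := by
      refine IsClosed.Icc_subset_of_forall_mem_nhdsWithin (IsClosed.inter ?_ isClosed_Icc) ?_ ?_
      · simp only [ofPred_forall]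
        exact isClosed_biInter fun σ _ => hKcl.preimage ((hgc Y).comp (continuous_const_mul σ))
      · intro σ _
        simpa [hg0] using hx₀K
      · rintro x ⟨hxs, hx⟩
        have hxK : ∀ τ ∈ Icc (0 : ℝ) x, g Y τ ∈ K := by
          intro τ hτ
          rcases hx.1.eq_or_lt with h0 | h0
          · have : τ = 0 := le_antisymm (h0 ▸ hτ.2) hτ.1
            simpa [this, hg0] using hx₀K
          · have := hxs (τ / x) ⟨div_nonneg hτ.1 hx.1, div_le_one_of_le₀ hτ.2 hx.1⟩
            rwa [div_mul_cancel₀ _ h0.ne'] at this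
        have h1 := (concl x ⟨hx.1, hx.2.le⟩ hxK).1.trans_lt hYC
        -- The a priori bound places the curve strictly inside the ball at time `x`, so it remains
        -- in `K` a little longer.
        have h2 : K ∈ 𝓝 (g Y x) := hKnhds _ (hKmem _ (hxK x ⟨hx.1, le_rfl⟩)).1 h1
        obtain ⟨η, hη, hηK⟩ := Metric.eventually_nhds_iff.1 ((hgc Y).continuousAt.eventually h2)
        refine mem_of_superset (Ioo_mem_nhdsGT (show x < x + η by linarith)) ?_
        intro y hy σ hσ
        have hy0 : 0 ≤ y := hx.1.trans hy.1.le
        by_cases hle : σ * y ≤ x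
        · exact hxK _ ⟨mul_nonneg hσ.1 hy0, hle⟩
        · push Not at hle
          refine hηK ?_
          have : σ * y ≤ y := mul_le_of_le_one_left hy0 hσ.2
          rw [Real.dist_eq, abs_lt]
          constructor <;> linarith [hy.2]
    have h1K : ∀ τ ∈ Icc (0 : ℝ) 1, g Y τ ∈ K := fun τ hτ => by
      simpa using hall (right_mem_Icc.2 zero_le_one) τ hτ
    have h2 := concl 1 (right_mem_Icc.2 zero_le_one) h1K
    exact ⟨(hKmem _ (h1K 1 (right_mem_Icc.2 zero_le_one))).1,
      (h2.1.trans_lt hYC).trans_le (min_le_right _ _), h2.2⟩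
  have hnear : ∀ᶠ Y in 𝓝 (0 : E), g Y 1 ∈ c.source := by
    obtain ⟨δ, hδ, hk⟩ := key 1 one_pos 1 one_pos
    exact Metric.eventually_nhds_iff.2 ⟨δ, hδ, fun Y hY => (hk Y (by simpa using hY)).1⟩
  constructor
  · have h1 : Tendsto (fun Y => c (g Y 1)) (𝓝 0) (𝓝 (c x₀)) := by
      rw [Metric.tendsto_nhds_nhds]
      intro r' hr'
      obtain ⟨δ, hδ, hk⟩ := key 1 one_pos r' hr'
      exact ⟨δ, hδ, fun Y hY => by
        rw [dist_eq_norm]; exact (hk Y (by simpa using hY)).2.1⟩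
    have h2 : Tendsto c.symm (𝓝 (c x₀)) (𝓝 x₀) := by
      have := c.continuousAt_symm htgt
      rwa [ContinuousAt, c.left_inv hx₀] at this
    exact (h2.comp h1).congr' (hnear.mono fun Y hY => c.left_inv hY)
  · rw [hasFDerivAt_iff_isLittleO, Asymptotics.isLittleO_iff]
    intro ε hε
    obtain ⟨δ, hδ, hk⟩ := key ε hε 1 one_pos
    refine Metric.eventually_nhds_iff.2 ⟨δ, hδ, fun Y hY => ?_⟩
    -- No uniqueness theorem is needed for `Y = 0`: the error bound itself is then zero.
    have h0 : g 0 1 = x₀ := by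
      have h3 := hk 0 (by simpa using hδ)
      have h4 : ‖c (g 0 1) - c x₀‖ ≤ 0 := by simpa [linearSolution] using h3.2.2
      exact c.injOn h3.1 hx₀ (sub_eq_zero.1 (norm_le_zero_iff.1 h4))
    have := (hk Y (by simpa using hY)).2.2
    simpa [h0, linearSolution] using this

end Linearization

/-! ### One-parameter subgroups and the multiplication in the chart at the identity -/

noncomputable section OneParameter

open Set Filter Topology

variable {E : Type*} [NormedAddCommGroup E] [NormedSpace ℝ E] [FiniteDimensional ℝ E]
  {G : Type*} [TopologicalSpace G] [T2Space G] [ChartedSpace E G] [Group G] [LieGroup 𝓘(ℝ, E) ∞ G]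

/-- The exponential map as a map on the vector space underlying the Lie algebra. -/
def gexp (X : E) : G := lieExp (G := G) (X : GroupLieAlgebra 𝓘(ℝ, E) G)

/-- The left-invariant vector field generated by a vector of the model space. -/
abbrev leftField (G : Type*) [TopologicalSpace G] [ChartedSpace E G] [Group G] (X : E) (g : G) :
    TangentSpace 𝓘(ℝ, E) g :=
  mulInvariantVectorField (I := 𝓘(ℝ, E)) (G := G) X g

theorem contMDiff_leftField (X : E) :
    ContMDiff 𝓘(ℝ, E) (𝓘(ℝ, E).prod 𝓘(ℝ, E)) 1
      (fun g : G => (⟨g, leftField G X g⟩ : TangentBundle 𝓘(ℝ, E) G)) := by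
  have : CompleteSpace E := FiniteDimensional.complete ℝ E
  exact (contMDiff_mulInvariantVectorField (I := 𝓘(ℝ, E)) (G := G) X).of_le
    (by rw [minSmoothness_of_isRCLikeNormedField]; norm_num)

theorem integralCurve_eq {X : E} {γ γ' : ℝ → G} (h : IsMIntegralCurve γ (leftField G X))
    (h' : IsMIntegralCurve γ' (leftField G X)) (h0 : γ 0 = γ' 0) : γ = γ' := by
  have : CompleteSpace E := FiniteDimensional.complete ℝ E
  exact isMIntegralCurve_Ioo_eq_of_contMDiff_boundaryless (t₀ := 0) (contMDiff_leftField X) h h' h0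

theorem gexp_smul_eq {X : E} {γ : ℝ → G} (h0 : γ 0 = 1) (h : IsMIntegralCurve γ (leftField G X))
    (t : ℝ) : gexp (t • X) = γ t := by
  have h1 := h.comp_mul t
  have h2 : t • leftField G X = leftField G (t • X) :=
    (mulInvariantVectorField_smul (I := 𝓘(ℝ, E)) (G := G) t X).symm
  rw [h2] at h1
  exact (lieExp_eq _ (by simp [h0]) h1).trans (by simp)

theorem isMIntegralCurve_gexp (X : E) :
    IsMIntegralCurve (fun t : ℝ => gexp (G := G) (t • X)) (leftField G X) := by
  obtain ⟨γ, h0, h⟩ := exists_oneParameter (E := E) (G := G) X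
  have : (fun t : ℝ => gexp (G := G) (t • X)) = γ := funext fun t => gexp_smul_eq h0 h t
  rw [this]
  exact h

theorem gexp_zero : gexp (0 : E) = (1 : G) := by
  obtain ⟨γ, h0, h⟩ := exists_oneParameter (E := E) (G := G) (0 : E)
  have := gexp_smul_eq h0 h 0
  rwa [h0, zero_smul] at this

theorem isMIntegralCurve_mul_left {X : E} {γ : ℝ → G} (h : IsMIntegralCurve γ (leftField G X))
    (g : G) : IsMIntegralCurve (fun t => g * γ t) (leftField G X) :=
  fun t => hasMFDerivAt_mul_left_curve (E := E) X g γ t (h t)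

/-- Left translates of `t ↦ exp (tX)` are again integral curves, and integral curves are determined
by their initial value. -/
theorem integralCurve_eq_mul_gexp {X : E} {γ : ℝ → G} (h : IsMIntegralCurve γ (leftField G X))
    (t : ℝ) : γ t = γ 0 * gexp (t • X) := by
  refine congrFun (integralCurve_eq h
    (isMIntegralCurve_mul_left (isMIntegralCurve_gexp X) (γ 0)) ?_) t
  simp [gexp_zero]

theorem gexp_add_smul (X : E) (s t : ℝ) :
    gexp (G := G) ((s + t) • X) = gexp (s • X) * gexp (t • X) := by
  have h1 := (isMIntegralCurve_gexp (G := G) X).comp_add s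
  have := integralCurve_eq_mul_gexp h1 t
  simpa [add_comm] using this

theorem gexp_neg (X : E) : gexp (G := G) (-X) = (gexp X)⁻¹ := by
  have := gexp_add_smul (G := G) X 1 (-1)
  rw [add_neg_cancel, zero_smul, gexp_zero, one_smul, neg_one_smul] at this
  exact (inv_eq_of_mul_eq_one_right this.symm).symm

theorem continuous_gexp_smul (X : E) : Continuous fun t : ℝ => gexp (G := G) (t • X) :=
  continuous_iff_continuousAt.2 fun t => (isMIntegralCurve_gexp X t).continuousAt

variable (E G) in
/-- The chart of a Lie group at the identity. -/
abbrev oneChart : OpenPartialHomeomorph G E := chartAt E (1 : G)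

variable (E G) in
/-- The coordinates of the identity in the chart at the identity. -/
abbrev oneCoord : E := oneChart E G 1

variable (E G) in
/-- The product of three elements of a Lie group in the chart at the identity. -/
def chartMul (q : E × E × E) : E :=
  oneChart E G ((oneChart E G).symm q.1 * (oneChart E G).symm q.2.1 * (oneChart E G).symm q.2.2)

theorem oneChart_symm_oneCoord  : (chartAt E (1 : G)).symm (chartAt E (1 : G) 1) = 1 :=
  (chartAt E (1 : G)).left_inv (mem_chart_source E 1)

theorem contDiffAt_chartMul :
    ContDiffAt ℝ ∞ (chartMul E G) (oneCoord E G, oneCoord E G, oneCoord E G) := by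
  have hs : ContMDiffAt 𝓘(ℝ, E) 𝓘(ℝ, E) ∞ (oneChart E G).symm (oneCoord E G) :=
    contMDiffOn_chart_symm.contMDiffAt
      ((oneChart E G).open_target.mem_nhds (mem_chart_target E (1 : G)))
  have hc : ∀ g : G, g = 1 → ContMDiffAt 𝓘(ℝ, E) 𝓘(ℝ, E) ∞ (oneChart E G) g := by
    rintro g rfl
    exact contMDiffOn_chart.contMDiffAt (chart_source_mem_nhds E (1 : G))
  rw [← contMDiffAt_iff_contDiffAt]
  have h1 : ContMDiffAt 𝓘(ℝ, E × E × E) 𝓘(ℝ, E) ∞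
      (fun q : E × E × E => (oneChart E G).symm q.1)
      (oneCoord E G, oneCoord E G, oneCoord E G) :=
    ContMDiffAt.comp _ (g := (oneChart E G).symm) hs contDiffAt_fst.contMDiffAt
  have h2 : ContMDiffAt 𝓘(ℝ, E × E × E) 𝓘(ℝ, E) ∞
      (fun q : E × E × E => (oneChart E G).symm q.2.1)
      (oneCoord E G, oneCoord E G, oneCoord E G) :=
    ContMDiffAt.comp _ (g := (oneChart E G).symm) hs
      (contDiffAt_fst.comp (oneCoord E G, oneCoord E G, oneCoord E G) contDiffAt_snd).contMDiffAt
  have h3 : ContMDiffAt 𝓘(ℝ, E × E × E) 𝓘(ℝ, E) ∞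
      (fun q : E × E × E => (oneChart E G).symm q.2.2)
      (oneCoord E G, oneCoord E G, oneCoord E G) :=
    ContMDiffAt.comp _ (g := (oneChart E G).symm) hs
      (contDiffAt_snd.comp (oneCoord E G, oneCoord E G, oneCoord E G) contDiffAt_snd).contMDiffAt
  exact ContMDiffAt.comp _ (g := oneChart E G)
    (hc _ (by simp)) ((h1.mul h2).mul h3)

theorem hasDerivAt_oneChart_gexp (X : E) :
    HasDerivAt (fun t : ℝ => oneChart E G (gexp (t • X))) X 0 := by
  have h1 : IsMIntegralCurveAt (fun t : ℝ => gexp (G := G) (t • X)) (leftField G X) 0 :=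
    (isMIntegralCurve_gexp X).isMIntegralCurveAt 0
  have h2 := h1.eventually_hasDerivAt.self_of_nhds
  -- The base point of the curve is `gexp (0 • X)`, equal to 1 only propositionally; generalising it
  -- to `g` lets the dependent types be rewritten.
  have h3 : ∀ g : G, g = 1 → ((tangentCoordChange 𝓘(ℝ, E) g g g) (leftField G X g) : E) = X := by
    rintro g rfl
    have : leftField G X 1 = X := by
      have hid : ∀ f : G → G, f = id →
          (mfderiv 𝓘(ℝ, E) 𝓘(ℝ, E) f (1 : G) : E →L[ℝ] E) X = X := by
        rintro f rfl
        rw [mfderiv_id]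
        rfl
      exact hid (fun x => 1 * x) (funext one_mul)
    rw [this]
    exact tangentCoordChange_self (I := 𝓘(ℝ, E)) (mem_extChartAt_source (1 : G))
  have h4 := h3 (gexp (G := G) ((0 : ℝ) • X)) (by rw [zero_smul, gexp_zero])
  rw [h4] at h2
  have h5 : (fun t : ℝ => oneChart E G (gexp (t • X))) =
      (extChartAt 𝓘(ℝ, E) (gexp (G := G) ((0 : ℝ) • X))) ∘ fun t : ℝ => gexp (t • X) := by
    rw [zero_smul, gexp_zero]
    funext t
    simp
  rw [h5]
  exact h2

end OneParameter

/-! ### The derivative of the exponential map -/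

noncomputable section ExpDerivative

open Set Filter Topology

variable {E : Type*} [NormedAddCommGroup E] [NormedSpace ℝ E] [FiniteDimensional ℝ E]
  {G : Type*} [TopologicalSpace G] [T2Space G] [ChartedSpace E G] [Group G] [LieGroup 𝓘(ℝ, E) ∞ G]

variable (E G) in
/-- The base point `(1, 1, 1)` in coordinates. -/
abbrev tripleOne : E × E × E := (oneCoord E G, oneCoord E G, oneCoord E G)

variable (E G) in
/-- The Lie bracket of a Lie group, computed from the second derivative of the multiplication. -/
def chartBracket : E →L[ℝ] E →L[ℝ] E :=
  ((fderiv ℝ (fderiv ℝ (chartMul E G)) (tripleOne E G)).comp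
    ((ContinuousLinearMap.inr ℝ E (E × E)).comp (ContinuousLinearMap.inl ℝ E E))).flip.comp
    ((ContinuousLinearMap.id ℝ E).prod ((0 : E →L[ℝ] E).prod (-ContinuousLinearMap.id ℝ E)))

theorem chartBracket_apply (X q : E) : chartBracket E G X q =
    fderiv ℝ (fderiv ℝ (chartMul E G)) (tripleOne E G) (0, q, 0) (X, 0, -X) := by
  simp [chartBracket]

theorem oneCoord_mem_target : oneCoord E G ∈ (oneChart E G).target :=
  (oneChart E G).map_source (mem_chart_source E (1 : G))

theorem eventually_right_inv :
    ∀ᶠ p in 𝓝 (oneCoord E G), oneChart E G ((oneChart E G).symm p) = p :=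
  (oneChart E G).eventually_right_inverse oneCoord_mem_target

theorem differentiableAt_chartMul : DifferentiableAt ℝ (chartMul E G) (tripleOne E G) :=
  contDiffAt_chartMul.differentiableAt (by simp)

/-- On each coordinate axis through `(1, 1, 1)` the triple product is the identity, and the
derivative is the sum of its three partial derivatives. -/
theorem fderiv_chartMul (a p b : E) :
    fderiv ℝ (chartMul E G) (tripleOne E G) (a, p, b) = a + p + b := by
  have hd := (differentiableAt_chartMul (E := E) (G := G)).hasFDerivAt
  have key : ∀ (ι : E →L[ℝ] E × E × E) (f : E → E × E × E), f (oneCoord E G) = tripleOne E G →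
      HasFDerivAt f ι (oneCoord E G) →
      (∀ᶠ p in 𝓝 (oneCoord E G), chartMul E G (f p) = p) →
      ∀ v, fderiv ℝ (chartMul E G) (tripleOne E G) (ι v) = v := by
    intro ι f hf0 hf hev v
    have h1 : HasFDerivAt (fun p => chartMul E G (f p))
        ((fderiv ℝ (chartMul E G) (tripleOne E G)).comp ι) (oneCoord E G) :=
      HasFDerivAt.comp (oneCoord E G) (g := chartMul E G) (by rw [hf0]; exact hd) hf
    have h2 := (hasFDerivAt_id (𝕜 := ℝ) (oneCoord E G)).congr_of_eventuallyEq
      (f₁ := fun p => chartMul E G (f p)) hev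
    exact congrArg (fun L : E →L[ℝ] E => L v) (h1.unique h2)
  have hid := hasFDerivAt_id (𝕜 := ℝ) (oneCoord E G)
  have h1 := key _ (fun p => (p, oneCoord E G, oneCoord E G)) rfl
    (hid.prodMk (hasFDerivAt_const _ _)) (eventually_right_inv.mono fun p hp => by
      simpa [chartMul, oneChart_symm_oneCoord] using hp) a
  have h2 := key _ (fun p => (oneCoord E G, p, oneCoord E G)) rfl
    ((hasFDerivAt_const _ _).prodMk (hid.prodMk (hasFDerivAt_const _ _)))
    (eventually_right_inv.mono fun p hp => by
      simpa [chartMul, oneChart_symm_oneCoord] using hp) p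
  have h3 := key _ (fun p => (oneCoord E G, oneCoord E G, p)) rfl
    ((hasFDerivAt_const _ _).prodMk ((hasFDerivAt_const _ _).prodMk hid))
    (eventually_right_inv.mono fun p hp => by
      simpa [chartMul, oneChart_symm_oneCoord] using hp) b
  have hsplit : ((a, p, b) : E × E × E) = (a, 0, 0) + (0, p, 0) + (0, 0, b) := by simp
  rw [hsplit, map_add, map_add]
  congr 1
  · congr 1

/-- The vector field, in the chart at `1`, of the flow `x ↦ exp (-t X) x exp (t (X + Y))`. -/
def conjField (G : Type*) [TopologicalSpace G] [ChartedSpace E G] [Group G] (X : E)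
    (q : E × E) : E :=
  fderiv ℝ (chartMul E G) (oneCoord E G, q.1, oneCoord E G) (-X, 0, X + q.2)

theorem conjField_one (X : E) : conjField G X (oneCoord E G, 0) = 0 := by
  simp only [conjField]
  rw [fderiv_chartMul]
  simp

/-- Differentiating in `q` brings in the second derivative of the product at `(0, q, 0), (-X, 0,
X)`, which is `-[X, q]`; the field is affine in `Y`, and its `Y`-derivative at the identity is the
identity map by `fderiv_chartMul`. -/
theorem hasFDerivAt_conjField (X : E) :
    HasFDerivAt (conjField G X)
      ((-chartBracket E G X).coprod (ContinuousLinearMap.id ℝ E)) (oneCoord E G, 0) := by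
  have h1 : DifferentiableAt ℝ (fderiv ℝ (chartMul E G)) (tripleOne E G) :=
    ((contDiffAt_chartMul (E := E) (G := G)).fderiv_right (m := 1)
      (by rw [one_add_one_eq_two]; exact ENat.LEInfty.out)).differentiableAt
      (by simp)
  have hfst : HasFDerivAt (fun q : E × E => q.1) (ContinuousLinearMap.fst ℝ E E)
    (oneCoord E G, 0) := hasFDerivAt_fst
  have hsnd : HasFDerivAt (fun q : E × E => X + q.2) (ContinuousLinearMap.snd ℝ E E)
    (oneCoord E G, 0) := hasFDerivAt_snd.const_add X
  have h2 : HasFDerivAt (fun q : E × E => ((oneCoord E G, q.1, oneCoord E G) : E × E × E)) _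
      ((oneCoord E G, 0) : E × E) :=
    (hasFDerivAt_const _ _).prodMk (hfst.prodMk (hasFDerivAt_const _ _))
  have h3 : HasFDerivAt (fun q : E × E => ((-X, 0, X + q.2) : E × E × E)) _
      ((oneCoord E G, 0) : E × E) :=
    (hasFDerivAt_const _ _).prodMk ((hasFDerivAt_const _ _).prodMk hsnd)
  have h4 : HasFDerivAt (fun q : E × E =>
      fderiv ℝ (chartMul E G) (oneCoord E G, q.1, oneCoord E G)) _ ((oneCoord E G, 0) : E × E) :=
    HasFDerivAt.comp ((oneCoord E G, 0) : E × E) (g := fderiv ℝ (chartMul E G)) h1.hasFDerivAt h2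
  refine (h4.clm_apply h3).congr_fderiv ?_
  ext q
  · have h5 : ((-X, 0, X) : E × E × E) = -(X, 0, -X) := by simp
    simp [chartBracket_apply]
    rw [h5, map_neg, fderiv_chartMul]
    simp
  · have h6 : ((0, 0, 0) : E × E × E) = 0 := rfl
    simp
    rw [fderiv_chartMul, h6, map_zero]
    simp

/-- If `x` is the position at time `t`, the position at time `s + t` is `exp(-sX) x exp(s(X + Y))`.
The velocity is therefore the derivative at `s = 0` of a triple product with outer velocities `-X`
and `X + Y`. -/
theorem hasDerivAt_oneChart_conj (X : E) :
    ∀ᶠ x in 𝓝 (1 : G), ∀ (Y : E) (t : ℝ), gexp (-(t • X)) * gexp (t • (X + Y)) = x →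
      HasDerivAt (fun s : ℝ => oneChart E G (gexp (-(s • X)) * gexp (s • (X + Y))))
        (conjField G X (oneChart E G x, Y)) t := by
  have h0 : ∀ᶠ p in 𝓝 (oneCoord E G),
      DifferentiableAt ℝ (chartMul E G) (oneCoord E G, p, oneCoord E G) := by
    have h1 : ∀ᶠ q in 𝓝 (tripleOne E G), DifferentiableAt ℝ (chartMul E G) q :=
      (((contDiffAt_chartMul (E := E) (G := G)).of_le (m := 1) (by simp)).eventually
        (by simp)).mono fun q hq => hq.differentiableAt (by simp)
    have h2 : Continuous fun p : E => ((oneCoord E G, p, oneCoord E G) : E × E × E) := by fun_prop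
    exact h2.continuousAt.eventually h1
  have h1 := ((oneChart E G).continuousAt (mem_chart_source E (1 : G))).eventually h0
  filter_upwards [h1, (oneChart E G).open_source.eventually_mem (mem_chart_source E (1 : G))]
    with x hx hxs Y t ht
  have ha : HasDerivAt (fun s : ℝ => oneChart E G (gexp (-(s • X)))) (-X) 0 := by
    simpa using hasDerivAt_oneChart_gexp (G := G) (-X)
  have hb := hasDerivAt_oneChart_gexp (G := G) (X + Y)
  have hcurve : HasDerivAt (fun s : ℝ => ((oneChart E G (gexp (-(s • X))), oneChart E G x,
      oneChart E G (gexp (s • (X + Y)))) : E × E × E)) (-X, 0, X + Y) 0 :=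
    ha.prodMk ((hasDerivAt_const _ _).prodMk hb)
  have hcomp : HasDerivAt (fun s : ℝ => chartMul E G (oneChart E G (gexp (-(s • X))),
      oneChart E G x, oneChart E G (gexp (s • (X + Y))))) (conjField G X (oneChart E G x, Y)) 0 := by
    refine HasFDerivAt.comp_hasDerivAt (0 : ℝ) (l := chartMul E G) ?_ hcurve
    simp only [zero_smul, neg_zero, gexp_zero]
    exact hx.hasFDerivAt
  have hnear : ∀ Z : E, ∀ᶠ s in 𝓝 (0 : ℝ), gexp (G := G) (s • Z) ∈ (oneChart E G).source := by
    intro Z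
    have := (continuous_gexp_smul (G := G) Z).continuousAt (x := 0)
    rw [ContinuousAt, zero_smul, gexp_zero] at this
    exact this.eventually ((oneChart E G).open_source.eventually_mem (mem_chart_source E (1 : G)))
  have heq : (fun s : ℝ => oneChart E G
      (gexp (-((s + t) • X)) * gexp ((s + t) • (X + Y)))) =ᶠ[𝓝 0]
      fun s : ℝ => chartMul E G (oneChart E G (gexp (-(s • X))),
        oneChart E G x, oneChart E G (gexp (s • (X + Y)))) := by
    filter_upwards [hnear (-X), hnear (X + Y)] with s h2 h3
    rw [smul_neg] at h2
    simp only [chartMul]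
    rw [(oneChart E G).left_inv h2, (oneChart E G).left_inv h3, (oneChart E G).left_inv hxs, ← ht]
    congr 1
    have e1 : gexp (G := G) (-((s + t) • X)) = gexp (-(s • X)) * gexp (-(t • X)) := by
      simpa using gexp_add_smul (G := G) (-X) s t
    have e2 : gexp (G := G) ((s + t) • (X + Y)) = gexp (t • (X + Y)) * gexp (s • (X + Y)) := by
      rw [add_comm s t, gexp_add_smul]
    rw [e1, e2]
    group
  have hfin := hcomp.congr_of_eventuallyEq heq
  have := HasDerivAt.comp_sub_const (x := t) (a := t)
    (f := fun s : ℝ => oneChart E G (gexp (-((s + t) • X)) * gexp ((s + t) • (X + Y))))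
    (by rw [sub_self]; exact hfin)
  simpa using this

variable {n : ℕ}

/-- The product `exp(-X) exp(X + Y)` is the time-1 value of the conjugation flow. Its linearisation
`u' = -[X, u] + Y`, `u(0) = 0`, has time-1 value `∑ (-ad X)^j Y / (j + 1)!`. -/
theorem tendsto_and_hasFDerivAt_gexp {X : E} (hn : (chartBracket E G X) ^ n = 0) :
    Tendsto (fun Z : E => (gexp X)⁻¹ * gexp Z) (𝓝 X) (𝓝 (1 : G)) ∧
      HasFDerivAt (fun Z : E => oneChart E G ((gexp X)⁻¹ * gexp Z))
        (expDeriv (chartBracket E G) n X) X := by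
  have hL : (-chartBracket E G X) ^ n = 0 := by rw [neg_pow, hn, mul_zero]
  obtain ⟨h1, h2⟩ := tendsto_and_hasFDerivAt_of_chart_ode (oneChart E G)
    (mem_chart_source E (1 : G)) hL (conjField_one X) (hasFDerivAt_conjField X)
    (g := fun Y t => gexp (-(t • X)) * gexp (t • (X + Y)))
    (fun Y => by simp [gexp_zero])
    (fun Y => by
      have := topologicalGroup_of_lieGroup 𝓘(ℝ, E) ∞ (G := G)
      have h1 := continuous_gexp_smul (G := G) (-X)
      simp only [smul_neg] at h1
      exact h1.mul (continuous_gexp_smul (X + Y)))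
    (hasDerivAt_oneChart_conj X)
  have hθ : ∑ j ∈ Finset.range (n + 1), ((1 : ℝ) / (j + 1).factorial) • (-chartBracket E G X) ^ j =
      expDeriv (chartBracket E G) n X := by
    rw [expDeriv_eq_sum]
    refine Finset.sum_congr rfl fun j _ => ?_
    rcases Nat.even_or_odd j with hj | hj
    · simp [hj.neg_pow]
    · simp [hj.neg_pow, neg_div]
  rw [hθ] at h2
  have hsub : HasFDerivAt (fun Z : E => Z - X) (ContinuousLinearMap.id ℝ E) X :=
    (hasFDerivAt_id X).sub_const X
  have hsub0 : (fun Z : E => Z - X) X = 0 := sub_self X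
  constructor
  · have h3 : Tendsto (fun Z : E => Z - X) (𝓝 X) (𝓝 0) := by
      simpa using hsub.continuousAt.tendsto
    simpa [Function.comp_def, gexp_neg] using h1.comp h3
  · rw [← hsub0] at h2
    have := HasFDerivAt.comp X (f := fun Z : E => Z - X) h2 hsub
    simpa [Function.comp_def, gexp_neg] using this

end ExpDerivative

/-! ### The Lie bracket as a second derivative of the multiplication -/

noncomputable section ChartBracket

open Set Filter Topology VectorField

variable {E : Type*} [NormedAddCommGroup E] [NormedSpace ℝ E] [FiniteDimensional ℝ E]
  {G : Type*} [TopologicalSpace G] [T2Space G] [ChartedSpace E G] [Group G] [LieGroup 𝓘(ℝ, E) ∞ G]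

theorem fderiv_fderiv_comp_affine {F F' V : Type*} [NormedAddCommGroup F] [NormedSpace ℝ F]
    [NormedAddCommGroup F'] [NormedSpace ℝ F'] [NormedAddCommGroup V] [NormedSpace ℝ V]
    {M : F → V} {f : F' → F} {ι : F' →L[ℝ] F} {x : F'} (hf : ∀ y, HasFDerivAt f ι y)
    (hM : ContDiffAt ℝ 2 M (f x)) (v w : F') :
    fderiv ℝ (fun y => fderiv ℝ (fun z => M (f z)) y w) x v =
      fderiv ℝ (fderiv ℝ M) (f x) (ι v) (ι w) := by
  have h1 : ∀ᶠ q in 𝓝 (f x), DifferentiableAt ℝ M q :=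
    (hM.eventually (by simp)).mono fun q hq => hq.differentiableAt (by simp)
  have h2 : (fun y => fderiv ℝ (fun z => M (f z)) y w) =ᶠ[𝓝 x]
      fun y => fderiv ℝ M (f y) (ι w) := by
    filter_upwards [(hf x).continuousAt.eventually h1] with y hy
    have hcomp := (HasFDerivAt.comp y hy.hasFDerivAt (hf y)).fderiv
    simp only [Function.comp_def] at hcomp
    rw [hcomp]
    rfl
  have h3 : DifferentiableAt ℝ (fderiv ℝ M) (f x) :=
    (hM.fderiv_right (m := 1) (by rw [one_add_one_eq_two])).differentiableAt (by simp)
  have h4 := (HasFDerivAt.comp x h3.hasFDerivAt (hf x)).clm_apply (hasFDerivAt_const (ι w) x)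
  rw [h2.fderiv_eq]
  have h5 := h4.fderiv
  simp only [Function.comp_def] at h5
  rw [h5]
  simp

theorem chartMul_left_right (a b : E) :
    chartMul E G (a, b, oneCoord E G) = chartMul E G (oneCoord E G, a, b) := by
  simp [chartMul]

theorem contDiffAt_two_chartMul : ContDiffAt ℝ 2 (chartMul E G) (tripleOne E G) :=
  contDiffAt_chartMul.of_le ENat.LEInfty.out

/-- Because `a · b · 1 = 1 · a · b`, the mixed second derivative in slots 2 and 3 agrees with the
one in slots 1 and 2; symmetry of second derivatives puts it in the stated order. This reconciles
the bracket of left-invariant fields with `chartBracket`. -/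
theorem sndDeriv_chartMul_shift (X Y : E) :
    fderiv ℝ (fderiv ℝ (chartMul E G)) (tripleOne E G) (0, X, 0) (0, 0, Y) =
      fderiv ℝ (fderiv ℝ (chartMul E G)) (tripleOne E G) (0, Y, 0) (X, 0, 0) := by
  have hsymm : IsSymmSndFDerivAt ℝ (chartMul E G) (tripleOne E G) :=
    contDiffAt_two_chartMul.isSymmSndFDerivAt (by simp)
  have hfst : ∀ y : E × E, HasFDerivAt (fun q : E × E => q.1) (ContinuousLinearMap.fst ℝ E E) y :=
    fun y => hasFDerivAt_fst
  have hsnd : ∀ y : E × E, HasFDerivAt (fun q : E × E => q.2) (ContinuousLinearMap.snd ℝ E E) y :=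
    fun y => hasFDerivAt_snd
  have h1 := fderiv_fderiv_comp_affine (M := chartMul E G)
    (f := fun q : E × E => ((q.1, q.2, oneCoord E G) : E × E × E))
    (x := (oneCoord E G, oneCoord E G))
    (fun y => (hfst y).prodMk ((hsnd y).prodMk (hasFDerivAt_const _ _)))
    contDiffAt_two_chartMul (X, 0) (0, Y)
  have h2 := fderiv_fderiv_comp_affine (M := chartMul E G)
    (f := fun q : E × E => ((oneCoord E G, q.1, q.2) : E × E × E))
    (x := (oneCoord E G, oneCoord E G))
    (fun y => (hasFDerivAt_const _ _).prodMk ((hfst y).prodMk (hsnd y)))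
    contDiffAt_two_chartMul (X, 0) (0, Y)
  simp only [chartMul_left_right] at h1
  rw [h1] at h2
  simp at h2
  rw [← h2]
  exact hsymm _ _

/-- Left translation by `g`, read in the chart, is `b ↦ chartMul (1, g, b)`; the left-invariant
field is its derivative at the identity. -/
theorem mfderiv_oneChart_leftField {g : G} (hg : g ∈ (oneChart E G).source)
    (hd : DifferentiableAt ℝ (chartMul E G) (oneCoord E G, oneChart E G g, oneCoord E G)) (X : E) :
    (mfderiv 𝓘(ℝ, E) 𝓘(ℝ, E) (extChartAt 𝓘(ℝ, E) (1 : G)) g : E →L[ℝ] E) (leftField G X g : E) =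
      fderiv ℝ (chartMul E G) (oneCoord E G, oneChart E G g, oneCoord E G) (0, 0, X) := by
  have hM : (∞ : WithTop ℕ∞) ≠ 0 := by simp
  have hmul : MDifferentiableAt 𝓘(ℝ, E) 𝓘(ℝ, E) (fun x : G => g * x) 1 :=
    (contMDiff_mul_left (I := 𝓘(ℝ, E)) (n := ∞)).contMDiffAt.mdifferentiableAt hM
  have hc : ∀ b : G, b = g →
      MDifferentiableAt 𝓘(ℝ, E) 𝓘(ℝ, E) (extChartAt 𝓘(ℝ, E) (1 : G)) b := by
    rintro b rfl
    exact mdifferentiableAt_extChartAt hg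
  have h1 := mfderiv_comp (1 : G) (hc (g * 1) (mul_one g)) hmul
  have hb : ∀ b : G, b = g → ∀ w : E,
      (mfderiv 𝓘(ℝ, E) 𝓘(ℝ, E) (extChartAt 𝓘(ℝ, E) (1 : G)) b : E →L[ℝ] E) w =
        (mfderiv 𝓘(ℝ, E) 𝓘(ℝ, E) (extChartAt 𝓘(ℝ, E) (1 : G)) g : E →L[ℝ] E) w := by
    rintro _ rfl _
    rfl
  have h2 : (mfderiv 𝓘(ℝ, E) 𝓘(ℝ, E) ((extChartAt 𝓘(ℝ, E) (1 : G)) ∘ fun x : G => g * x) 1 :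
      E →L[ℝ] E) X =
      (mfderiv 𝓘(ℝ, E) 𝓘(ℝ, E) (extChartAt 𝓘(ℝ, E) (1 : G)) g : E →L[ℝ] E)
        (leftField G X g : E) := by
    rw [h1]
    exact hb (g * 1) (mul_one g) _
  rw [← h2]
  have hψ : HasMFDerivAt 𝓘(ℝ, E) 𝓘(ℝ, E) (extChartAt 𝓘(ℝ, E) (1 : G)) (1 : G)
      (ContinuousLinearMap.id ℝ E) := by
    have := (mdifferentiableAt_extChartAt (I := 𝓘(ℝ, E)) (mem_chart_source E (1 : G))).hasMFDerivAt
    rw [mfderiv_extChartAt_self] at this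
    exact this
  have haff : HasFDerivAt (fun b : E => ((oneCoord E G, oneChart E G g, b) : E × E × E))
      ((0 : E →L[ℝ] E).prod ((0 : E →L[ℝ] E).prod (ContinuousLinearMap.id ℝ E)))
      (extChartAt 𝓘(ℝ, E) (1 : G) 1) :=
    (hasFDerivAt_const _ _).prodMk ((hasFDerivAt_const _ _).prodMk (hasFDerivAt_id _))
  have hd' : HasFDerivAt (fun b : E => chartMul E G (oneCoord E G, oneChart E G g, b)) _
      (extChartAt 𝓘(ℝ, E) (1 : G) 1) :=
    HasFDerivAt.comp (extChartAt 𝓘(ℝ, E) (1 : G) 1) (g := chartMul E G)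
      (f := fun b : E => ((oneCoord E G, oneChart E G g, b) : E × E × E)) hd.hasFDerivAt haff
  have h3 := HasMFDerivAt.comp (1 : G) hd'.hasMFDerivAt hψ
  have heq : ((extChartAt 𝓘(ℝ, E) (1 : G)) ∘ fun x : G => g * x) =ᶠ[𝓝 1]
      (fun b : E => chartMul E G (oneCoord E G, oneChart E G g, b)) ∘
        (extChartAt 𝓘(ℝ, E) (1 : G)) := by
    filter_upwards [(oneChart E G).open_source.eventually_mem (mem_chart_source E (1 : G))]
      with x hx
    simp [chartMul, (oneChart E G).left_inv hg, (oneChart E G).left_inv hx]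
  rw [heq.mfderiv_eq, h3.mfderiv]
  simp
  rfl

theorem mpullback_leftField (X : E) :
    ∀ᶠ p in 𝓝 (oneCoord E G),
      mpullbackWithin 𝓘(ℝ, E) 𝓘(ℝ, E) (extChartAt 𝓘(ℝ, E) (1 : G)).symm (leftField G X)
        (range 𝓘(ℝ, E)) p = fderiv ℝ (chartMul E G) (oneCoord E G, p, oneCoord E G) (0, 0, X) := by
  have h0 : ∀ᶠ p in 𝓝 (oneCoord E G),
      DifferentiableAt ℝ (chartMul E G) (oneCoord E G, p, oneCoord E G) := by
    have h1 : ∀ᶠ q in 𝓝 (tripleOne E G), DifferentiableAt ℝ (chartMul E G) q :=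
      ((contDiffAt_two_chartMul (E := E) (G := G)).eventually
        (by simp)).mono fun q hq => hq.differentiableAt (by simp)
    have h2 : Continuous fun p : E => ((oneCoord E G, p, oneCoord E G) : E × E × E) := by fun_prop
    exact h2.continuousAt.eventually h1
  filter_upwards [h0, (oneChart E G).open_target.eventually_mem oneCoord_mem_target] with p hp hpt
  have hpt' : p ∈ (extChartAt 𝓘(ℝ, E) (1 : G)).target := by simpa using hpt
  have h1 := ContinuousLinearMap.inverse_eq
    (mfderivWithin_extChartAt_symm_comp_mfderiv_extChartAt hpt')
    (mfderiv_extChartAt_comp_mfderivWithin_extChartAt_symm hpt')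
  rw [mpullbackWithin_apply, h1]
  have hpr : oneChart E G ((oneChart E G).symm p) = p := (oneChart E G).right_inv hpt
  have h2 := mfderiv_oneChart_leftField (g := (oneChart E G).symm p)
    ((oneChart E G).map_target hpt) (by rw [hpr]; exact hp) X
  rw [hpr] at h2
  exact h2

variable (G) in
/-- A vector of the model space as an element of the Lie algebra. -/
abbrev toLie (X : E) : GroupLieAlgebra 𝓘(ℝ, E) G := X

theorem bracket_eq_chartBracket (X Y : E) :
    ⁅toLie G X, toLie G Y⁆ = toLie G (chartBracket E G X Y) := by
  rw [GroupLieAlgebra.bracket_def, ← mlieBracketWithin_univ, mlieBracketWithin_apply]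
  have hinv : ∀ w : E, (ContinuousLinearMap.inverse
      (mfderiv 𝓘(ℝ, E) 𝓘(ℝ, E) (extChartAt 𝓘(ℝ, E) (1 : G)) 1 : E →L[ℝ] E) : E →L[ℝ] E) w = w := by
    intro w
    have h1 : (mfderiv 𝓘(ℝ, E) 𝓘(ℝ, E) (extChartAt 𝓘(ℝ, E) (1 : G)) 1 : E →L[ℝ] E) =
        ContinuousLinearMap.id ℝ E := mfderiv_extChartAt_self
    rw [h1, ContinuousLinearMap.inverse_id]
    rfl
  let V : E → E → E := fun X => mpullbackWithin 𝓘(ℝ, E) 𝓘(ℝ, E)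
    (extChartAt 𝓘(ℝ, E) (1 : G)).symm (leftField G X) (range 𝓘(ℝ, E))
  have hV : ∀ X : E, V X =ᶠ[𝓝 (oneCoord E G)]
      fun p => fderiv ℝ (chartMul E G) (oneCoord E G, p, oneCoord E G) (0, 0, X) :=
    fun X => mpullback_leftField X
  -- At its own centre the chart has derivative the identity, so the pullback in the definition of
  -- the bracket does nothing.
  suffices hmain : lieBracketWithin ℝ (V X) (V Y)
      ((extChartAt 𝓘(ℝ, E) (1 : G)).symm ⁻¹' univ ∩ range 𝓘(ℝ, E))
      (extChartAt 𝓘(ℝ, E) (1 : G) 1) = chartBracket E G X Y from (hinv _).trans hmain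
  have huniv : (extChartAt 𝓘(ℝ, E) (1 : G)).symm ⁻¹' univ ∩ range 𝓘(ℝ, E) = univ := by simp
  have hpt : extChartAt 𝓘(ℝ, E) (1 : G) 1 = oneCoord E G := by simp
  rw [huniv, lieBracketWithin_univ, hpt, lieBracket_eq]
  have haff : ∀ y : E, HasFDerivAt (fun p : E => ((oneCoord E G, p, oneCoord E G) : E × E × E))
      ((0 : E →L[ℝ] E).prod ((ContinuousLinearMap.id ℝ E).prod (0 : E →L[ℝ] E))) y := fun y =>
    (hasFDerivAt_const _ _).prodMk ((hasFDerivAt_id _).prodMk (hasFDerivAt_const _ _))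
  have h3 : DifferentiableAt ℝ (fderiv ℝ (chartMul E G)) (tripleOne E G) :=
    ((contDiffAt_two_chartMul (E := E) (G := G)).fderiv_right (m := 1)
      (by rw [one_add_one_eq_two])).differentiableAt (by simp)
  have hder : ∀ v w : E, fderiv ℝ (fun p : E =>
      fderiv ℝ (chartMul E G) (oneCoord E G, p, oneCoord E G) (0, 0, w)) (oneCoord E G) v =
      fderiv ℝ (fderiv ℝ (chartMul E G)) (tripleOne E G) (0, v, 0) (0, 0, w) := by
    intro v w
    have h4 := (HasFDerivAt.comp (oneCoord E G)
      (f := fun p : E => ((oneCoord E G, p, oneCoord E G) : E × E × E))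
      (g := fderiv ℝ (chartMul E G)) h3.hasFDerivAt
      (haff (oneCoord E G))).clm_apply (hasFDerivAt_const ((0, 0, w) : E × E × E) (oneCoord E G))
    have h5 := h4.fderiv
    simp only [Function.comp_def] at h5
    rw [h5]
    simp
  have hV0 : ∀ X : E, V X (oneCoord E G) = X := fun X => by
    refine ((hV X).self_of_nhds).trans ((fderiv_chartMul _ _ _).trans ?_)
    simp
  simp only
  rw [(hV X).fderiv_eq, (hV Y).fderiv_eq, hV0, hV0, hder, hder, chartBracket_apply,
    sndDeriv_chartMul_shift]
  have : ((X, 0, -X) : E × E × E) = (X, 0, 0) - (0, 0, X) := by simp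
  rw [this, map_sub]

/-- The lower central series, transported to the model space, serves as the filtration; the
condition on the left argument follows from antisymmetry of the bracket. -/
theorem exists_nilpotentFiltration [LieRing.IsNilpotent (GroupLieAlgebra 𝓘(ℝ, E) G)] :
    ∃ N n, NilpotentFiltration (chartBracket E G) N n := by
  obtain ⟨n, hn⟩ := (LieModule.isNilpotent_iff ℝ (GroupLieAlgebra 𝓘(ℝ, E) G)
    (GroupLieAlgebra 𝓘(ℝ, E) G)).1 inferInstance
  let N : ℕ → Submodule ℝ E := fun k =>
    (LieModule.lowerCentralSeries ℝ (GroupLieAlgebra 𝓘(ℝ, E) G)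
      (GroupLieAlgebra 𝓘(ℝ, E) G) k).toSubmodule
  have hright : ∀ k y, y ∈ N k → ∀ x, chartBracket E G x y ∈ N (k + 1) := by
    intro k y hy x
    have : ⁅toLie G x, toLie G y⁆ ∈
        LieModule.lowerCentralSeries ℝ (GroupLieAlgebra 𝓘(ℝ, E) G)
          (GroupLieAlgebra 𝓘(ℝ, E) G) (k + 1) := by
      rw [LieModule.lowerCentralSeries_succ]
      exact LieSubmodule.lie_mem_lie (LieSubmodule.mem_top _) hy
    rw [bracket_eq_chartBracket] at this
    exact this
  refine ⟨N, n, ?_, ?_, ?_, ?_, hright⟩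
  · rfl
  · simp only [N]
    rw [hn]
    rfl
  · intro a b hab
    exact LieModule.antitone_lowerCentralSeries ℝ (GroupLieAlgebra 𝓘(ℝ, E) G)
      (GroupLieAlgebra 𝓘(ℝ, E) G) hab
  · intro k x hx y
    have h1 : chartBracket E G x y = -chartBracket E G y x := by
      have := lie_skew (toLie G x) (toLie G y)
      rw [bracket_eq_chartBracket, bracket_eq_chartBracket] at this
      exact this.symm
    rw [h1]
    exact neg_mem (hright k x hx y)

end ChartBracket

/-! ### The exponential map as a covering map and a homeomorphism -/

noncomputable section ExpHomeomorph

open Set Filter Topology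

variable {E : Type*} [NormedAddCommGroup E] [NormedSpace ℝ E] [FiniteDimensional ℝ E]
  {G : Type*} [TopologicalSpace G] [T2Space G] [ChartedSpace E G] [Group G] [LieGroup 𝓘(ℝ, E) ∞ G]

theorem hasMFDerivAt_mul_oneChart_symm (g : G) :
    HasMFDerivAt 𝓘(ℝ, E) 𝓘(ℝ, E) (fun b : E => g * (oneChart E G).symm b) (oneCoord E G)
      (mfderiv 𝓘(ℝ, E) 𝓘(ℝ, E) (fun x : G => g * x) 1 : E →L[ℝ] E) := by
  have hM : (∞ : WithTop ℕ∞) ≠ 0 := by simp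
  have hs : HasMFDerivAt 𝓘(ℝ, E) 𝓘(ℝ, E) (oneChart E G).symm (oneCoord E G)
      (ContinuousLinearMap.id ℝ E) := by
    have h1 : MDifferentiableAt 𝓘(ℝ, E) 𝓘(ℝ, E) (extChartAt 𝓘(ℝ, E) (1 : G)).symm
        (extChartAt 𝓘(ℝ, E) (1 : G) 1) := by
      have := mdifferentiableWithinAt_extChartAt_symm (I := 𝓘(ℝ, E))
        (mem_extChartAt_target (I := 𝓘(ℝ, E)) (1 : G))
      rwa [ModelWithCorners.range_eq_univ, mdifferentiableWithinAt_univ] at this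
    have h2 := h1.hasMFDerivAt
    have h3 := mfderivWithin_range_extChartAt_symm (I := 𝓘(ℝ, E)) (x := (1 : G))
    rw [ModelWithCorners.range_eq_univ, mfderivWithin_univ] at h3
    rw [h3] at h2
    exact h2
  have hmul : ∀ b : G, b = 1 → HasMFDerivAt 𝓘(ℝ, E) 𝓘(ℝ, E) (fun x : G => g * x) b
      (mfderiv 𝓘(ℝ, E) 𝓘(ℝ, E) (fun x : G => g * x) 1 : E →L[ℝ] E) := by
    rintro b rfl
    exact ((contMDiff_mul_left (I := 𝓘(ℝ, E)) (n := ∞)).contMDiffAt.mdifferentiableAt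
      hM).hasMFDerivAt
  exact HasMFDerivAt.comp (oneCoord E G) (hmul _ oneChart_symm_oneCoord) hs

namespace NilpotentFiltration

variable {N : ℕ → Submodule ℝ E} {n : ℕ} (h : NilpotentFiltration (chartBracket E G) N n)
include h

theorem tendsto_inv_mul_gexp (X : E) :
    Tendsto (fun Z : E => (gexp X)⁻¹ * gexp Z) (𝓝 X) (𝓝 (1 : G)) :=
  (tendsto_and_hasFDerivAt_gexp (h.bracket_pow X)).1

theorem hasFDerivAt_inv_mul_gexp (X : E) :
    HasFDerivAt (fun Z : E => oneChart E G ((gexp X)⁻¹ * gexp Z))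
      (expDeriv (chartBracket E G) n X) X :=
  (tendsto_and_hasFDerivAt_gexp (h.bracket_pow X)).2

theorem continuous_gexp : Continuous (gexp : E → G) := by
  have := topologicalGroup_of_lieGroup 𝓘(ℝ, E) ∞ (G := G)
  refine continuous_iff_continuousAt.2 fun X => ?_
  have := (h.tendsto_inv_mul_gexp X).const_mul (gexp X)
  simpa [ContinuousAt] using this

theorem eventually_inv_mul_mem (X : E) :
    ∀ᶠ Z in 𝓝 X, (gexp X)⁻¹ * gexp Z ∈ (oneChart E G).source :=
  (h.tendsto_inv_mul_gexp X).eventually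
    ((oneChart E G).open_source.eventually_mem (mem_chart_source E (1 : G)))

/-- Along the flow the velocity is `expDerivInv Y`, which the derivative of `exp` turns back into
`Y`; the image is therefore an integral curve of the left-invariant field of `Y`. The flow thus
lifts right translation by `exp (tY)`. -/
theorem gexp_nilFlow (X Y : E) (t : ℝ) :
    gexp (nilFlow (chartBracket E G) n X Y t) = (gexp X * gexp (t • Y) : G) := by
  set c : ℝ → E := nilFlow (chartBracket E G) n X Y with hc
  have hcurve : IsMIntegralCurve (fun t => gexp (G := G) (c t)) (leftField G Y) := by
    intro t
    have h1 : HasDerivAt (fun s => oneChart E G ((gexp (c t))⁻¹ * gexp (c s))) Y t := by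
      have := (h.hasFDerivAt_inv_mul_gexp (c t)).comp_hasDerivAt t (h.hasDerivAt_nilFlow X Y t)
      have h2 : expDeriv (chartBracket E G) n (c t)
          (expDerivInv (chartBracket E G) n (c t) Y) = Y := by
        have := congrArg (fun L : E →L[ℝ] E => L Y) (h.expDeriv_mul_inv (c t))
        simpa using this
      rwa [h2] at this
    have h3 : ∀ b : E, b = oneCoord E G →
        HasMFDerivAt 𝓘(ℝ, E) 𝓘(ℝ, E) (fun b : E => gexp (c t) * (oneChart E G).symm b) b
          (mfderiv 𝓘(ℝ, E) 𝓘(ℝ, E) (fun x : G => gexp (c t) * x) 1 : E →L[ℝ] E) := by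
      rintro b rfl
      exact hasMFDerivAt_mul_oneChart_symm _
    have h4 := HasMFDerivAt.comp t (h3 _ (by simp)) h1.hasFDerivAt.hasMFDerivAt
    have hcc : ContinuousAt c t := (h.hasDerivAt_nilFlow X Y t).continuousAt
    have heq : (fun t => gexp (G := G) (c t)) =ᶠ[𝓝 t]
        (fun b : E => gexp (c t) * (oneChart E G).symm b) ∘
          fun s => oneChart E G ((gexp (c t))⁻¹ * gexp (c s)) := by
      filter_upwards [hcc.eventually (h.eventually_inv_mul_mem (c t))] with s hs
      simp [(oneChart E G).left_inv hs]
    have h5 := h4.congr_of_eventuallyEq heq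
    have hL : (ContinuousLinearMap.smulRight (1 : ℝ →L[ℝ] ℝ) (leftField G Y (gexp (c t))) :
        ℝ →L[ℝ] E) = (mfderiv 𝓘(ℝ, E) 𝓘(ℝ, E) (fun x : G => gexp (c t) * x) 1 : E →L[ℝ] E).comp
          (ContinuousLinearMap.toSpanSingleton ℝ Y) := by
      ext
      change (1 : ℝ) • _ = (mfderiv 𝓘(ℝ, E) 𝓘(ℝ, E) (fun x : G => gexp (c t) * x) 1 : E →L[ℝ] E)
        ((1 : ℝ) • Y)
      rw [one_smul]
      exact one_smul ℝ (leftField G Y (gexp (c t)) : E)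
    refine HasMFDerivAt.congr_mfderiv h5 ?_
    exact hL.symm
  have := integralCurve_eq_mul_gexp hcurve t
  simp only [hc] at this
  rwa [h.nilFlow_zero] at this

/-- Near 0 the derivative is the partial derivative of the product composed with `expDeriv`. It is
continuous at 0, so differentiability there is strict and the inverse function theorem applies. -/
theorem hasStrictFDerivAt_oneChart_gexp :
    HasStrictFDerivAt (fun Z : E => oneChart E G (gexp Z)) (ContinuousLinearMap.id ℝ E) 0 := by
  have hcexp := h.continuous_gexp
  have h0 : (gexp (0 : E) : G) ∈ (oneChart E G).source := by
    rw [gexp_zero]; exact mem_chart_source E (1 : G)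
  have hsrc : ∀ᶠ X in 𝓝 (0 : E), (gexp X : G) ∈ (oneChart E G).source :=
    hcexp.continuousAt.eventually ((oneChart E G).open_source.eventually_mem h0)
  have hpt : Tendsto (fun X : E => ((oneCoord E G, oneChart E G (gexp X), oneCoord E G) : E × E × E))
      (𝓝 0) (𝓝 (tripleOne E G)) := by
    have h1 : ContinuousAt (fun X : E => oneChart E G (gexp X)) 0 :=
      ((oneChart E G).continuousAt h0).comp hcexp.continuousAt
    have h2 := h1.tendsto
    simp only [gexp_zero] at h2
    exact tendsto_const_nhds.prodMk_nhds (h2.prodMk_nhds tendsto_const_nhds)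
  set f' : E → E →L[ℝ] E := fun X =>
    ((fderiv ℝ (chartMul E G) (oneCoord E G, oneChart E G (gexp X), oneCoord E G)).comp
      ((0 : E →L[ℝ] E).prod ((0 : E →L[ℝ] E).prod (ContinuousLinearMap.id ℝ E)))).comp
      (expDeriv (chartBracket E G) n X) with hf'
  have hd : ∀ᶠ X in 𝓝 (0 : E), DifferentiableAt ℝ (chartMul E G)
      (oneCoord E G, oneChart E G (gexp X), oneCoord E G) :=
    hpt.eventually (((contDiffAt_two_chartMul (E := E) (G := G)).eventually
        (by simp)).mono fun q hq => hq.differentiableAt (by simp))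
  have hder : ∀ᶠ X in 𝓝 (0 : E), HasFDerivAt (fun Z : E => oneChart E G (gexp Z)) (f' X) X := by
    filter_upwards [hsrc, hd] with X hX hdX
    have haff : HasFDerivAt (fun b : E => ((oneCoord E G, oneChart E G (gexp X), b) : E × E × E))
        ((0 : E →L[ℝ] E).prod ((0 : E →L[ℝ] E).prod (ContinuousLinearMap.id ℝ E)))
        (oneChart E G ((gexp X)⁻¹ * gexp X)) :=
      (hasFDerivAt_const _ _).prodMk ((hasFDerivAt_const _ _).prodMk (hasFDerivAt_id _))
    have h2 : HasFDerivAt (fun b : E => chartMul E G (oneCoord E G, oneChart E G (gexp X), b))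
        ((fderiv ℝ (chartMul E G) (oneCoord E G, oneChart E G (gexp X), oneCoord E G)).comp
          ((0 : E →L[ℝ] E).prod ((0 : E →L[ℝ] E).prod (ContinuousLinearMap.id ℝ E))))
        (oneChart E G ((gexp X)⁻¹ * gexp X)) :=
      HasFDerivAt.comp (oneChart E G ((gexp X)⁻¹ * gexp X)) (g := chartMul E G)
        (f := fun b : E => ((oneCoord E G, oneChart E G (gexp X), b) : E × E × E))
        (by rw [inv_mul_cancel]; exact hdX.hasFDerivAt) haff
    have h3 := HasFDerivAt.comp X h2 (h.hasFDerivAt_inv_mul_gexp X)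
    refine h3.congr_of_eventuallyEq ?_
    filter_upwards [h.eventually_inv_mul_mem X] with Z hZ
    simp [chartMul, (oneChart E G).left_inv hX, (oneChart E G).left_inv hZ]
  have hcont : ContinuousAt f' 0 := by
    have h1 : ContinuousAt (fderiv ℝ (chartMul E G)) (tripleOne E G) :=
      ((contDiffAt_two_chartMul (E := E) (G := G)).fderiv_right (m := 1)
        (by rw [one_add_one_eq_two])).continuousAt
    have h2 : ContinuousAt (fun X : E =>
        fderiv ℝ (chartMul E G) (oneCoord E G, oneChart E G (gexp X), oneCoord E G)) 0 := by
      have := h1.tendsto.comp hpt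
      simpa [ContinuousAt, gexp_zero, Function.comp_def] using this
    exact (h2.clm_comp continuousAt_const).clm_comp (continuous_expDeriv _ n).continuousAt
  have h1 := hasStrictFDerivAt_of_hasFDerivAt_of_continuousAt hder hcont
  have h2 : f' 0 = ContinuousLinearMap.id ℝ E := by
    ext v
    simp [hf', expDeriv_zero, gexp_zero]
    refine (fderiv_chartMul _ _ _).trans ?_
    simp
  rwa [h2] at h1

theorem exists_local_section : ∃ (U : Set G) (l : G → E), IsOpen U ∧ 1 ∈ U ∧ ContinuousOn l U ∧
    ∀ u ∈ U, gexp (l u) = u := by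
  have hs : HasStrictFDerivAt (fun Z : E => oneChart E G (gexp Z))
      ((ContinuousLinearEquiv.refl ℝ E : E ≃L[ℝ] E) : E →L[ℝ] E) 0 :=
    h.hasStrictFDerivAt_oneChart_gexp
  set Φ := hs.toOpenPartialHomeomorph with hΦ
  have hΦc : ∀ Z, Φ Z = oneChart E G (gexp Z) := fun Z => by
    rw [hΦ, hs.toOpenPartialHomeomorph_coe]
  have h0 : (0 : E) ∈ Φ.source := hs.mem_toOpenPartialHomeomorph_source
  set Ψ := (oneChart E G).trans Φ.symm with hΨ
  -- The second condition is needed because equality of chart coordinates identifies two points only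
  -- if both lie in the chart domain.
  set W : Set G := Ψ.source ∩ Ψ ⁻¹' ((gexp : E → G) ⁻¹' (oneChart E G).source) with hW
  refine ⟨W, Ψ, Ψ.isOpen_inter_preimage ((oneChart E G).open_source.preimage h.continuous_gexp),
    ?_, Ψ.continuousOn.mono inter_subset_left, ?_⟩
  · have h1 : oneChart E G 1 = Φ 0 := by rw [hΦc, gexp_zero]
    have h2 : oneChart E G 1 ∈ Φ.target := h1 ▸ Φ.map_source h0
    have h3 : Ψ 1 = 0 := by
      simp only [hΨ, OpenPartialHomeomorph.coe_trans, Function.comp_apply]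
      rw [h1, Φ.left_inv h0]
    refine ⟨?_, ?_⟩
    · rw [hΨ, OpenPartialHomeomorph.trans_source]
      exact ⟨mem_chart_source E (1 : G), h2⟩
    · rw [mem_preimage, mem_preimage, h3, gexp_zero]
      exact mem_chart_source E (1 : G)
  · rintro u ⟨hu, hu'⟩
    rw [hΨ, OpenPartialHomeomorph.trans_source] at hu
    refine (oneChart E G).injOn hu' hu.1 ?_
    rw [← hΦc]
    exact Φ.right_inv hu.2

/-- The derivative of `exp` has a bounded left inverse at each point, so `exp` takes different
values at nearby points. -/
theorem discreteTopology_fiber (g : G) : DiscreteTopology ((gexp : E → G) ⁻¹' {g}) := by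
  have key : ∀ X : E, ∀ᶠ Z in 𝓝[≠] X, (gexp Z : G) ≠ gexp X := by
    intro X
    have h1 := (h.hasFDerivAt_inv_mul_gexp X).eventually_ne (c := oneCoord E G)
      ⟨_, (expDerivInv (chartBracket E G) n X).lipschitz.to_rightInverse fun z => by
        simpa using congrArg (fun L : E →L[ℝ] E => L z) (h.expDerivInv_mul X)⟩
    filter_upwards [h1] with Z hZ hne
    exact hZ (by simp [hne])
  rw [discreteTopology_subtype_iff]
  intro X hX
  rw [← disjoint_iff, disjoint_principal_right]
  filter_upwards [key X] with Z hZ hZ'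
  exact hZ (hZ'.trans hX.symm)

theorem isCoveringMap_gexp : IsCoveringMap (gexp : E → G) := by
  have := topologicalGroup_of_lieGroup 𝓘(ℝ, E) ∞ (G := G)
  obtain ⟨U, l, hUo, h1U, hl, hexpl⟩ := h.exists_local_section
  have hcexp := h.continuous_gexp
  have hflow := continuous_nilFlow (chartBracket E G) n
  intro g
  refine ⟨h.discreteTopology_fiber g, (fun x => g⁻¹ * x) ⁻¹' U, by simpa using h1U,
    hUo.preimage (continuous_const_mul _),
    (hUo.preimage (continuous_const_mul _)).preimage hcexp, ?_⟩
  have hneg : ∀ X Y : E, nilFlow (chartBracket E G) n (nilFlow (chartBracket E G) n X (-Y) 1) Y 1 =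
      X := fun X Y => by simpa using h.nilFlow_neg_nilFlow X (-Y)
  have hflow1 : Continuous fun q : E × E => nilFlow (chartBracket E G) n q.1 q.2 1 :=
    hflow.comp (f := fun q : E × E => (q, (1 : ℝ))) (by fun_prop)
  have hlc : ContinuousOn (fun x => l (g⁻¹ * x)) ((fun x => g⁻¹ * x) ⁻¹' U) :=
    hl.comp (continuous_const_mul _).continuousOn fun x hx => hx
  -- Over `gU`, with local logarithm `l`, a point `X` is carried to the fibre of `g` by flowing
  -- along `-l(g⁻¹ exp X)`. Flowing forward along `l(g⁻¹ x)` inverts this.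
  refine ⟨{
    toFun := fun X => (⟨gexp X.1, X.2⟩,
      ⟨nilFlow (chartBracket E G) n X.1 (-l (g⁻¹ * gexp X.1)) 1, ?_⟩)
    invFun := fun p => ⟨nilFlow (chartBracket E G) n p.2.1 (l (g⁻¹ * p.1.1)) 1, ?_⟩
    left_inv := ?_
    right_inv := ?_
    continuous_toFun := ?_
    continuous_invFun := ?_ }, ?_⟩
  · have hx : g⁻¹ * gexp X.1 ∈ U := X.2
    rw [mem_preimage, mem_singleton_iff, h.gexp_nilFlow, one_smul, gexp_neg, hexpl _ hx]
    group
  · have hx : g⁻¹ * p.1.1 ∈ U := p.1.2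
    have hp : gexp p.2.1 = g := p.2.2
    rw [mem_preimage, h.gexp_nilFlow, one_smul, hexpl _ hx, hp, mul_inv_cancel_left]
    exact p.1.2
  · intro X
    ext
    exact hneg _ _
  · intro p
    have hx : g⁻¹ * p.1.1 ∈ U := p.1.2
    have hp : gexp p.2.1 = g := p.2.2
    have h1 : gexp (nilFlow (chartBracket E G) n p.2.1 (l (g⁻¹ * p.1.1)) 1) = p.1.1 := by
      rw [h.gexp_nilFlow, one_smul, hexpl _ hx, hp, mul_inv_cancel_left]
    refine Prod.ext (Subtype.ext h1) (Subtype.ext ?_)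
    simp only [h1]
    exact h.nilFlow_neg_nilFlow _ _
  · refine Continuous.prodMk ((hcexp.comp continuous_subtype_val).subtype_mk _)
      ((hflow1.comp (continuous_subtype_val.prodMk (Continuous.neg ?_))).subtype_mk _)
    exact hlc.comp_continuous (hcexp.comp continuous_subtype_val) fun X => X.2
  · refine (hflow1.comp ((continuous_subtype_val.comp continuous_snd).prodMk ?_)).subtype_mk _
    exact hlc.comp_continuous (continuous_subtype_val.comp continuous_fst) fun p => p.1.2
  · intro x
    rfl

end NilpotentFiltration

variable [SimplyConnectedSpace G]

/-- Since `G` is simply connected, the identity of `G` lifts to a section `F` of the covering. Both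
`F ∘ exp` and the identity of `E` lift `exp` and agree at 0, so they coincide. -/
theorem exists_expHomeomorph [LieRing.IsNilpotent (GroupLieAlgebra 𝓘(ℝ, E) G)] :
    ∃ Φ : E ≃ₜ G, ∀ X, Φ X = gexp X := by
  obtain ⟨N, n, h⟩ := exists_nilpotentFiltration (E := E) (G := G)
  have hcov := h.isCoveringMap_gexp
  have : LocallyPathConnectedSpace E := inferInstance
  have : LocallyPathConnectedSpace G := ChartedSpace.locallyPathConnectedSpace E G
  obtain ⟨F, ⟨hF0, hF⟩, -⟩ := hcov.existsUnique_continuousMap_lifts (ContinuousMap.id G) (1 : G)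
    (0 : E) (by simp [gexp_zero])
  have hF' : ∀ x, gexp (F x) = x := fun x => congrFun hF x
  have hleft : (fun X : E => F (gexp X)) = id := by
    refine hcov.eq_of_comp_eq (F.continuous.comp h.continuous_gexp) continuous_id ?_ (0 : E) ?_
    · funext X
      exact hF' _
    · simp [gexp_zero, hF0]
  exact ⟨{ toFun := gexp, invFun := F, left_inv := fun X => congrFun hleft X, right_inv := hF',
           continuous_toFun := h.continuous_gexp, continuous_invFun := F.continuous }, fun X => rfl⟩

variable (E G) in
/-- The exponential map of a simply connected nilpotent Lie group, as a homeomorphism. -/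
def expHomeo [LieRing.IsNilpotent (GroupLieAlgebra 𝓘(ℝ, E) G)] : E ≃ₜ G :=
  (exists_expHomeomorph (E := E) (G := G)).choose

variable [LieRing.IsNilpotent (GroupLieAlgebra 𝓘(ℝ, E) G)]

theorem expHomeo_apply (X : E) : expHomeo E G X = gexp X :=
  (exists_expHomeomorph (E := E) (G := G)).choose_spec X

theorem lieLog_eq (x : G) : lieLog x = (expHomeo E G).symm x := by
  have hfun : (fun X : E => lieExp (G := G) (X : GroupLieAlgebra 𝓘(ℝ, E) G)) = expHomeo E G :=
    funext fun X => (expHomeo_apply X).symm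
  apply (expHomeo E G).injective
  rw [(expHomeo E G).apply_symm_apply, lieLog, hfun]
  exact Function.invFun_eq ⟨(expHomeo E G).symm x, (expHomeo E G).apply_symm_apply x⟩

end ExpHomeomorph

/-! ### Haar measure in exponential coordinates and unimodularity -/

noncomputable section HaarMeasure

open Set Filter Topology

variable {E : Type*} [NormedAddCommGroup E] [NormedSpace ℝ E] [FiniteDimensional ℝ E]
  {G : Type*} [TopologicalSpace G] [T2Space G] [ChartedSpace E G] [Group G] [LieGroup 𝓘(ℝ, E) ∞ G]
  [SimplyConnectedSpace G] [LieRing.IsNilpotent (GroupLieAlgebra 𝓘(ℝ, E) G)]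

variable (E G) in
theorem expHomeo_symm_gexp (X : E) : (expHomeo E G).symm (gexp X) = X := by
  rw [← expHomeo_apply, Homeomorph.symm_apply_apply]

variable (E G) in
theorem gexp_expHomeo_symm (x : G) : gexp ((expHomeo E G).symm x) = x := by
  rw [← expHomeo_apply, Homeomorph.apply_symm_apply]

variable (E) in
/-- Left translation by `g` in exponential coordinates. -/
def logTranslate (g : G) (X : E) : E := (expHomeo E G).symm (g * gexp X)

theorem gexp_logTranslate (g : G) (X : E) : gexp (logTranslate E g X) = g * gexp X :=
  gexp_expHomeo_symm E G _

/-- Left translation does not change `(exp X)⁻¹ exp X'`, so in left-trivialised coordinates its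
derivative is the identity; returning to `E` at both ends gives the two factors. -/
theorem NilpotentFiltration.hasFDerivAt_logTranslate {N : ℕ → Submodule ℝ E} {n : ℕ}
    (h : NilpotentFiltration (chartBracket E G) N n) (g : G) (X : E) :
    HasFDerivAt (logTranslate E g)
      ((expDerivInv (chartBracket E G) n (logTranslate E g X)).comp
        (expDeriv (chartBracket E G) n X)) X := by
  have := topologicalGroup_of_lieGroup 𝓘(ℝ, E) ∞ (G := G)
  set Z := logTranslate E g X with hZ
  -- A continuous local inverse of `Z' ↦ (exp Z)⁻¹ exp Z'` read in the chart; continuity and the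
  -- invertible derivative of that map suffice to differentiate `q`.
  set q : E → E := fun p => (expHomeo E G).symm (gexp Z * (oneChart E G).symm p) with hq
  have hqZ : q (oneCoord E G) = Z := by
    simp only [hq, oneChart_symm_oneCoord, mul_one, expHomeo_symm_gexp]
  have hqd : HasFDerivAt q (expDerivInv (chartBracket E G) n Z) (oneCoord E G) := by
    have h1 := HasFDerivAt.of_local_left_inverse
      (f' := ContinuousLinearEquiv.equivOfInverse (expDeriv (chartBracket E G) n Z)
        (expDerivInv (chartBracket E G) n Z)
        (fun z => by simpa using congrArg (fun L : E →L[ℝ] E => L z) (h.expDerivInv_mul Z))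
        (fun z => by simpa using congrArg (fun L : E →L[ℝ] E => L z) (h.expDeriv_mul_inv Z)))
      (g := q) (a := oneCoord E G) ?_ (by rw [hqZ]; exact h.hasFDerivAt_inv_mul_gexp Z) ?_
    · exact h1
    · refine (expHomeo E G).symm.continuous.continuousAt.comp (ContinuousAt.mul continuousAt_const ?_)
      exact (oneChart E G).continuousAt_symm oneCoord_mem_target
    · filter_upwards [(oneChart E G).open_target.eventually_mem oneCoord_mem_target] with p hp
      simp only [hq, gexp_expHomeo_symm, inv_mul_cancel_left]
      exact (oneChart E G).right_inv hp
  have h1 := HasFDerivAt.comp X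
    (show HasFDerivAt q (expDerivInv (chartBracket E G) n Z)
      (oneChart E G ((gexp X)⁻¹ * gexp X)) by rw [inv_mul_cancel]; exact hqd)
    (h.hasFDerivAt_inv_mul_gexp X)
  refine h1.congr_of_eventuallyEq ?_
  filter_upwards [h.eventually_inv_mul_mem X] with X' hX'
  simp only [Function.comp_apply, hq, (oneChart E G).left_inv hX', hZ, gexp_logTranslate]
  simp [logTranslate, mul_assoc]

theorem NilpotentFiltration.det_expDerivInv {B : E →L[ℝ] E →L[ℝ] E} {N : ℕ → Submodule ℝ E} {n : ℕ}
    (h : NilpotentFiltration B N n) (X : E) :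
    LinearMap.det (expDerivInv B n X : E →ₗ[ℝ] E) = 1 := by
  have h1 := congrArg (fun L : E →L[ℝ] E => LinearMap.det (L : E →ₗ[ℝ] E)) (h.expDeriv_mul_inv X)
  have h2 : ((expDeriv B n X * expDerivInv B n X : E →L[ℝ] E) : E →ₗ[ℝ] E) =
    (expDeriv B n X : E →ₗ[ℝ] E) * (expDerivInv B n X : E →ₗ[ℝ] E) := rfl
  have h3 : ((1 : E →L[ℝ] E) : E →ₗ[ℝ] E) = 1 := rfl
  simpa only [h2, h3, map_mul, h.det_expDeriv, map_one, one_mul] using h1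

variable [MeasurableSpace E] [BorelSpace E]

/-- Change of variables: the Jacobian is a product of two unipotent determinants, hence 1. -/
theorem measurePreserving_logTranslate (ν : Measure E) [ν.IsAddHaarMeasure] (g : G) :
    MeasurePreserving (logTranslate E g) ν ν := by
  have := topologicalGroup_of_lieGroup 𝓘(ℝ, E) ∞ (G := G)
  obtain ⟨N, n, h⟩ := exists_nilpotentFiltration (E := E) (G := G)
  have hinv : ∀ a b : G, a * b = 1 → ∀ X : E, logTranslate E a (logTranslate E b X) = X := by
    intro a b hab X
    rw [logTranslate, gexp_logTranslate, ← mul_assoc, hab, one_mul, expHomeo_symm_gexp]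
  have hcont : ∀ a : G, Continuous (logTranslate E a) := fun a =>
    continuous_iff_continuousAt.2 fun X => (h.hasFDerivAt_logTranslate a X).continuousAt
  refine ⟨(hcont g).measurable, ?_⟩
  ext s hs
  rw [Measure.map_apply (hcont g).measurable hs]
  have hpre : logTranslate E g ⁻¹' s = logTranslate E g⁻¹ '' s :=
    (image_eq_preimage_of_inverse (hinv _ _ (mul_inv_cancel g)) (hinv _ _ (inv_mul_cancel g))
      |>.symm ▸ rfl)
  rw [hpre, ← lintegral_abs_det_fderiv_eq_addHaar_image ν hs
    (fun x _ => (h.hasFDerivAt_logTranslate g⁻¹ x).hasFDerivWithinAt)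
    (Function.LeftInverse.injective (hinv _ _ (mul_inv_cancel g))).injOn]
  have hdet : ∀ X Z : E, ((expDerivInv (chartBracket E G) n Z).comp
      (expDeriv (chartBracket E G) n X)).det = 1 := by
    intro X Z
    have : (((expDerivInv (chartBracket E G) n Z).comp
      (expDeriv (chartBracket E G) n X) : E →L[ℝ] E) : E →ₗ[ℝ] E) =
      (expDerivInv (chartBracket E G) n Z : E →ₗ[ℝ] E) *
        (expDeriv (chartBracket E G) n X : E →ₗ[ℝ] E) := rfl
    rw [ContinuousLinearMap.det, this, map_mul, h.det_expDeriv, h.det_expDerivInv, one_mul]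
  simp [hdet]

variable [MeasurableSpace G] [BorelSpace G]

theorem measurable_expHomeo : Measurable (expHomeo E G) := (expHomeo E G).continuous.measurable

instance isHaarMeasure_map_expHomeo (ν : Measure E) [ν.IsAddHaarMeasure] :
    (ν.map (expHomeo E G)).IsHaarMeasure := by
  have := topologicalGroup_of_lieGroup 𝓘(ℝ, E) ∞ (G := G)
  have h1 : IsFiniteMeasureOnCompacts (ν.map (expHomeo E G)) := by
    refine ⟨fun K hK => ?_⟩
    rw [Measure.map_apply measurable_expHomeo hK.measurableSet]
    exact ((expHomeo E G).isCompact_preimage.2 hK).measure_lt_top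
  have h2 : (ν.map (expHomeo E G)).IsOpenPosMeasure :=
    (expHomeo E G).continuous.isOpenPosMeasure_map (expHomeo E G).surjective
  have h3 : (ν.map (expHomeo E G)).IsMulLeftInvariant := by
    refine ⟨fun g => ?_⟩
    rw [Measure.map_map (continuous_const_mul g).measurable measurable_expHomeo]
    have : (fun x => g * x) ∘ (expHomeo E G) = (expHomeo E G) ∘ logTranslate E g := by
      funext X
      simp [expHomeo_apply, gexp_logTranslate]
    rw [this, ← Measure.map_map measurable_expHomeo (measurePreserving_logTranslate ν g).measurable,
      (measurePreserving_logTranslate ν g).map_eq]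
  exact {}

variable [SecondCountableTopology G] (μ : Measure G) [μ.IsHaarMeasure]

variable (E) in
theorem exists_eq_smul_map_expHomeo : ∃ c : NNReal, c ≠ 0 ∧
    μ = c • (Measure.addHaar (G := E)).map (expHomeo E G) := by
  have := topologicalGroup_of_lieGroup 𝓘(ℝ, E) ∞ (G := G)
  have : LocallyCompactSpace G := (expHomeo E G).symm.isClosedEmbedding.locallyCompactSpace
  exact ⟨_, (Measure.haarScalarFactor_pos_of_isHaarMeasure _ _).ne',
    Measure.isMulLeftInvariant_eq_smul μ _⟩

variable (E) in
theorem lieAlgebraHaar_eq : lieAlgebraHaar E μ = μ.map (expHomeo E G).symm := by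
  have : (lieLog : G → E) = (expHomeo E G).symm := funext lieLog_eq
  rw [lieAlgebraHaar, this]

variable (E) in
theorem isAddHaarMeasure_lieAlgebraHaar : (lieAlgebraHaar E μ).IsAddHaarMeasure := by
  obtain ⟨c, hc, h⟩ := exists_eq_smul_map_expHomeo E μ
  have : lieAlgebraHaar E μ = c • (Measure.addHaar (G := E)) := by
    rw [lieAlgebraHaar_eq, h, Measure.map_smul, Measure.map_map
      (expHomeo E G).symm.continuous.measurable measurable_expHomeo]
    simp
  rw [this]
  exact Measure.IsAddHaarMeasure.nnreal_smul _ hc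

variable (E) in
theorem measurePreserving_expHomeo :
    MeasurePreserving (expHomeo E G) (lieAlgebraHaar E μ) μ := by
  refine ⟨measurable_expHomeo, ?_⟩
  rw [lieAlgebraHaar_eq, Measure.map_map measurable_expHomeo
    (expHomeo E G).symm.continuous.measurable]
  simp

variable (E) in
include E in
-- Inversion is `X ↦ -X` in exponential coordinates, which preserves Lebesgue measure. Together with
-- left invariance this replaces unimodularity.
theorem isInvInvariant_of_isHaarMeasure : μ.IsInvInvariant := by
  have := topologicalGroup_of_lieGroup 𝓘(ℝ, E) ∞ (G := G)
  have := isAddHaarMeasure_lieAlgebraHaar E μ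
  refine ⟨?_⟩
  have h := measurePreserving_expHomeo E μ
  rw [Measure.inv]
  conv_lhs => rw [← h.map_eq]
  rw [Measure.map_map measurable_inv measurable_expHomeo]
  have h1 : Inv.inv ∘ (expHomeo E G) = (expHomeo E G) ∘ Neg.neg := by
    funext X
    simp [expHomeo_apply, gexp_neg]
  rw [h1, ← Measure.map_map measurable_expHomeo measurable_neg]
  have h2 : (lieAlgebraHaar E μ).map Neg.neg = lieAlgebraHaar E μ :=
    Measure.IsNegInvariant.neg_eq_self
  rw [h2, h.map_eq]

end HaarMeasure

/-! ### Plancherel's theorem on a vector space and its dual, with the dual Haar measure -/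

noncomputable section Plancherel

open Set Filter Topology FourierTransform

theorem eLpNorm_two_sq {α F : Type*} [MeasurableSpace α] [NormedAddCommGroup F] (f : α → F)
    (m : Measure α) : eLpNorm f 2 m ^ 2 = ∫⁻ x, ‖f x‖ₑ ^ 2 ∂m := by
  have := eLpNorm_nnreal_pow_eq_lintegral (f := f) (μ := m) (p := 2) (by norm_num)
  simpa using this

section InnerProductSpace

variable {V : Type*} [NormedAddCommGroup V] [InnerProductSpace ℝ V] [FiniteDimensional ℝ V]
  [MeasurableSpace V] [BorelSpace V]

/-- The Fourier integral of a function in `L¹ ∩ L²` is a representative of its Fourier transform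
in `L²`. -/
theorem fourier_toLp_two_ae_eq {f : V → ℂ} (h1 : Integrable f) (h2 : MemLp f 2) :
    (𝓕 (h2.toLp f) : Lp ℂ 2 (volume : Measure V)) =ᵐ[volume] 𝓕 f := by
  have hcont : Continuous (𝓕 f) :=
    VectorFourier.fourierIntegral_continuous (L := innerₗ V) Real.continuous_fourierChar
      continuous_inner h1
  refine ae_eq_of_integral_contDiff_smul_eq
    ((Lp.memLp _).locallyIntegrable (by norm_num)) hcont.locallyIntegrable ?_
  intro g hg hgc
  have hg₁ : HasCompactSupport (Complex.ofRealCLM ∘ g) := hgc.comp_left rfl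
  have hg₂ : ContDiff ℝ ∞ (Complex.ofRealCLM ∘ g) := by fun_prop
  set φ : 𝓢(V, ℂ) := hg₁.toSchwartzMap hg₂ with hφ
  have hφg : ∀ x, φ x = (g x : ℂ) := fun x => by simp [hφ]
  -- Both candidates pair with the test function `φ` as `f` pairs with `𝓕 φ`: the `L²` transform by
  -- duality for tempered distributions, the Fourier integral by Fubini.
  have key := congrArg (fun T : 𝓢'(V, ℂ) => T φ)
    (Lp.fourier_toTemperedDistribution_eq (h2.toLp f))
  simp only [TemperedDistribution.fourier_apply, Lp.toTemperedDistribution_apply] at key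
  have e1 : ∫ x, g x • (𝓕 (h2.toLp f) : Lp ℂ 2 (volume : Measure V)) x
      = ∫ x, φ x • (𝓕 (h2.toLp f) : Lp ℂ 2 (volume : Measure V)) x := by
    simp [hφg]
  rw [e1, ← key]
  have e2 : ∫ x, (𝓕 φ) x • h2.toLp f x = ∫ x, (𝓕 φ) x • f x := by
    refine integral_congr_ae ?_
    filter_upwards [h2.coeFn_toLp] with x hx
    rw [hx]
  rw [e2]
  have e3 := VectorFourier.integral_fourierIntegral_smul_eq_flip (L := innerₗ V)
    Real.continuous_fourierChar continuous_inner φ.integrable (μ := volume) (ν := volume) h1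
  rw [flip_innerₗ] at e3
  have e4 : ∫ x, φ x • (𝓕 f) x = ∫ x, g x • (𝓕 f) x := by simp [hφg]
  rw [← e4]
  exact e3

theorem lintegral_enorm_fourier_sq {f : V → ℂ} (h1 : Integrable f) (h2 : MemLp f 2) :
    ∫⁻ w, ‖𝓕 f w‖ₑ ^ 2 = ∫⁻ x, ‖f x‖ₑ ^ 2 := by
  have h := Lp.norm_fourier_eq (h2.toLp f)
  have h3 : eLpNorm (𝓕 f) 2 volume = eLpNorm f 2 volume := by
    rw [← eLpNorm_congr_ae (fourier_toLp_two_ae_eq h1 h2), ← eLpNorm_congr_ae h2.coeFn_toLp,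
      ← Lp.enorm_def, ← Lp.enorm_def, enorm_eq_iff_norm_eq, h]
  rw [← eLpNorm_two_sq, ← eLpNorm_two_sq, h3]

end InnerProductSpace

variable {E : Type*} [NormedAddCommGroup E] [NormedSpace ℝ E] [FiniteDimensional ℝ E]
  [MeasurableSpace E] [BorelSpace E]

theorem eq_smul_addHaar_basis {ι : Type*} [Fintype ι] (b : Module.Basis ι ℝ E) (ν : Measure E)
    [ν.IsAddHaarMeasure] : ν = ν (parallelepiped b) • b.addHaar := by
  have := Measure.addHaarMeasure_unique ν b.parallelepiped
  rwa [← Module.Basis.addHaar_def, Module.Basis.coe_parallelepiped] at this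

variable (E) in
/-- The coordinates of a basis, as an isomorphism from a Euclidean space. -/
def euclideanCoord : EuclideanSpace ℝ (Fin (Module.finrank ℝ E)) ≃L[ℝ] E :=
  ((EuclideanSpace.basisFun (Fin (Module.finrank ℝ E)) ℝ).toBasis.equiv (Module.finBasis ℝ E)
    (Equiv.refl _)).toContinuousLinearEquiv

variable (E) in
/-- The coordinates of a dual basis, as an isomorphism from a Euclidean space. -/
def euclideanDualCoord : EuclideanSpace ℝ (Fin (Module.finrank ℝ E)) ≃L[ℝ] StrongDual ℝ E :=
  ((EuclideanSpace.basisFun (Fin (Module.finrank ℝ E)) ℝ).toBasis.equiv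
    ((Module.finBasis ℝ E).dualBasis.map
      (LinearMap.toContinuousLinearMap : (E →ₗ[ℝ] ℝ) ≃ₗ[ℝ] StrongDual ℝ E))
    (Equiv.refl _)).toContinuousLinearEquiv

theorem map_volume_euclideanCoord :
    Measure.map (euclideanCoord E) volume = (Module.finBasis ℝ E).addHaar := by
  rw [← (EuclideanSpace.basisFun (Fin (Module.finrank ℝ E)) ℝ).addHaar_eq_volume,
    Module.Basis.map_addHaar]
  congr 1
  ext i
  simp [euclideanCoord]

theorem map_volume_euclideanDualCoord :
    Measure.map (euclideanDualCoord E) volume = ((Module.finBasis ℝ E).dualBasis.map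
      (LinearMap.toContinuousLinearMap : (E →ₗ[ℝ] ℝ) ≃ₗ[ℝ] StrongDual ℝ E)).addHaar := by
  rw [← (EuclideanSpace.basisFun (Fin (Module.finrank ℝ E)) ℝ).addHaar_eq_volume,
    Module.Basis.map_addHaar]
  congr 1
  ext i
  simp [euclideanDualCoord]

/-- Coordinates in a basis and in its dual basis turn the duality pairing into the Euclidean inner
product, which reduces Plancherel on `𝔤` to the Euclidean case. -/
theorem euclideanDualCoord_apply (η x : EuclideanSpace ℝ (Fin (Module.finrank ℝ E))) :
    euclideanDualCoord E η (euclideanCoord E x) = inner ℝ x η := by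
  have h1 : ∀ i j, euclideanDualCoord E (EuclideanSpace.basisFun _ ℝ i)
      (euclideanCoord E (EuclideanSpace.basisFun _ ℝ j)) = if i = j then 1 else 0 := by
    intro i j
    have e1 : euclideanCoord E (EuclideanSpace.basisFun _ ℝ j) = Module.finBasis ℝ E j := by
      have := (EuclideanSpace.basisFun (Fin (Module.finrank ℝ E)) ℝ).toBasis.equiv_apply j
        (Module.finBasis ℝ E) (Equiv.refl _)
      simpa [euclideanCoord] using this
    have e2 : euclideanDualCoord E (EuclideanSpace.basisFun _ ℝ i) =
        (Module.finBasis ℝ E).dualBasis.map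
          (LinearMap.toContinuousLinearMap : (E →ₗ[ℝ] ℝ) ≃ₗ[ℝ] StrongDual ℝ E) i := by
      have := (EuclideanSpace.basisFun (Fin (Module.finrank ℝ E)) ℝ).toBasis.equiv_apply i
        ((Module.finBasis ℝ E).dualBasis.map
          (LinearMap.toContinuousLinearMap : (E →ₗ[ℝ] ℝ) ≃ₗ[ℝ] StrongDual ℝ E)) (Equiv.refl _)
      simpa [euclideanDualCoord] using this
    rw [e1, e2]
    simp [Finsupp.single_apply, eq_comm]
  have hx := (EuclideanSpace.basisFun (Fin (Module.finrank ℝ E)) ℝ).sum_repr x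
  have hη := (EuclideanSpace.basisFun (Fin (Module.finrank ℝ E)) ℝ).sum_repr η
  conv_lhs => rw [← hx, ← hη]
  simp only [map_sum, map_smul, sum_apply, smul_apply, h1]
  simp [PiLp.inner_apply, mul_comm]

/-- Plancherel's theorem for the Fourier transform from `(𝔤, dX)` to `(𝔤♯, dξ)`. -/
theorem lintegral_enorm_fourier_sq_dualHaar (ν : Measure E) [ν.IsAddHaarMeasure] {F : E → ℂ}
    (h1 : Integrable F ν) (h2 : MemLp F 2 ν) :
    ∫⁻ ξ : StrongDual ℝ E, ‖∫ X, F X * Complex.exp (Complex.I * ((ξ X : ℝ) : ℂ)) ∂ν‖ₑ ^ 2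
      ∂(dualHaar ν) = ∫⁻ X, ‖F X‖ₑ ^ 2 ∂ν := by
  set b := Module.finBasis ℝ E with hb
  set c := ν (parallelepiped b) with hc
  have hν : ν = c • b.addHaar := eq_smul_addHaar_basis b ν
  have hc0 : c ≠ 0 := by
    intro h
    rw [h, zero_smul] at hν
    exact NeZero.ne ν hν
  have hct : c ≠ ⊤ := by
    rw [hc, ← Module.Basis.coe_parallelepiped]
    exact b.parallelepiped.isCompact.measure_lt_top.ne
  have hν' : ν = c • Measure.map (euclideanCoord E) volume := by
    rw [map_volume_euclideanCoord]; exact hν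
  have hme : MeasurableEmbedding (euclideanCoord E) :=
    (euclideanCoord E).toHomeomorph.measurableEmbedding
  have hmd : MeasurableEmbedding (euclideanDualCoord E) :=
    (euclideanDualCoord E).toHomeomorph.measurableEmbedding
  set f : EuclideanSpace ℝ (Fin (Module.finrank ℝ E)) → ℂ := fun x => F (euclideanCoord E x) with hf
  have hvol : Measure.map (euclideanCoord E) volume = c⁻¹ • ν := by
    conv_rhs => rw [hν']
    rw [smul_smul, ENNReal.inv_mul_cancel hc0 hct, one_smul]
  have hf1 : Integrable f := by
    have := h1.smul_measure (ENNReal.inv_ne_top.2 hc0)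
    rw [← hvol] at this
    exact hme.integrable_map_iff.1 this
  have hf2 : MemLp f 2 := by
    have := h2.smul_measure (ENNReal.inv_ne_top.2 hc0)
    rw [← hvol] at this
    exact hme.memLp_map_measure_iff.1 this
  have hpl := lintegral_enorm_fourier_sq hf1 hf2
  have hr : ∫⁻ X, ‖F X‖ₑ ^ 2 ∂ν = c * ∫⁻ x, ‖f x‖ₑ ^ 2 := by
    conv_lhs => rw [hν']
    rw [lintegral_smul_measure, hme.lintegral_map, smul_eq_mul]
  have hπ : (2 * Real.pi)⁻¹ ≠ 0 := by positivity
  -- The character `e^{i⟨X, η⟩}` becomes `e^{-2πi⟨X, ·⟩}` at `-(2π)⁻¹ η`; the dilation costs the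
  -- factor `(2π)ⁿ` found in `dualHaar`.
  have hI : ∀ η, ∫ X, F X * Complex.exp (Complex.I * ((euclideanDualCoord E η X : ℝ) : ℂ)) ∂ν =
      c.toReal • 𝓕 f (-(2 * Real.pi)⁻¹ • η) := by
    intro η
    conv_lhs => rw [hν']
    rw [integral_smul_measure, hme.integral_map, Real.fourier_eq']
    congr 1
    refine integral_congr_ae (ae_of_all _ fun x => ?_)
    simp only [euclideanDualCoord_apply, hf, inner_smul_right, smul_eq_mul]
    rw [mul_comm]
    congr 2
    push_cast
    have : (Real.pi : ℂ) ≠ 0 := by exact_mod_cast Real.pi_ne_zero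
    field_simp
  have hscale : ∫⁻ η, ‖𝓕 f (-(2 * Real.pi)⁻¹ • η)‖ₑ ^ 2 =
      ENNReal.ofReal ((2 * Real.pi) ^ Module.finrank ℝ E) * ∫⁻ w, ‖𝓕 f w‖ₑ ^ 2 := by
    have h3 := Measure.map_addHaar_smul (volume : Measure (EuclideanSpace ℝ (Fin (Module.finrank ℝ E))))
      (neg_ne_zero.2 hπ)
    have h4 : MeasurableEmbedding
        fun x : EuclideanSpace ℝ (Fin (Module.finrank ℝ E)) => (-(2 * Real.pi)⁻¹) • x :=
      (Homeomorph.smulOfNeZero _ (neg_ne_zero.2 hπ)).measurableEmbedding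
    rw [← h4.lintegral_map (f := fun w => ‖𝓕 f w‖ₑ ^ 2), h3, lintegral_smul_measure, smul_eq_mul]
    congr 2
    rw [finrank_euclideanSpace, Fintype.card_fin, ← inv_pow, abs_pow, inv_neg, inv_inv, abs_neg,
      abs_of_pos (by positivity)]
  have h2π : ENNReal.ofReal ((2 * Real.pi) ^ Module.finrank ℝ E) ≠ 0 := by
    simp only [ne_eq, ENNReal.ofReal_eq_zero, not_le]; positivity
  rw [dualHaar, ← map_volume_euclideanDualCoord, lintegral_smul_measure, hmd.lintegral_map, hr, ← hb, ← hc]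
  simp only [hI, enorm_smul, mul_pow ‖c.toReal‖ₑ]
  rw [lintegral_const_mul' _ _ (by simp), hscale, hpl, smul_eq_mul]
  have hce : ‖c.toReal‖ₑ = c := by
    rw [Real.enorm_eq_ofReal ENNReal.toReal_nonneg, ENNReal.ofReal_toReal hct]
  rw [hce, ENNReal.mul_inv (Or.inl h2π) (Or.inl ENNReal.ofReal_ne_top)]
  -- Squaring the integral against `ν` gives `c²`; the normalisation of `dualHaar` removes `(2π)ⁿ`
  -- and one factor `c`, and the other factor belongs to the integral of `‖F‖²` against `ν`.
  calc _ = (ENNReal.ofReal ((2 * Real.pi) ^ Module.finrank ℝ E))⁻¹ *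
          ENNReal.ofReal ((2 * Real.pi) ^ Module.finrank ℝ E) * (c⁻¹ * c) * (c * ∫⁻ x, ‖f x‖ₑ ^ 2) := by
        ring
    _ = _ := by
        rw [ENNReal.inv_mul_cancel h2π ENNReal.ofReal_ne_top, ENNReal.inv_mul_cancel hc0 hct,
          one_mul, one_mul]

theorem isAddHaarMeasure_dualHaar (ν : Measure E) [ν.IsAddHaarMeasure] :
    (dualHaar ν).IsAddHaarMeasure := by
  have hct : ν (parallelepiped (Module.finBasis ℝ E)) ≠ ⊤ := by
    rw [← Module.Basis.coe_parallelepiped]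
    exact (Module.finBasis ℝ E).parallelepiped.isCompact.measure_lt_top.ne
  have hc0 : ν (parallelepiped (Module.finBasis ℝ E)) ≠ 0 := by
    intro h
    have hν := eq_smul_addHaar_basis (Module.finBasis ℝ E) ν
    rw [h, zero_smul] at hν
    exact NeZero.ne ν hν
  have h2π : ENNReal.ofReal ((2 * Real.pi) ^ Module.finrank ℝ E) ≠ 0 := by
    simp only [ne_eq, ENNReal.ofReal_eq_zero, not_le]; positivity
  exact Measure.IsAddHaarMeasure.smul _ (ENNReal.inv_ne_zero.2
    (ENNReal.mul_ne_top ENNReal.ofReal_ne_top hct)) (ENNReal.inv_ne_top.2 (mul_ne_zero h2π hc0))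

end Plancherel

/-! ### Coherent states and their orthogonality relation -/

noncomputable section CoherentStates

open Set Filter Topology

variable {E : Type*} [NormedAddCommGroup E] [NormedSpace ℝ E] [FiniteDimensional ℝ E]
  {G : Type*} [TopologicalSpace G] [T2Space G] [ChartedSpace E G] [Group G] [LieGroup 𝓘(ℝ, E) ∞ G]
  [SimplyConnectedSpace G] [LieRing.IsNilpotent (GroupLieAlgebra 𝓘(ℝ, E) G)]

theorem continuous_lieLog : Continuous (lieLog : G → E) := by
  rw [show (lieLog : G → E) = (expHomeo E G).symm from funext lieLog_eq]
  exact (expHomeo E G).symm.continuous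

theorem gexp_lieLog (x : G) : gexp (lieLog x : E) = x := by
  rw [lieLog_eq, gexp_expHomeo_symm]

theorem lieLog_gexp (X : E) : lieLog (gexp X : G) = X := by
  rw [lieLog_eq, expHomeo_symm_gexp]

theorem IsSchwartz.exists_comp_lieLog {w : G → ℂ} (hw : IsSchwartz (E := E) w) :
    ∃ φ : 𝓢(E, ℂ), w = fun x => φ (lieLog x) := by
  obtain ⟨φ, hφ⟩ := hw
  refine ⟨φ, funext fun x => ?_⟩
  rw [← hφ]
  exact congrArg w (gexp_lieLog x).symm

theorem IsSchwartz.continuous {w : G → ℂ} (hw : IsSchwartz (E := E) w) : Continuous w := by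
  obtain ⟨φ, rfl⟩ := hw.exists_comp_lieLog
  exact φ.continuous.comp continuous_lieLog

theorem IsSchwartz.exists_norm_le {w : G → ℂ} (hw : IsSchwartz (E := E) w) :
    ∃ C : ℝ, ∀ x, ‖w x‖ ≤ C := by
  obtain ⟨φ, rfl⟩ := hw.exists_comp_lieLog
  obtain ⟨C, hC⟩ := φ.decay 0 0
  exact ⟨C, fun x => by simpa using hC.2 (lieLog x)⟩

theorem continuous_coherentState_uncurry {w : G → ℂ} (hw : Continuous w) :
    Continuous fun q : (G × StrongDual ℝ E) × G => coherentState w q.1 q.2 := by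
  have := topologicalGroup_of_lieGroup 𝓘(ℝ, E) ∞ (G := G)
  have hm : Continuous fun q : (G × StrongDual ℝ E) × G => q.1.1 * q.2 := by fun_prop
  have h1 : Continuous fun q : (G × StrongDual ℝ E) × G => q.1.2 (lieLog (q.1.1 * q.2)) :=
    (continuous_snd.comp continuous_fst).clm_apply (continuous_lieLog.comp hm)
  unfold coherentState
  exact (Complex.continuous_exp.comp (continuous_const.mul
    (Complex.continuous_ofReal.comp h1)).neg).mul (hw.comp hm)

theorem continuous_coherentState {w : G → ℂ} (hw : Continuous w) (p : G × StrongDual ℝ E) :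
    Continuous (coherentState w p) :=
  (continuous_coherentState_uncurry hw).comp (f := fun x => (p, x)) (by fun_prop)

theorem norm_coherentState (w : G → ℂ) (p : G × StrongDual ℝ E) (x : G) :
    ‖coherentState w p x‖ = ‖w (p.1 * x)‖ := by
  rw [coherentState, norm_mul, ← mul_neg, ← Complex.ofReal_neg, mul_comm Complex.I,
    Complex.norm_exp_ofReal_mul_I, one_mul]

variable [MeasurableSpace E] [BorelSpace E] [MeasurableSpace G] [BorelSpace G]
  [SecondCountableTopology G] (μ : Measure G) [μ.IsHaarMeasure]

/-- The dummy vector only tells unification which model space is meant, since the conclusion does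
not mention it. -/
theorem sigmaFinite_of_expHomeo (_ : E) : SigmaFinite μ := by
  have : LocallyCompactSpace G := (expHomeo E G).symm.isClosedEmbedding.locallyCompactSpace
  infer_instance

theorem eLpNorm_coherentState {w : G → ℂ} (hw : Continuous w) (p : G × StrongDual ℝ E) :
    eLpNorm (coherentState w p) 2 μ = eLpNorm w 2 μ := by
  have := topologicalGroup_of_lieGroup 𝓘(ℝ, E) ∞ (G := G)
  rw [eLpNorm_congr_norm_ae (ae_of_all _ (norm_coherentState w p))]
  exact eLpNorm_comp_measurePreserving (f := fun x => p.1 * x) hw.aestronglyMeasurable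
    (measurePreserving_mul_left μ p.1)

theorem memLp_coherentState {w : G → ℂ} (hw : Continuous w) (hw1 : eLpNorm w 2 μ = 1)
    (p : G × StrongDual ℝ E) : MemLp (coherentState w p) 2 μ :=
  ⟨(continuous_coherentState hw p).aestronglyMeasurable, by
    rw [eLpNorm_coherentState μ hw, hw1]; exact ENNReal.one_lt_top⟩

theorem inner_toLp_coherentState {w : G → ℂ} (hw : Continuous w) (hw1 : eLpNorm w 2 μ = 1)
    (u : Lp ℂ 2 μ) (p : G × StrongDual ℝ E) :
    inner ℂ ((memLp_coherentState μ hw hw1 p).toLp _) u = coherentCoeff μ w u p := by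
  rw [L2.inner_def, coherentCoeff]
  refine integral_congr_ae ?_
  filter_upwards [(memLp_coherentState μ hw hw1 p).coeFn_toLp] with x hx
  rw [hx, RCLike.inner_apply]

theorem norm_toLp_coherentState {w : G → ℂ} (hw : Continuous w) (hw1 : eLpNorm w 2 μ = 1)
    (p : G × StrongDual ℝ E) : ‖(memLp_coherentState μ hw hw1 p).toLp _‖ = 1 := by
  rw [Lp.norm_toLp, eLpNorm_coherentState μ hw, hw1, ENNReal.toReal_one]

theorem stronglyMeasurable_coherentCoeff {w : G → ℂ} (hw : Continuous w) (u : Lp ℂ 2 μ) :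
    StronglyMeasurable (coherentCoeff (E := E) μ w u) := by
  have := sigmaFinite_of_expHomeo (E := E) μ 0
  have : ProperSpace (StrongDual ℝ E) := FiniteDimensional.proper ℝ _
  have h1 : StronglyMeasurable fun q : (G × StrongDual ℝ E) × G =>
      u q.2 * starRingEnd ℂ (coherentState w q.1 q.2) :=
    ((Lp.stronglyMeasurable u).comp_measurable measurable_snd).mul
      (Complex.continuous_conj.comp (continuous_coherentState_uncurry hw)).stronglyMeasurable
  exact h1.integral_prod_right

/-- Substituting `x = z⁻¹ y` moves the translation onto `u`; the only dependence on `ζ` left is a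
character evaluated at `X = log y`. -/
theorem coherentCoeff_eq_fourier (w : G → ℂ) (u : Lp ℂ 2 μ) (z : G) (ζ : StrongDual ℝ E) :
    coherentCoeff μ w u (z, ζ) =
      ∫ X, (u (z⁻¹ * gexp X) * starRingEnd ℂ (w (gexp X))) *
        Complex.exp (Complex.I * ((ζ X : ℝ) : ℂ)) ∂(lieAlgebraHaar E μ) := by
  have := topologicalGroup_of_lieGroup 𝓘(ℝ, E) ∞ (G := G)
  have h1 : coherentCoeff μ w u (z, ζ) = ∫ y, (u (z⁻¹ * y) * starRingEnd ℂ (w y)) *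
      Complex.exp (Complex.I * ((ζ (lieLog y) : ℝ) : ℂ)) ∂μ := by
    rw [← integral_mul_left_eq_self _ z, coherentCoeff]
    refine integral_congr_ae (ae_of_all _ fun x => ?_)
    simp only [coherentState, inv_mul_cancel_left, map_mul, ← Complex.exp_conj, map_neg,
      Complex.conj_I, Complex.conj_ofReal, neg_mul, neg_neg]
    ring
  rw [h1, ← (measurePreserving_expHomeo E μ).integral_comp (expHomeo E G).measurableEmbedding]
  simp only [expHomeo_apply, lieLog_gexp]

/-- By Tonelli the `z`-integral may be taken first. For fixed `y` the map `z ↦ z⁻¹ y` preserves the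
measure up to inversion and left translation, both of which leave Haar measure invariant. -/
theorem lintegral_enorm_sq_translate (_ : E) {u v : G → ℂ} (hu : StronglyMeasurable u)
    (hv : Measurable v) :
    ∫⁻ z, ∫⁻ y, ‖u (z⁻¹ * y)‖ₑ ^ 2 * ‖v y‖ₑ ^ 2 ∂μ ∂μ =
      (∫⁻ y, ‖u y‖ₑ ^ 2 ∂μ) * ∫⁻ y, ‖v y‖ₑ ^ 2 ∂μ := by
  have := topologicalGroup_of_lieGroup 𝓘(ℝ, E) ∞ (G := G)
  have := sigmaFinite_of_expHomeo (E := E) μ 0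
  have := isInvInvariant_of_isHaarMeasure E μ
  have hu' : Measurable u := hu.measurable
  rw [lintegral_lintegral_swap (by fun_prop)]
  have h1 : ∀ y, ∫⁻ z, ‖u (z⁻¹ * y)‖ₑ ^ 2 * ‖v y‖ₑ ^ 2 ∂μ =
      (∫⁻ y, ‖u y‖ₑ ^ 2 ∂μ) * ‖v y‖ₑ ^ 2 := by
    intro y
    rw [lintegral_mul_const _ (by fun_prop)]
    congr 1
    rw [← lintegral_mul_left_eq_self _ y, ← lintegral_inv_eq_self (fun y => ‖u y‖ₑ ^ 2)]
    simp
  simp only [h1]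
  rw [lintegral_const_mul _ (by fun_prop)]

/-- The orthogonality relation of the coherent states. -/
theorem lintegral_enorm_coherentCoeff_sq {w : G → ℂ} (hw : IsSchwartz (E := E) w)
    (hw1 : eLpNorm w 2 μ = 1) (u : Lp ℂ 2 μ) :
    ∫⁻ p, ‖coherentCoeff μ w u p‖ₑ ^ 2 ∂(phaseMeasure E μ) = ‖u‖ₑ ^ 2 := by
  have := topologicalGroup_of_lieGroup 𝓘(ℝ, E) ∞ (G := G)
  have := sigmaFinite_of_expHomeo (E := E) μ 0
  have := isAddHaarMeasure_lieAlgebraHaar E μ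
  have := isAddHaarMeasure_dualHaar (lieAlgebraHaar E μ)
  have : ProperSpace (StrongDual ℝ E) := FiniteDimensional.proper ℝ _
  obtain ⟨C, hC⟩ := hw.exists_norm_le
  have hwm : MemLp w 2 μ := ⟨hw.continuous.aestronglyMeasurable, by simp [hw1]⟩
  have hmp := measurePreserving_expHomeo E μ
  rw [phaseMeasure, lintegral_prod _
    ((stronglyMeasurable_coherentCoeff μ hw.continuous u).enorm.pow_const 2).aemeasurable]
  have h1 : ∀ z, ∫⁻ ζ, ‖coherentCoeff μ w u (z, ζ)‖ₑ ^ 2 ∂(dualHaar (lieAlgebraHaar E μ)) =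
      ∫⁻ y, ‖u (z⁻¹ * y)‖ₑ ^ 2 * ‖w y‖ₑ ^ 2 ∂μ := by
    intro z
    have hu : MemLp (fun y => u (z⁻¹ * y)) 2 μ :=
      (Lp.memLp u).comp_measurePreserving (measurePreserving_mul_left μ z⁻¹)
    have hwc : MemLp (fun y => starRingEnd ℂ (w y)) 2 μ := hwm.star
    have hF1 : Integrable (fun y => u (z⁻¹ * y) * starRingEnd ℂ (w y)) μ := hu.integrable_mul hwc
    -- Plancherel requires the product in `L²` as well as in `L¹`; this is where boundedness of the
    -- Schwartz function `w` enters.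
    have hF2 : MemLp (fun y => u (z⁻¹ * y) * starRingEnd ℂ (w y)) 2 μ := by
      refine MemLp.mono' (hu.norm.const_mul C) hF1.aestronglyMeasurable (ae_of_all _ fun y => ?_)
      rw [norm_mul, RCLike.norm_conj, mul_comm]
      exact mul_le_mul_of_nonneg_right (hC y) (norm_nonneg _)
    have hpl := lintegral_enorm_fourier_sq_dualHaar (lieAlgebraHaar E μ)
      (hmp.integrable_comp_of_integrable hF1) (hF2.comp_measurePreserving hmp)
    simp only [Function.comp_apply, expHomeo_apply] at hpl
    simp only [coherentCoeff_eq_fourier]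
    rw [hpl]
    have := hmp.lintegral_comp_emb (expHomeo E G).measurableEmbedding
      (fun y => ‖u (z⁻¹ * y)‖ₑ ^ 2 * ‖w y‖ₑ ^ 2)
    simp only [expHomeo_apply] at this
    rw [← this]
    simp only [enorm_mul, mul_pow, RCLike.enorm_conj]
  simp only [h1]
  rw [lintegral_enorm_sq_translate μ (0 : E) (Lp.stronglyMeasurable u) hw.continuous.measurable,
    ← eLpNorm_two_sq, ← eLpNorm_two_sq, hw1, one_pow, mul_one, Lp.enorm_def]

end CoherentStates

/-! ### Traces, compact operators and Schatten norms in Hilbert space -/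

noncomputable section SchattenBound

open Set Filter Topology

variable {H : Type u} [NormedAddCommGroup H] [InnerProductSpace ℂ H]

theorem enorm_sq_eq_ofReal_sq {F : Type*} [NormedAddCommGroup F] (x : F) :
    ‖x‖ₑ ^ 2 = ENNReal.ofReal (‖x‖ ^ 2) := by
  rw [ENNReal.ofReal_pow (norm_nonneg _), ofReal_norm]

theorem hasSum_norm_inner_sq {ι : Type*} (b : HilbertBasis ι ℂ H) (x : H) :
    HasSum (fun i => ‖inner ℂ (b i) x‖ ^ 2) (‖x‖ ^ 2) := by
  have h := (b.hasSum_inner_mul_inner x x).mapL Complex.reCLM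
  have h1 : ∀ i, Complex.reCLM (inner ℂ x (b i) * inner ℂ (b i) x) = ‖inner ℂ (b i) x‖ ^ 2 := by
    intro i
    rw [← inner_conj_symm x (b i), Complex.reCLM_apply, Complex.conj_mul']
    norm_cast
  simp only [h1] at h
  have h2 : Complex.reCLM (inner ℂ x x) = ‖x‖ ^ 2 := by
    rw [inner_self_eq_norm_sq_to_K]
    simp [← Complex.ofReal_pow]
  rwa [h2] at h

theorem tsum_enorm_inner_sq {ι : Type*} (b : HilbertBasis ι ℂ H) (x : H) :
    ∑' i, ‖inner ℂ (b i) x‖ₑ ^ 2 = ‖x‖ₑ ^ 2 := by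
  have h := hasSum_norm_inner_sq b x
  simp only [enorm_sq_eq_ofReal_sq]
  rw [← ENNReal.ofReal_tsum_of_nonneg (fun i => by positivity) h.summable, h.tsum_eq]

theorem sum_enorm_inner_sq_le {ι : Type*} {e : ι → H} (he : Orthonormal ℂ e) (s : Finset ι)
    (x : H) : ∑ i ∈ s, ‖inner ℂ (e i) x‖ₑ ^ 2 ≤ ‖x‖ₑ ^ 2 := by
  simp only [enorm_sq_eq_ofReal_sq]
  rw [← ENNReal.ofReal_sum_of_nonneg fun i _ => by positivity]
  exact ENNReal.ofReal_le_ofReal (he.sum_inner_products_le x)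

/-- The Bessel inequality for products of coefficients along two orthonormal families. -/
theorem sum_enorm_inner_mul_le {ι : Type*} {e g : ι → H} (he : Orthonormal ℂ e)
    (hg : Orthonormal ℂ g) (s : Finset ι) {x : H} (hx : ‖x‖ ≤ 1) :
    ∑ i ∈ s, ‖inner ℂ (e i) x‖ₑ * ‖inner ℂ (g i) x‖ₑ ≤ 1 := by
  have h := Finset.sum_mul_sq_le_sq_mul_sq s (fun i => ‖inner ℂ (e i) x‖)
    (fun i => ‖inner ℂ (g i) x‖)
  have h1 : ∑ i ∈ s, ‖inner ℂ (e i) x‖ * ‖inner ℂ (g i) x‖ ≤ 1 := by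
    have hx2 : ‖x‖ ^ 2 ≤ 1 := pow_le_one₀ (norm_nonneg _) hx
    refine (sq_le_one_iff₀ (by positivity)).1 (h.trans ?_)
    exact mul_le_one₀ ((he.sum_inner_products_le x).trans hx2) (by positivity)
      ((hg.sum_inner_products_le x).trans hx2)
  simp only [← ofReal_norm, ← ENNReal.ofReal_mul (norm_nonneg _)]
  rw [← ENNReal.ofReal_sum_of_nonneg fun i _ => by positivity]
  exact ENNReal.ofReal_le_one.2 h1

variable [CompleteSpace H]

/-- The trace of a positive operator may be computed in any orthonormal basis. -/
theorem positiveTrace_eq {A : H →L[ℂ] H} (hA : 0 ≤ A) {ι : Type*} (b : HilbertBasis ι ℂ H) :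
    positiveTrace A = ∑' i, ENNReal.ofReal (inner ℂ (b i) (A (b i))).re := by
  have hS : IsSelfAdjoint (CFC.sqrt A) := IsSelfAdjoint.of_nonneg (CFC.sqrt_nonneg A)
  have hSA : CFC.sqrt A * CFC.sqrt A = A := CFC.sqrt_mul_sqrt_self A hA
  have key : ∀ x : H, ENNReal.ofReal (inner ℂ x (A x)).re = ‖CFC.sqrt A x‖ₑ ^ 2 := by
    intro x
    have h1 : inner ℂ x (A x) = inner ℂ (CFC.sqrt A x) (CFC.sqrt A x) := by
      conv_lhs => rw [← hSA]
      rw [mul_apply_eq_comp, ← ContinuousLinearMap.adjoint_inner_left,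
        hS.adjoint_eq]
    rw [h1, enorm_sq_eq_ofReal_sq, inner_self_eq_norm_sq_to_K]
    simp [← Complex.ofReal_pow]
  obtain ⟨b₀, hb₀⟩ := (exists_hilbertBasis ℂ H).choose_spec
  rw [positiveTrace]
  have h0 : ∀ e : (exists_hilbertBasis ℂ H).choose, (e : H) = b₀ e := fun e => by rw [hb₀]
  simp only [h0, key]
  -- Parseval in `b` for `√A b₀ e`, moving the self-adjoint root across; the double sum is symmetric
  -- in the two bases and may be summed in either order.
  have h1 : ∀ e, ‖CFC.sqrt A (b₀ e)‖ₑ ^ 2 = ∑' i, ‖inner ℂ (b₀ e) (CFC.sqrt A (b i))‖ₑ ^ 2 := by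
    intro e
    rw [← tsum_enorm_inner_sq b]
    congr 1
    funext i
    rw [← ContinuousLinearMap.adjoint_inner_left, hS.adjoint_eq, ← ofReal_norm, ← ofReal_norm,
      norm_inner_symm]
  simp only [h1]
  rw [ENNReal.tsum_comm]
  simp only [tsum_enorm_inner_sq b₀]

/-- The operator norm is bounded by the Hilbert–Schmidt norm. Passing to the adjoint makes Parseval
applicable: the coefficients of `S* w` are `⟨S b_i, w⟩`, each at most `‖S b_i‖ ‖w‖`. -/
theorem enorm_sq_le_tsum {ι : Type*} (b : HilbertBasis ι ℂ H) (S : H →L[ℂ] H) :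
    ‖S‖ₑ ^ 2 ≤ ∑' i, ‖S (b i)‖ₑ ^ 2 := by
  rw [← ContinuousLinearMap.adjoint.enorm_map S]
  set C := ∑' i, ‖S (b i)‖ₑ ^ 2 with hC
  by_cases hCt : C = ⊤
  · rw [hCt]; exact le_top
  have h1 : ∀ w : H, ‖ContinuousLinearMap.adjoint S w‖ₑ ^ 2 ≤ C * ‖w‖ₑ ^ 2 := by
    intro w
    rw [← tsum_enorm_inner_sq b, hC, ← ENNReal.tsum_mul_right]
    refine ENNReal.tsum_le_tsum fun i => ?_
    rw [ContinuousLinearMap.adjoint_inner_right, ← mul_pow]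
    gcongr
    rw [← ofReal_norm, ← ofReal_norm, ← ofReal_norm, ← ENNReal.ofReal_mul (norm_nonneg _)]
    exact ENNReal.ofReal_le_ofReal (norm_inner_le_norm _ _)
  have h2 : ‖ContinuousLinearMap.adjoint S‖ ≤ Real.sqrt C.toReal := by
    refine ContinuousLinearMap.opNorm_le_bound _ (Real.sqrt_nonneg _) fun w => ?_
    refine le_of_sq_le_sq ?_ (by positivity)
    rw [mul_pow, Real.sq_sqrt ENNReal.toReal_nonneg]
    have := ENNReal.toReal_mono (by finiteness) (h1 w)
    simpa using this
  calc ‖ContinuousLinearMap.adjoint S‖ₑ ^ 2 = ENNReal.ofReal (‖ContinuousLinearMap.adjoint S‖ ^ 2) :=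
        enorm_sq_eq_ofReal_sq _
    _ ≤ ENNReal.ofReal (Real.sqrt C.toReal ^ 2) := ENNReal.ofReal_le_ofReal (by gcongr)
    _ = C := by rw [Real.sq_sqrt ENNReal.toReal_nonneg, ENNReal.ofReal_toReal hCt]

theorem isCompactOperator_smulRight (φ : H →L[ℂ] ℂ) (v : H) :
    IsCompactOperator (φ.smulRight v) :=
  IsCompactOperator.clm_comp (f := φ) (isCompactOperator_of_locallyCompactSpace_dom φ)
    (ContinuousLinearMap.toSpanSingleton ℂ v)

/-- Hilbert–Schmidt operators are compact. -/
theorem isCompactOperator_of_tsum_ne_top {ι : Type*} (b : HilbertBasis ι ℂ H) (T : H →L[ℂ] H)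
    (h : ∑' i, ‖T (b i)‖ₑ ^ 2 ≠ ⊤) : IsCompactOperator T := by
  classical
  -- Finite-rank truncations of `T` along the basis; by `enorm_sq_le_tsum` the error is at most the
  -- tail of a convergent series.
  set F : Finset ι → H →L[ℂ] H := fun s => ∑ i ∈ s, (innerSL ℂ (b i)).smulRight (T (b i)) with hF
  have hFb : ∀ s j, F s (b j) = if j ∈ s then T (b j) else 0 := by
    intro s j
    simp only [hF, sum_apply, ContinuousLinearMap.smulRight_apply, innerSL_apply_apply,
      orthonormal_iff_ite.1 b.orthonormal, ite_smul, one_smul, zero_smul]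
    simp
  have hlim : Tendsto (fun s : Finset ι => ∑' i : {i // i ∉ s}, ‖T (b i)‖ₑ ^ 2) atTop (𝓝 0) :=
    ENNReal.tendsto_tsum_compl_atTop_zero h
  have hle : ∀ s, ‖T - F s‖ₑ ^ 2 ≤ ∑' i : {i // i ∉ s}, ‖T (b i)‖ₑ ^ 2 := by
    intro s
    refine (enorm_sq_le_tsum b _).trans (le_of_eq ?_)
    rw [← tsum_subtype_eq_of_support_subset (s := {i | i ∉ s})]
    · refine tsum_congr fun i => ?_
      have : (i : ι) ∉ s := i.2
      simp [hFb, this]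
    · intro i hi his
      apply hi
      have : i ∈ s := by simpa using his
      simp [hFb, this]
  have htend : Tendsto F atTop (𝓝 T) := by
    rw [tendsto_iff_edist_tendsto_0, ENNReal.tendsto_nhds_zero]
    intro ε hε
    filter_upwards [ENNReal.tendsto_nhds_zero.1 hlim (ε ^ 2) (by positivity)] with s hs
    rw [edist_comm, edist_eq_enorm_sub]
    by_contra hlt
    exact absurd ((hle s).trans hs) (not_le.2 (ENNReal.pow_right_strictMono two_ne_zero (not_le.1 hlt)))
  refine isCompactOperator_of_tendsto htend (Eventually.of_forall fun s => ?_)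
  induction s using Finset.induction_on with
  | empty => simpa [hF] using isCompactOperator_zero
  | insert a s ha ih =>
    have : F (insert a s) = (innerSL ℂ (b a)).smulRight (T (b a)) + F s := Finset.sum_insert ha
    rw [this]
    exact (isCompactOperator_smulRight _ _).add ih

/-- The spectral theorem for the modulus of a compact operator. -/
theorem exists_hilbertBasis_adjoint_comp_self {T : H →L[ℂ] H} (hT : IsCompactOperator T) :
    ∃ (ι : Type u) (b : HilbertBasis ι ℂ H),
      ∀ i, ContinuousLinearMap.adjoint T (T (b i)) = ((‖T (b i)‖ ^ 2 : ℝ) : ℂ) • b i := by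
  set K : H →L[ℂ] H := (ContinuousLinearMap.adjoint T).comp T with hK
  have hKc : IsCompactOperator K := hT.clm_comp (ContinuousLinearMap.adjoint T)
  have hKs : K.IsSymmetric := fun x y => by
    simp only [hK, ContinuousLinearMap.coe_coe, ContinuousLinearMap.comp_apply]
    rw [ContinuousLinearMap.adjoint_inner_left, ContinuousLinearMap.adjoint_inner_right]
  set V : ℂ → Submodule ℂ H := fun z => Module.End.eigenspace (K : Module.End ℂ H) z with hV
  have hbot : (⨆ z, V z)ᗮ = ⊥ :=
    ContinuousLinearMap.orthogonalComplement_iSup_eigenspaces_eq_bot hKc hKs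
  have hmem : ∀ z x, x ∈ V z ↔ K x = z • x := fun z x => Module.End.mem_eigenspace_iff
  have hclosed : ∀ z, IsClosed (V z : Set H) := by
    intro z
    have : (V z : Set H) = {x | K x = z • x} := by
      ext x
      exact hmem z x
    rw [this]
    exact isClosed_eq K.continuous (continuous_const_smul z)
  have hcompl : ∀ z, CompleteSpace (V z) := fun z => (hclosed z).completeSpace_coe
  choose s b _ using fun z => exists_hilbertBasis ℂ (V z)
  have hon : Orthonormal ℂ fun a : Σ z, s z => (V a.1).subtypeₗᵢ (b a.1 a.2) :=
    hKs.orthogonalFamily_eigenspaces.orthonormal_sigma_orthonormal fun z => (b z).orthonormal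
  -- A vector orthogonal to the bases of all eigenspaces is orthogonal to the eigenspaces
  -- themselves, and by the spectral theorem only 0 is.
  have hspan : (Submodule.span ℂ (range fun a : Σ z, s z => (V a.1).subtypeₗᵢ (b a.1 a.2)))ᗮ = ⊥ := by
    rw [eq_bot_iff, ← hbot]
    intro x hx
    rw [Submodule.mem_orthogonal] at hx ⊢
    have hVz : ∀ z, V z ≤ (Submodule.span ℂ {x})ᗮ := by
      intro z y hy
      rw [Submodule.mem_orthogonal_singleton_iff_inner_right]
      have h1 := ((b z).hasSum_repr ⟨y, hy⟩).mapL ((innerSL ℂ x).comp (V z).subtypeL)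
      refine h1.unique ?_
      have h2 : ∀ i, ((innerSL ℂ x).comp (V z).subtypeL) ((b z).repr ⟨y, hy⟩ i • b z i) = 0 := by
        intro i
        have h3 := hx ((V z).subtypeₗᵢ (b z i)) (Submodule.subset_span ⟨⟨z, i⟩, rfl⟩)
        rw [map_smul]
        have : ((innerSL ℂ x).comp (V z).subtypeL) (b z i) = 0 := by
          simp only [ContinuousLinearMap.comp_apply, innerSL_apply_apply]
          exact inner_eq_zero_symm.1 h3
        rw [this, smul_zero]
      simp only [h2]
      exact hasSum_zero
    intro u hu
    have := (iSup_le hVz) hu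
    rw [Submodule.mem_orthogonal_singleton_iff_inner_left] at this
    exact this
  refine ⟨Σ z, s z, HilbertBasis.mkOfOrthogonalEqBot hon hspan, fun a => ?_⟩
  rw [HilbertBasis.coe_mkOfOrthogonalEqBot]
  set x : H := (V a.1).subtypeₗᵢ (b a.1 a.2) with hx
  have hx1 : ‖x‖ = 1 := hon.1 a
  have hKx : K x = a.1 • x := (hmem _ _).1 (b a.1 a.2).2
  have hz : a.1 = ((‖T x‖ ^ 2 : ℝ) : ℂ) := by
    have h1 : inner ℂ x (K x) = a.1 := by
      rw [hKx, inner_smul_right, inner_self_eq_norm_sq_to_K, hx1]; simp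
    rw [← h1, hK, ContinuousLinearMap.comp_apply, ContinuousLinearMap.adjoint_inner_right,
      inner_self_eq_norm_sq_to_K]
    simp
  rw [← hz]
  exact hKx

/-- Stone–Weierstrass on the spectrum: the identity is clear for constants and for the coordinate
function, and it survives sums, products and uniform limits. -/
theorem cfc_apply_of_eigenvector {A : H →L[ℂ] H} (hA : IsSelfAdjoint A) {r : ℝ} {x : H}
    (hx : A x = (r : ℂ) • x) (f : ℝ → ℝ) (hf : ContinuousOn f (spectrum ℝ A)) :
    cfc f A x = ((f r : ℝ) : ℂ) • x := by
  by_cases hx0 : x = 0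
  · simp [hx0]
  have hr : r ∈ spectrum ℝ A := by
    rw [spectrum.mem_iff]
    intro hu
    obtain ⟨U, hU⟩ := hu
    have h1 : (U : H →L[ℂ] H) x = 0 := by
      rw [hU, sub_apply, hx, Algebra.algebraMap_eq_smul_one]
      simp
    have h2 : ((U⁻¹ : (H →L[ℂ] H)ˣ) : H →L[ℂ] H) ((U : H →L[ℂ] H) x) = x := by
      rw [← mul_apply_eq_comp, Units.inv_mul]; rfl
    rw [h1, map_zero] at h2
    exact hx0 h2.symm
  have key : ∀ g : C(spectrum ℝ A, ℝ), cfcHom (R := ℝ) hA g x = ((g ⟨r, hr⟩ : ℝ) : ℂ) • x := by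
    intro g
    induction g using ContinuousMap.induction_on_of_compact with
    | const c =>
      have : cfcHom (R := ℝ) hA (ContinuousMap.const _ c) = algebraMap ℝ (H →L[ℂ] H) c :=
        AlgHomClass.commutes (cfcHom (R := ℝ) hA) c
      rw [this, Algebra.algebraMap_eq_smul_one]
      simp
    | id => rw [cfcHom_id]; exact hx
    | star_id => rw [map_star, cfcHom_id, hA.star_eq]; exact hx
    | add f g hf hg =>
      rw [map_add, add_apply, hf, hg, ← add_smul]
      simp
    | mul f g hf hg =>
      rw [map_mul, mul_apply_eq_comp, hg, map_smul, hf, smul_smul]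
      simp [mul_comm]
    | frequently f hf =>
      have hcl : IsClosed {g : C(spectrum ℝ A, ℝ) | cfcHom (R := ℝ) hA g x =
          ((g ⟨r, hr⟩ : ℝ) : ℂ) • x} := by
        refine isClosed_eq ?_ ?_
        · exact (ContinuousLinearMap.apply ℂ H x).continuous.comp (cfcHom_continuous hA)
        · exact (Complex.continuous_ofReal.comp (continuous_eval_const _)).smul continuous_const
      rw [← mem_ofPred_eq (p := fun g : C(spectrum ℝ A, ℝ) => cfcHom (R := ℝ) hA g x =
          ((g ⟨r, hr⟩ : ℝ) : ℂ) • x), ← hcl.closure_eq]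
      exact mem_closure_iff_frequently.2 hf
  rw [cfc_apply f A hA hf, key]
  rfl

/-- `|T|^s` is the power `s / 2` of `T* T`, and `(r²)^(s/2) = r^s` for `r ≥ 0`. -/
theorem rpow_abs_apply_of_eigenvector {T : H →L[ℂ] H} {s : ℝ} (hs : 0 ≤ s) {r : ℝ} (hr : 0 ≤ r)
    {x : H} (hx : ContinuousLinearMap.adjoint T (T x) = ((r ^ 2 : ℝ) : ℂ) • x) :
    CFC.rpow (CFC.abs T) s x = ((r ^ s : ℝ) : ℂ) • x := by
  have hK0 : 0 ≤ star T * T := star_mul_self_nonneg T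
  rw [CFC.rpow_eq_pow, CFC.abs, CFC.sqrt_eq_rpow,
    CFC.rpow_rpow_of_exponent_nonneg _ _ _ (by norm_num) hs hK0, CFC.rpow_eq_cfc_real hK0,
    cfc_apply_of_eigenvector (IsSelfAdjoint.of_nonneg hK0) (r := r ^ 2) hx]
  · congr 2
    rw [← Real.rpow_natCast, ← Real.rpow_mul hr]
    congr 1
    push_cast
    ring
  · exact (Real.continuous_rpow_const (by positivity)).continuousOn

/-- A bound for the diagonal matrix elements of a compact operator along all pairs of orthonormal
families bounds its Schatten norm. -/
theorem positiveTrace_rpow_abs_le {T : H →L[ℂ] H} (hT : IsCompactOperator T) {s : ℝ} (hs : 0 < s)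
    {C : ℝ≥0∞} (hC : ∀ (ι : Type u) (e g : ι → H), Orthonormal ℂ e → Orthonormal ℂ g →
      ∀ F : Finset ι, ∑ i ∈ F, ‖inner ℂ (g i) (T (e i))‖ₑ ^ s ≤ C) :
    positiveTrace (CFC.rpow (CFC.abs T) s) ≤ C := by
  obtain ⟨ι, b, hb⟩ := exists_hilbertBasis_adjoint_comp_self hT
  rw [positiveTrace_eq (A := CFC.rpow (CFC.abs T) s) CFC.rpow_nonneg b]
  have hterm : ∀ i, ENNReal.ofReal (inner ℂ (b i) (CFC.rpow (CFC.abs T) s (b i))).re =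
      ‖T (b i)‖ₑ ^ s := by
    intro i
    rw [rpow_abs_apply_of_eigenvector hs.le (norm_nonneg _) (hb i), inner_smul_right,
      inner_self_eq_norm_sq_to_K, b.orthonormal.1 i, ← ofReal_norm,
      ENNReal.ofReal_rpow_of_nonneg (norm_nonneg _) hs.le]
    simp
  simp only [hterm]
  have hinner : ∀ i j, inner ℂ (T (b i)) (T (b j)) =
      ((‖T (b j)‖ ^ 2 : ℝ) : ℂ) * inner ℂ (b i) (b j) := by
    intro i j
    rw [← ContinuousLinearMap.adjoint_inner_right, hb, inner_smul_right]
  set S : Set ι := {i | T (b i) ≠ 0} with hS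
  -- The left singular vectors; they are orthonormal because `b` diagonalises `T* T`. Indices with
  -- `T b_i = 0` contribute nothing to the trace, as `s > 0`.
  set g : S → H := fun i => ((‖T (b i)‖⁻¹ : ℝ) : ℂ) • T (b i) with hg
  have hgon : Orthonormal ℂ g := by
    refine ⟨fun i => ?_, fun i j hij => ?_⟩
    · have : ‖T (b i)‖ ≠ 0 := norm_ne_zero_iff.2 i.2
      simp only [hg, norm_smul, Complex.norm_real, norm_inv, norm_norm]
      exact inv_mul_cancel₀ this
    · have : inner ℂ (b i) (b j) = 0 := b.orthonormal.2 (fun h => hij (Subtype.ext h))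
      simp only [hg, inner_smul_left, inner_smul_right, hinner, this, mul_zero]
  have hgT : ∀ i : S, ‖inner ℂ (g i) (T (b i))‖ₑ ^ s = ‖T (b i)‖ₑ ^ s := by
    intro i
    have h0 : ‖T (b i)‖ ≠ 0 := norm_ne_zero_iff.2 i.2
    have : inner ℂ (g i) (T (b i)) = ((‖T (b i)‖ : ℝ) : ℂ) := by
      simp only [hg, inner_smul_left, Complex.conj_ofReal, inner_self_eq_norm_sq_to_K]
      have h0' : ((‖T (b i)‖ : ℝ) : ℂ) ≠ 0 := by exact_mod_cast h0
      push_cast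
      field_simp
      simp
    rw [this, ← ofReal_norm, Complex.norm_real, norm_norm, ofReal_norm]
  rw [← tsum_subtype_eq_of_support_subset (s := S)]
  · rw [ENNReal.tsum_eq_iSup_sum]
    refine iSup_le fun F => ?_
    have := hC S (fun i => b i) g (b.orthonormal.comp _ Subtype.val_injective) hgon F
    simpa only [hgT] using this
  · intro i hi h0
    apply hi
    simp only [h0, enorm_zero, ENNReal.zero_rpow_of_pos hs]

end SchattenBound

/-! ### Weak integrals over a family of unit vectors resolving the identity -/

noncomputable section WeakIntegrals

open Set Filter Topology

theorem sq_lintegral_mul_le {α : Type*} [MeasurableSpace α] (m : Measure α) {f g : α → ℝ≥0∞}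
    (hf : Measurable f) (hg : Measurable g) :
    (∫⁻ x, f x * g x ∂m) ^ 2 ≤ (∫⁻ x, f x ^ 2 ∂m) * ∫⁻ x, g x ^ 2 ∂m := by
  have h := ENNReal.lintegral_mul_le_Lp_mul_Lq m Real.HolderConjugate.two_two hf.aemeasurable
    hg.aemeasurable
  simp only [Pi.mul_apply, ENNReal.rpow_two] at h
  have h2 : ∀ x : ℝ≥0∞, (x ^ (1 / 2 : ℝ)) ^ 2 = x := fun x => by
    rw [← ENNReal.rpow_two, ← ENNReal.rpow_mul]; norm_num
  calc _ ≤ _ := ENNReal.pow_le_pow_left h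
    _ = _ := by rw [mul_pow, h2, h2]

variable {P : Type*} [MeasurableSpace P] {H : Type u} [NormedAddCommGroup H]
  [InnerProductSpace ℂ H]

/-- A measurable family of unit vectors which resolves the identity. -/
structure IsCoherentFamily (m : Measure P) (W : P → H) : Prop where
  norm_eq : ∀ p, ‖W p‖ = 1
  stronglyMeasurable : ∀ u, StronglyMeasurable fun p => inner ℂ (W p) u
  lintegral_sq : ∀ u, ∫⁻ p, ‖inner ℂ (W p) u‖ₑ ^ 2 ∂m = ‖u‖ₑ ^ 2

/-- `T` is the weak integral of `f p ⟨·, W p⟩ W p`. -/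
def IsWeakIntegral (m : Measure P) (W : P → H) (f : P → ℂ) (T : H →L[ℂ] H) : Prop :=
  ∀ u v : H,
    Integrable (fun p => f p * (inner ℂ (W p) u * starRingEnd ℂ (inner ℂ (W p) v))) m ∧
      inner ℂ v (T u) = ∫ p, f p * (inner ℂ (W p) u * starRingEnd ℂ (inner ℂ (W p) v)) ∂m

theorem IsWeakIntegral.sub {m : Measure P} {W : P → H} {f g : P → ℂ} {S T : H →L[ℂ] H}
    (hS : IsWeakIntegral m W f S) (hT : IsWeakIntegral m W g T) :
    IsWeakIntegral m W (f - g) (S - T) := by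
  intro u v
  simp only [Pi.sub_apply, sub_mul]
  refine ⟨(hS u v).1.sub (hT u v).1, ?_⟩
  rw [integral_sub (hS u v).1 (hT u v).1, ← (hS u v).2, ← (hT u v).2, sub_apply,
    inner_sub_right]

theorem IsWeakIntegral.add {m : Measure P} {W : P → H} {f g : P → ℂ} {S T : H →L[ℂ] H}
    (hS : IsWeakIntegral m W f S) (hT : IsWeakIntegral m W g T) :
    IsWeakIntegral m W (f + g) (S + T) := by
  intro u v
  simp only [Pi.add_apply, add_mul]
  refine ⟨(hS u v).1.add (hT u v).1, ?_⟩
  rw [integral_add (hS u v).1 (hT u v).1, ← (hS u v).2, ← (hT u v).2, add_apply,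
    inner_add_right]

theorem IsWeakIntegral.smul {m : Measure P} {W : P → H} {f : P → ℂ} {T : H →L[ℂ] H}
    (hT : IsWeakIntegral m W f T) (c : ℂ) : IsWeakIntegral m W (c • f) (c • T) := by
  intro u v
  simp only [Pi.smul_apply, smul_eq_mul, mul_assoc]
  refine ⟨(hT u v).1.const_mul c, ?_⟩
  rw [integral_const_mul, ← (hT u v).2, smul_apply, inner_smul_right]

theorem IsWeakIntegral.congr_ae {m : Measure P} {W : P → H} {f g : P → ℂ} {T : H →L[ℂ] H}
    (hT : IsWeakIntegral m W f T) (hfg : f =ᵐ[m] g) : IsWeakIntegral m W g T := by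
  intro u v
  have h : (fun p => f p * (inner ℂ (W p) u * starRingEnd ℂ (inner ℂ (W p) v))) =ᵐ[m]
      fun p => g p * (inner ℂ (W p) u * starRingEnd ℂ (inner ℂ (W p) v)) :=
    hfg.mono fun p hp => by simp only [hp]
  exact ⟨(hT u v).1.congr h, (hT u v).2.trans (integral_congr_ae h)⟩

namespace IsCoherentFamily

variable {m : Measure P} {W : P → H} (hW : IsCoherentFamily m W)
include hW

theorem measurable_enorm (u : H) : Measurable fun p => ‖inner ℂ (W p) u‖ₑ :=
  (hW.stronglyMeasurable u).enorm

theorem enorm_inner_le (u : H) (p : P) : ‖inner ℂ (W p) u‖ₑ ≤ ‖u‖ₑ := by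
  rw [← ofReal_norm, ← ofReal_norm]
  refine ENNReal.ofReal_le_ofReal ((norm_inner_le_norm _ _).trans ?_)
  rw [hW.norm_eq, one_mul]

theorem lintegral_mul_le (u v : H) :
    ∫⁻ p, ‖inner ℂ (W p) u‖ₑ * ‖inner ℂ (W p) v‖ₑ ∂m ≤ ‖u‖ₑ * ‖v‖ₑ := by
  have h := sq_lintegral_mul_le m (hW.measurable_enorm u) (hW.measurable_enorm v)
  rw [hW.lintegral_sq, hW.lintegral_sq, ← mul_pow] at h
  exact (ENNReal.pow_right_strictMono two_ne_zero).le_iff_le.1 h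

theorem withDensity_univ_le {u v : H} (hu : ‖u‖ₑ ≤ 1) (hv : ‖v‖ₑ ≤ 1) :
    m.withDensity (fun p => ‖inner ℂ (W p) u‖ₑ * ‖inner ℂ (W p) v‖ₑ) univ ≤ 1 := by
  rw [withDensity_apply _ MeasurableSet.univ, Measure.restrict_univ]
  exact (hW.lintegral_mul_le u v).trans (mul_le_one' hu hv)

/-- The weighted measure has total mass at most 1, and on such a measure the `L¹` norm is at most
the `Lˢ` norm. -/
theorem lintegral_le_eLpNorm_withDensity {f : P → ℂ} (hf : StronglyMeasurable f) {s : ℝ≥0∞}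
    (hs : 1 ≤ s) {u v : H} (hu : ‖u‖ₑ ≤ 1) (hv : ‖v‖ₑ ≤ 1) :
    ∫⁻ p, ‖f p‖ₑ * (‖inner ℂ (W p) u‖ₑ * ‖inner ℂ (W p) v‖ₑ) ∂m ≤
      eLpNorm f s (m.withDensity fun p => ‖inner ℂ (W p) u‖ₑ * ‖inner ℂ (W p) v‖ₑ) := by
  have hd : Measurable fun p => ‖inner ℂ (W p) u‖ₑ * ‖inner ℂ (W p) v‖ₑ :=
    (hW.measurable_enorm u).mul (hW.measurable_enorm v)
  have h1 : ∫⁻ p, ‖f p‖ₑ * (‖inner ℂ (W p) u‖ₑ * ‖inner ℂ (W p) v‖ₑ) ∂m =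
      eLpNorm f 1 (m.withDensity fun p => ‖inner ℂ (W p) u‖ₑ * ‖inner ℂ (W p) v‖ₑ) := by
    rw [eLpNorm_one_eq_lintegral_enorm, lintegral_withDensity_eq_lintegral_mul m hd hf.enorm]
    simp only [Pi.mul_apply, mul_comm]
  rw [h1]
  refine (eLpNorm_le_eLpNorm_mul_rpow_measure_univ hs hf.aestronglyMeasurable).trans ?_
  refine mul_le_of_le_one_right' (ENNReal.rpow_le_one (hW.withDensity_univ_le hu hv) ?_)
  rw [sub_nonneg, ENNReal.toReal_one, div_one]
  rcases eq_or_ne s ⊤ with rfl | hst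
  · simp
  · rw [one_div]
    exact inv_le_one_of_one_le₀ (by simpa using ENNReal.toReal_mono hst hs)

theorem lintegral_rpow_le {f : P → ℂ} (hf : StronglyMeasurable f) {s : ℝ≥0∞} (hs : 1 ≤ s)
    (hst : s ≠ ⊤) {u v : H} (hu : ‖u‖ₑ ≤ 1) (hv : ‖v‖ₑ ≤ 1) :
    (∫⁻ p, ‖f p‖ₑ * (‖inner ℂ (W p) u‖ₑ * ‖inner ℂ (W p) v‖ₑ) ∂m) ^ s.toReal ≤
      ∫⁻ p, ‖f p‖ₑ ^ s.toReal * (‖inner ℂ (W p) u‖ₑ * ‖inner ℂ (W p) v‖ₑ) ∂m := by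
  have hd : Measurable fun p => ‖inner ℂ (W p) u‖ₑ * ‖inner ℂ (W p) v‖ₑ :=
    (hW.measurable_enorm u).mul (hW.measurable_enorm v)
  have hs0 : s ≠ 0 := (zero_lt_one.trans_le hs).ne'
  have hsr : 0 < s.toReal := ENNReal.toReal_pos hs0 hst
  refine (ENNReal.rpow_le_rpow (hW.lintegral_le_eLpNorm_withDensity hf hs hu hv) hsr.le).trans ?_
  rw [eLpNorm_eq_lintegral_rpow_enorm_toReal hs0 hst, ← ENNReal.rpow_mul,
    one_div_mul_cancel hsr.ne', ENNReal.rpow_one,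
    lintegral_withDensity_eq_lintegral_mul m hd (hf.enorm.pow_const _)]
  simp only [Pi.mul_apply, mul_comm, le_refl]

/-- The weight is also pointwise at most 1, because the `W p` are unit vectors; hence the weighted
measure is dominated by `m`. -/
theorem lintegral_le_of_enorm_le_one {f : P → ℂ} (hf : StronglyMeasurable f) {s : ℝ≥0∞}
    (hs : 1 ≤ s) {u v : H} (hu : ‖u‖ₑ ≤ 1) (hv : ‖v‖ₑ ≤ 1) :
    ∫⁻ p, ‖f p‖ₑ * (‖inner ℂ (W p) u‖ₑ * ‖inner ℂ (W p) v‖ₑ) ∂m ≤ eLpNorm f s m := by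
  refine (hW.lintegral_le_eLpNorm_withDensity hf hs hu hv).trans (eLpNorm_mono_measure f ?_)
  refine (withDensity_mono (g := 1) (ae_of_all _ fun p => ?_)).trans (by rw [withDensity_one])
  exact mul_le_one' ((hW.enorm_inner_le u p).trans hu) ((hW.enorm_inner_le v p).trans hv)

theorem lintegral_le {f : P → ℂ} (hf : StronglyMeasurable f) {s : ℝ≥0∞} (hs : 1 ≤ s) (u v : H) :
    ∫⁻ p, ‖f p‖ₑ * (‖inner ℂ (W p) u‖ₑ * ‖inner ℂ (W p) v‖ₑ) ∂m ≤
      eLpNorm f s m * (‖u‖ₑ * ‖v‖ₑ) := by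
  have hn : ∀ x : H, ∃ y : H, ‖y‖ₑ ≤ 1 ∧ x = ((‖x‖ : ℝ) : ℂ) • y := by
    intro x
    rcases eq_or_ne x 0 with rfl | hx
    · exact ⟨0, by simp, by simp⟩
    · have hx' : ‖x‖ ≠ 0 := norm_ne_zero_iff.2 hx
      refine ⟨((‖x‖⁻¹ : ℝ) : ℂ) • x, ?_, ?_⟩
      · rw [← ofReal_norm, norm_smul, Complex.norm_real, norm_inv, norm_norm,
          inv_mul_cancel₀ hx', ENNReal.ofReal_one]
      · rw [smul_smul, ← Complex.ofReal_mul, mul_inv_cancel₀ hx', Complex.ofReal_one, one_smul]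
  obtain ⟨u', hu', hu⟩ := hn u
  obtain ⟨v', hv', hv⟩ := hn v
  have he : ∀ x y : H, x = ((‖x‖ : ℝ) : ℂ) • y → ∀ p,
      ‖inner ℂ (W p) x‖ₑ = ‖x‖ₑ * ‖inner ℂ (W p) y‖ₑ := by
    intro x y hxy p
    conv_lhs => rw [hxy]
    rw [inner_smul_right, enorm_mul, ← ofReal_norm, Complex.norm_real, norm_norm, ofReal_norm]
  simp only [he u u' hu, he v v' hv]
  calc _ = ∫⁻ p, (‖u‖ₑ * ‖v‖ₑ) *
        (‖f p‖ₑ * (‖inner ℂ (W p) u'‖ₑ * ‖inner ℂ (W p) v'‖ₑ)) ∂m := by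
        refine lintegral_congr fun p => ?_
        ring
    _ = (‖u‖ₑ * ‖v‖ₑ) * ∫⁻ p, ‖f p‖ₑ * (‖inner ℂ (W p) u'‖ₑ * ‖inner ℂ (W p) v'‖ₑ) ∂m :=
        lintegral_const_mul' _ _ (by finiteness)
    _ ≤ _ := by
        rw [mul_comm]
        gcongr
        exact hW.lintegral_le_of_enorm_le_one hf hs hu' hv'

theorem lintegral_enorm_le {f : P → ℂ} (hf : StronglyMeasurable f) {s : ℝ≥0∞} (hs : 1 ≤ s)
    (u v : H) :
    ∫⁻ p, ‖f p * (inner ℂ (W p) u * starRingEnd ℂ (inner ℂ (W p) v))‖ₑ ∂m ≤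
      eLpNorm f s m * (‖u‖ₑ * ‖v‖ₑ) := by
  simp only [enorm_mul, RCLike.enorm_conj]
  exact hW.lintegral_le hf hs u v

theorem integrable {f : P → ℂ} (hf : StronglyMeasurable f) {s : ℝ≥0∞} (hs : 1 ≤ s)
    (hfs : eLpNorm f s m < ⊤) (u v : H) :
    Integrable (fun p => f p * (inner ℂ (W p) u * starRingEnd ℂ (inner ℂ (W p) v))) m :=
  ⟨(hf.mul ((hW.stronglyMeasurable u).mul (Complex.continuous_conj.comp_stronglyMeasurable
    (hW.stronglyMeasurable v)))).aestronglyMeasurable,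
    (hW.lintegral_enorm_le hf hs u v).trans_lt (by finiteness)⟩

theorem enorm_integral_le {f : P → ℂ} (hf : StronglyMeasurable f) {s : ℝ≥0∞} (hs : 1 ≤ s)
    (hfs : eLpNorm f s m < ⊤) (u v : H) :
    ‖∫ p, f p * (inner ℂ (W p) u * starRingEnd ℂ (inner ℂ (W p) v)) ∂m‖ ≤
      (eLpNorm f s m).toReal * ‖u‖ * ‖v‖ := by
  have h := ENNReal.toReal_mono (by finiteness)
    ((enorm_integral_le_lintegral_enorm _).trans (hW.lintegral_enorm_le hf hs u v))
  simpa [mul_assoc] using h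

variable [CompleteSpace H]

theorem exists_isWeakIntegral {f : P → ℂ} (hf : StronglyMeasurable f) {s : ℝ≥0∞} (hs : 1 ≤ s)
    (hfs : eLpNorm f s m < ⊤) : ∃ T, IsWeakIntegral m W f T := by
  have hint := hW.integrable hf hs hfs
  -- The conjugate makes the form antilinear in `u` and linear in `v`, as required for representing
  -- it by `⟨T u, v⟩` in the convention of `inner`.
  set β : H → H → ℂ := fun u v => starRingEnd ℂ
    (∫ p, f p * (inner ℂ (W p) u * starRingEnd ℂ (inner ℂ (W p) v)) ∂m) with hβ
  set B : H →ₗ⋆[ℂ] H →ₗ[ℂ] ℂ := LinearMap.mk₂'ₛₗ (starRingEnd ℂ) (RingHom.id ℂ) β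
    (fun u u' v => by
      simp only [hβ]
      rw [← map_add, ← integral_add (hint _ _) (hint _ _)]
      simp only [inner_add_right, add_mul, mul_add])
    (fun c u v => by
      simp only [hβ]
      rw [smul_eq_mul, ← map_mul, ← integral_const_mul]
      refine congrArg _ (integral_congr_ae (ae_of_all _ fun p => ?_))
      simp only [inner_smul_right]
      ring)
    (fun u v v' => by
      simp only [hβ]
      rw [← map_add, ← integral_add (hint _ _) (hint _ _)]
      simp only [inner_add_right, map_add, mul_add])
    (fun c u v => by
      simp only [hβ]
      rw [RingHom.id_apply, smul_eq_mul, ← Complex.conj_conj c, ← map_mul, Complex.conj_conj,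
        ← integral_const_mul]
      refine congrArg _ (integral_congr_ae (ae_of_all _ fun p => ?_))
      simp only [inner_smul_right, map_mul]
      ring) with hB
  have hBb : ∀ u v, ‖B u v‖ ≤ (eLpNorm f s m).toReal * ‖u‖ * ‖v‖ := fun u v => by
    change ‖starRingEnd ℂ _‖ ≤ _
    rw [RCLike.norm_conj]
    exact hW.enorm_integral_le hf hs hfs u v
  refine ⟨InnerProductSpace.continuousLinearMapOfBilin (B.mkContinuous₂ _ hBb), fun u v =>
    ⟨hint u v, ?_⟩⟩
  rw [← inner_conj_symm, InnerProductSpace.continuousLinearMapOfBilin_apply]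
  exact Complex.conj_conj _

theorem enorm_le {f : P → ℂ} (hf : StronglyMeasurable f) {s : ℝ≥0∞} (hs : 1 ≤ s)
    {T : H →L[ℂ] H} (hT : IsWeakIntegral m W f T) : ‖T‖ₑ ≤ eLpNorm f s m := by
  by_cases hfs : eLpNorm f s m = ⊤
  · rw [hfs]; exact le_top
  have h : ‖T‖ ≤ (eLpNorm f s m).toReal := by
    refine ContinuousLinearMap.opNorm_le_bound _ ENNReal.toReal_nonneg fun u => ?_
    rcases eq_or_ne (T u) 0 with h0 | h0
    · rw [h0, norm_zero]; positivity
    · have h1 := hW.enorm_integral_le hf hs (lt_top_iff_ne_top.2 hfs) u (T u)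
      rw [← (hT u (T u)).2, inner_self_eq_norm_sq_to_K] at h1
      have h2 : ‖T u‖ * ‖T u‖ ≤ (eLpNorm f s m).toReal * ‖u‖ * ‖T u‖ := by
        simpa [sq] using h1
      exact le_of_mul_le_mul_right h2 (norm_pos_iff.2 h0)
  rw [← ofReal_norm]
  exact ENNReal.ofReal_le_of_le_toReal h

/-- Such an operator is Hilbert–Schmidt: `‖T u‖² ≤ ∫ |f|² |⟨W p, u⟩|²`, and summing over a basis
bounds the total by `∫ |f|²` through Bessel. -/
theorem isCompactOperator_of_memLp_two {f : P → ℂ} (hf : StronglyMeasurable f)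
    (hf2 : MemLp f 2 m) {T : H →L[ℂ] H} (hT : IsWeakIntegral m W f T) : IsCompactOperator T := by
  have h1 : ∀ u, ‖T u‖ₑ ^ 2 ≤ ∫⁻ p, ‖f p‖ₑ ^ 2 * ‖inner ℂ (W p) u‖ₑ ^ 2 ∂m := by
    intro u
    have h2 : ‖T u‖ₑ ^ 2 ≤ ∫⁻ p, (‖f p‖ₑ * ‖inner ℂ (W p) u‖ₑ) * ‖inner ℂ (W p) (T u)‖ₑ ∂m := by
      have h3 : ‖inner ℂ (T u) (T u)‖ₑ = ‖T u‖ₑ ^ 2 := by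
        rw [← ofReal_norm, enorm_sq_eq_ofReal_sq, inner_self_eq_norm_sq_to_K]
        simp
      rw [← h3, (hT u (T u)).2]
      refine (enorm_integral_le_lintegral_enorm _).trans (le_of_eq ?_)
      simp only [enorm_mul, RCLike.enorm_conj, mul_assoc]
    have h4 := sq_lintegral_mul_le m (hf.enorm.mul (hW.measurable_enorm u))
      (hW.measurable_enorm (T u))
    rw [hW.lintegral_sq] at h4
    simp only [Pi.mul_apply, mul_pow] at h4
    -- Cauchy–Schwarz and the resolution of the identity give `‖T u‖⁴ ≤ (∫ |f|² |⟨W p, u⟩|²) ‖T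
    -- u‖²`; one factor is cancelled below.
    have h5 := (ENNReal.pow_le_pow_left (n := 2) h2).trans h4
    rcases eq_or_ne (T u) 0 with h0 | h0
    · simp [h0]
    · rw [sq (‖T u‖ₑ ^ 2)] at h5
      exact (ENNReal.mul_le_mul_iff_left (by simpa using h0) (by finiteness)).1 h5
  obtain ⟨w, b, -⟩ := exists_hilbertBasis ℂ H
  refine isCompactOperator_of_tsum_ne_top b T (ne_top_of_le_ne_top
    (b := ∫⁻ p, ‖f p‖ₑ ^ 2 ∂m) ?_ ?_)
  · rw [← eLpNorm_two_sq]
    exact ENNReal.pow_ne_top hf2.2.ne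
  · rw [ENNReal.tsum_eq_iSup_sum]
    refine iSup_le fun F => ?_
    calc _ ≤ ∑ i ∈ F, ∫⁻ p, ‖f p‖ₑ ^ 2 * ‖inner ℂ (W p) (b i)‖ₑ ^ 2 ∂m :=
          Finset.sum_le_sum fun i _ => h1 (b i)
      _ = ∫⁻ p, ∑ i ∈ F, ‖f p‖ₑ ^ 2 * ‖inner ℂ (W p) (b i)‖ₑ ^ 2 ∂m :=
          (lintegral_finsetSum _ fun i _ =>
            (hf.enorm.pow_const 2).mul ((hW.measurable_enorm (b i)).pow_const 2)).symm
      _ ≤ _ := by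
          refine lintegral_mono fun p => ?_
          rw [← Finset.mul_sum]
          refine mul_le_of_le_one_right' ?_
          have := sum_enorm_inner_sq_le b.orthonormal F (W p)
          simp only [← ofReal_norm, norm_inner_symm (W p), hW.norm_eq] at this ⊢
          simpa using this

/-- Simple functions are dense in `Lˢ` for finite `s`, and those in `Lˢ` are also in `L²`. By
`enorm_le` their compact operators converge to `T` in norm. -/
theorem isCompactOperator {f : P → ℂ} (hf : StronglyMeasurable f) {s : ℝ≥0∞} (hs : 1 ≤ s)
    (hst : s ≠ ⊤) (hfs : MemLp f s m) {T : H →L[ℂ] H} (hT : IsWeakIntegral m W f T) :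
    IsCompactOperator T := by
  have hcl := isClosed_setOfPred_isCompactOperator (σ₁₂ := RingHom.id ℂ) (M₁ := H) (M₂ := H)
  have hs0 : s ≠ 0 := (zero_lt_one.trans_le hs).ne'
  change T ∈ {T : H →L[ℂ] H | IsCompactOperator T}
  rw [← hcl.closure_eq, EMetric.mem_closure_iff]
  intro ε hε
  obtain ⟨g, hg, hgs⟩ := hfs.exists_simpleFunc_eLpNorm_sub_lt hst hε.ne'
  obtain ⟨S, hS⟩ := hW.exists_isWeakIntegral g.stronglyMeasurable hs hgs.2
  have hg2 : MemLp g 2 m :=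
    (SimpleFunc.memLp_iff (by norm_num) (by norm_num)).2 ((SimpleFunc.memLp_iff hs0 hst).1 hgs)
  refine ⟨S, hW.isCompactOperator_of_memLp_two g.stronglyMeasurable hg2 hS, ?_⟩
  rw [edist_eq_enorm_sub]
  exact (hW.enorm_le (hf.sub g.stronglyMeasurable) hs (hT.sub hS)).trans_lt hg

/-- The Schatten norm of a weak integral is at most the `Lˢ` norm of the symbol. -/
theorem schattenNorm_le {f : P → ℂ} (hf : StronglyMeasurable f) {s : ℝ≥0∞} (hs : 1 ≤ s)
    (hfs : MemLp f s m) {T : H →L[ℂ] H} (hT : IsWeakIntegral m W f T) :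
    schattenNorm s T ≤ eLpNorm f s m := by
  rw [schattenNorm]
  split_ifs with hst
  · exact hW.enorm_le hf hs hT
  have hs0 : s ≠ 0 := (zero_lt_one.trans_le hs).ne'
  have hsr : 0 < s.toReal := ENNReal.toReal_pos hs0 hst
  rw [eLpNorm_eq_lintegral_rpow_enorm_toReal hs0 hst, one_div]
  refine ENNReal.rpow_le_rpow ?_ (inv_nonneg.2 hsr.le)
  refine positiveTrace_rpow_abs_le (hW.isCompactOperator hf hs hst hfs hT) hsr
    fun ι e g he hg F => ?_
  have he1 : ∀ i, ‖e i‖ₑ ≤ 1 := fun i => by rw [← ofReal_norm, he.1 i, ENNReal.ofReal_one]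
  have hg1 : ∀ i, ‖g i‖ₑ ≤ 1 := fun i => by rw [← ofReal_norm, hg.1 i, ENNReal.ofReal_one]
  -- Jensen's inequality is applied to each matrix element before summing, so Bessel at each `p`
  -- absorbs the whole sum with constant 1.
  calc _ ≤ ∑ i ∈ F, ∫⁻ p, ‖f p‖ₑ ^ s.toReal *
        (‖inner ℂ (W p) (e i)‖ₑ * ‖inner ℂ (W p) (g i)‖ₑ) ∂m := by
        refine Finset.sum_le_sum fun i _ => ?_
        refine le_trans ?_ (hW.lintegral_rpow_le hf hs hst (he1 i) (hg1 i))
        refine ENNReal.rpow_le_rpow ?_ hsr.le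
        rw [(hT (e i) (g i)).2]
        refine (enorm_integral_le_lintegral_enorm _).trans (le_of_eq ?_)
        simp only [enorm_mul, RCLike.enorm_conj]
    _ = ∫⁻ p, ∑ i ∈ F, ‖f p‖ₑ ^ s.toReal *
        (‖inner ℂ (W p) (e i)‖ₑ * ‖inner ℂ (W p) (g i)‖ₑ) ∂m :=
        (lintegral_finsetSum _ fun i _ => (hf.enorm.pow_const _).mul
          ((hW.measurable_enorm (e i)).mul (hW.measurable_enorm (g i)))).symm
    _ ≤ _ := by
        refine lintegral_mono fun p => ?_
        rw [← Finset.mul_sum]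
        refine mul_le_of_le_one_right' ?_
        have := sum_enorm_inner_mul_le he hg F (hW.norm_eq p).le
        simp only [← ofReal_norm, norm_inner_symm (W p)] at this ⊢
        exact this

omit [CompleteSpace H] hW in
-- Distinct orthonormal vectors are `√2` apart, so balls of radius 1/2 around them are disjoint; a
-- separable space contains only countably many. Countability permits exchanging sum and integral in
-- the trace.
theorem _root_.Orthonormal.countable_of_separableSpace [TopologicalSpace.SeparableSpace H]
    {ι : Type*} {b : ι → H} (hb : Orthonormal ℂ b) : Countable ι := by
  have h := Set.PairwiseDisjoint.countable_of_isOpen (a := (univ : Set ι))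
    (s := fun i => Metric.ball (b i) (1 / 2)) ?_ (fun i _ => Metric.isOpen_ball)
    (fun i _ => ⟨b i, Metric.mem_ball_self (by norm_num)⟩)
  · exact countable_univ_iff.1 h
  · intro i _ j _ hij
    refine Metric.ball_disjoint_ball ?_
    have h1 : ‖b i - b j‖ ^ 2 = 2 := by
      rw [@norm_sub_sq ℂ, hb.1 i, hb.1 j, hb.2 hij]
      norm_num
    rw [dist_eq_norm]
    nlinarith [norm_nonneg (b i - b j)]

theorem hasTrace [TopologicalSpace.SeparableSpace H] {f : P → ℂ}
    (hfi : Integrable f m) {T : H →L[ℂ] H} (hT : IsWeakIntegral m W f T) :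
    HasTrace T (∫ p, f p ∂m) := by
  intro ι b
  have := b.orthonormal.countable_of_separableSpace
  set F : ι → P → ℂ := fun i p =>
    f p * (inner ℂ (W p) (b i) * starRingEnd ℂ (inner ℂ (W p) (b i))) with hF
  have hFp : ∀ i p, F i p = f p * ((‖inner ℂ (b i) (W p)‖ ^ 2 : ℝ) : ℂ) := by
    intro i p
    simp only [hF, Complex.mul_conj', norm_inner_symm (W p)]
    push_cast
    rfl
  have hFi : ∀ i, Integrable (F i) m := fun i => (hT (b i) (b i)).1
  -- Each rank one operator has trace `‖W p‖² = 1`, by Parseval.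
  have hsum : ∀ p, HasSum (fun i => F i p) (f p) := by
    intro p
    have h1 := hasSum_norm_inner_sq b (W p)
    rw [hW.norm_eq, one_pow] at h1
    have h2 := (Complex.hasSum_ofReal.2 h1).mul_left (f p)
    simpa only [hFp, Complex.ofReal_one, mul_one] using h2
  have hS : Summable fun i => ∫ p, ‖F i p‖ ∂m := by
    refine summable_of_sum_le (c := ∫ p, ‖f p‖ ∂m)
      (fun i => integral_nonneg fun p => norm_nonneg _) fun s => ?_
    rw [← integral_finsetSum _ fun i _ => (hFi i).norm]
    refine integral_mono (integrable_finsetSum _ fun i _ => (hFi i).norm) hfi.norm fun p => ?_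
    simp only [hFp, norm_mul, Complex.norm_real, norm_pow, norm_norm]
    rw [← Finset.mul_sum]
    refine mul_le_of_le_one_right (norm_nonneg _) ?_
    have := b.orthonormal.sum_inner_products_le (s := s) (W p)
    rwa [hW.norm_eq, one_pow] at this
  have h := hasSum_integral_of_summable_integral_norm hFi hS
  have h3 : (fun p => ∑' i, F i p) = f := funext fun p => (hsum p).tsum_eq
  rw [h3] at h
  have h4 : (fun i => inner ℂ (b i) (T (b i))) = fun i => ∫ p, F i p ∂m :=
    funext fun i => (hT (b i) (b i)).2
  rw [h4]
  exact h

end IsCoherentFamily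

end WeakIntegrals

/-! ### Berezin operators as weak integrals over the coherent states -/

noncomputable section BerezinOperators

variable {E : Type*} [NormedAddCommGroup E] [NormedSpace ℝ E] [FiniteDimensional ℝ E]
  {G : Type*} [TopologicalSpace G] [T2Space G] [ChartedSpace E G] [Group G] [LieGroup 𝓘(ℝ, E) ∞ G]
  [SimplyConnectedSpace G] [LieRing.IsNilpotent (GroupLieAlgebra 𝓘(ℝ, E) G)]
  [MeasurableSpace E] [BorelSpace E] [MeasurableSpace G] [BorelSpace G]
  [SecondCountableTopology G] (μ : Measure G) [μ.IsHaarMeasure]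

/-- The coherent state at a point of the phase space, as an element of `L²(G)`. -/
def coherentVector {w : G → ℂ} (hw : IsSchwartz (E := E) w) (hw1 : eLpNorm w 2 μ = 1)
    (p : G × StrongDual ℝ E) : Lp ℂ 2 μ :=
  (memLp_coherentState μ hw.continuous hw1 p).toLp _

theorem inner_coherentVector {w : G → ℂ} (hw : IsSchwartz (E := E) w) (hw1 : eLpNorm w 2 μ = 1)
    (u : Lp ℂ 2 μ) (p : G × StrongDual ℝ E) :
    inner ℂ (coherentVector μ hw hw1 p) u = coherentCoeff μ w u p :=
  inner_toLp_coherentState μ hw.continuous hw1 u p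

theorem isCoherentFamily_coherentVector {w : G → ℂ} (hw : IsSchwartz (E := E) w)
    (hw1 : eLpNorm w 2 μ = 1) :
    IsCoherentFamily (phaseMeasure E μ) (coherentVector μ hw hw1) where
  norm_eq := norm_toLp_coherentState μ hw.continuous hw1
  stronglyMeasurable u := by
    simp only [inner_coherentVector]
    exact stronglyMeasurable_coherentCoeff μ hw.continuous u
  lintegral_sq u := by
    simp only [inner_coherentVector]
    exact lintegral_enorm_coherentCoeff_sq μ hw hw1 u

theorem isBerezinOperator_iff {w : G → ℂ} (hw : IsSchwartz (E := E) w)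
    (hw1 : eLpNorm w 2 μ = 1) (f : G × StrongDual ℝ E → ℂ) (T : Lp ℂ 2 μ →L[ℂ] Lp ℂ 2 μ) :
    IsBerezinOperator μ w f T ↔ IsWeakIntegral (phaseMeasure E μ) (coherentVector μ hw hw1) f T := by
  simp only [IsWeakIntegral, inner_coherentVector]
  rfl

theorem isBerezinOperator_berezin {w : G → ℂ} (hw : IsSchwartz (E := E) w)
    (hw1 : eLpNorm w 2 μ = 1) {s : ℝ≥0∞} (hs : 1 ≤ s) (f : Lp ℂ s (phaseMeasure E μ)) :
    IsBerezinOperator μ w f (berezin μ w f) := by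
  obtain ⟨T, hT⟩ := (isCoherentFamily_coherentVector μ hw hw1).exists_isWeakIntegral
    (Lp.stronglyMeasurable f) hs (Lp.memLp f).2
  rw [← isBerezinOperator_iff] at hT
  rwa [berezin_eq hT]

/-- The Berezin quantization as a linear map. -/
def berezinLinearMap {w : G → ℂ} (hw : IsSchwartz (E := E) w) (hw1 : eLpNorm w 2 μ = 1)
    {s : ℝ≥0∞} (hs : 1 ≤ s) :
    Lp ℂ s (phaseMeasure E μ) →ₗ[ℂ] (Lp ℂ 2 μ →L[ℂ] Lp ℂ 2 μ) where
  toFun f := berezin μ w f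
  map_add' f g := by
    refine berezin_eq ((isBerezinOperator_iff μ hw hw1 _ _).2 ?_)
    exact (((isBerezinOperator_iff μ hw hw1 _ _).1 (isBerezinOperator_berezin μ hw hw1 hs f)).add
      ((isBerezinOperator_iff μ hw hw1 _ _).1 (isBerezinOperator_berezin μ hw hw1 hs g))).congr_ae
      (Lp.coeFn_add f g).symm
  map_smul' c f := by
    refine berezin_eq ((isBerezinOperator_iff μ hw hw1 _ _).2 ?_)
    exact (((isBerezinOperator_iff μ hw hw1 _ _).1
      (isBerezinOperator_berezin μ hw hw1 hs f)).smul c).congr_ae (Lp.coeFn_smul c f).symm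

theorem schattenNorm_berezin_le {w : G → ℂ} (hw : IsSchwartz (E := E) w)
    (hw1 : eLpNorm w 2 μ = 1) {s : ℝ≥0∞} (hs : 1 ≤ s) (f : Lp ℂ s (phaseMeasure E μ)) :
    schattenNorm s (berezin μ w f) ≤ ‖f‖ₑ := by
  rw [Lp.enorm_def]
  exact (isCoherentFamily_coherentVector μ hw hw1).schattenNorm_le (Lp.stronglyMeasurable f) hs
    (Lp.memLp f)
    ((isBerezinOperator_iff μ hw hw1 _ _).1 (isBerezinOperator_berezin μ hw hw1 hs f))

theorem hasTrace_berezin {w : G → ℂ} (hw : IsSchwartz (E := E) w)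
    (hw1 : eLpNorm w 2 μ = 1) (f : Lp ℂ 1 (phaseMeasure E μ)) :
    HasTrace (berezin μ w f) (∫ p, f p ∂(phaseMeasure E μ)) := by
  have := sigmaFinite_of_expHomeo (E := E) μ 0
  -- Needed for the instance making `L²(G)` second countable, hence separable.
  have : Fact ((2 : ℝ≥0∞) ≠ ⊤) := ⟨by norm_num⟩
  have : SecondCountableTopology (Lp ℂ 2 μ) := inferInstance
  exact (isCoherentFamily_coherentVector μ hw hw1).hasTrace (memLp_one_iff_integrable.1 (Lp.memLp f))
    ((isBerezinOperator_iff μ hw hw1 _ _).1 (isBerezinOperator_berezin μ hw hw1 le_rfl f))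

end BerezinOperators

end Berezin

theorem theorem4p2
    {E : Type*} [NormedAddCommGroup E] [NormedSpace ℝ E] [FiniteDimensional ℝ E]
    [MeasurableSpace E] [BorelSpace E]
    {G : Type*} [TopologicalSpace G] [T2Space G] [SecondCountableTopology G]
    [ChartedSpace E G] [Group G] [LieGroup 𝓘(ℝ, E) ∞ G]
    [SimplyConnectedSpace G] [LieRing.IsNilpotent (GroupLieAlgebra 𝓘(ℝ, E) G)]
    [MeasurableSpace G] [BorelSpace G]
    (μ : Measure G) [μ.IsHaarMeasure]
    (w : G → ℂ) (hw : Berezin.IsSchwartz (E := E) w) (hw1 : eLpNorm w 2 μ = 1) :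
    (∀ s : ℝ≥0∞, 1 ≤ s →
      (∀ f : Lp ℂ s (Berezin.phaseMeasure E μ),
        Berezin.IsBerezinOperator μ w f (Berezin.berezin μ w f)) ∧
      (∃ B : Lp ℂ s (Berezin.phaseMeasure E μ) →ₗ[ℂ] (Lp ℂ 2 μ →L[ℂ] Lp ℂ 2 μ),
        ∀ f, B f = Berezin.berezin μ w f) ∧
      (∀ f : Lp ℂ s (Berezin.phaseMeasure E μ),
        Berezin.MemSchatten s (Berezin.berezin μ w f) ∧
        Berezin.schattenNorm s (Berezin.berezin μ w f) ≤ 4 ^ (1 / s).toReal * ‖f‖ₑ)) ∧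
    (∀ f : Lp ℂ 1 (Berezin.phaseMeasure E μ),
      Berezin.MemSchatten 1 (Berezin.berezin μ w f) ∧
      Berezin.HasTrace (Berezin.berezin μ w f) (∫ p, f p ∂(Berezin.phaseMeasure E μ))) := by
  have hmem : ∀ s : ℝ≥0∞, 1 ≤ s → ∀ f : Lp ℂ s (Berezin.phaseMeasure E μ),
      Berezin.MemSchatten s (Berezin.berezin μ w f) := fun s hs f =>
    (Berezin.schattenNorm_berezin_le μ hw hw1 hs f).trans_lt
      (by rw [Lp.enorm_def]; exact (Lp.memLp f).2)
  refine ⟨fun s hs => ⟨Berezin.isBerezinOperator_berezin μ hw hw1 hs,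
    ⟨Berezin.berezinLinearMap μ hw hw1 hs, fun f => rfl⟩, fun f => ⟨hmem s hs f, ?_⟩⟩,
    fun f => ⟨hmem 1 le_rfl f, Berezin.hasTrace_berezin μ hw hw1 f⟩⟩
  refine (Berezin.schattenNorm_berezin_le μ hw hw1 hs f).trans ?_
  -- The estimate already holds with constant 1, and `4^(1/s) ≥ 4^0 = 1`.
  exact le_mul_of_one_le_left' ((ENNReal.rpow_zero (x := 4)).symm.le.trans
    (ENNReal.rpow_le_rpow_of_exponent_le (by norm_num) ENNReal.toReal_nonneg))
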